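/- For $\alpha\in(0,1)$ let $T_\alpha\colon[0,1]\to[0,1]$ be the Liverani–Saussol–Vaienti map $$T_\alpha(x)=\begin{cases} x(1+2^\alpha x^\alpha), & x\in[0,1/2],\\ 2x-1, & x\in(1/2,1].\end{cases}$$ Each $T_\alpha$, $\alpha\in(0,1)$, admits a unique invariant probability measure $\nu_\alpha$ on $[0,1]$ that is absolutely continuous with respect to Lebesgue measure. Its density has a version $\rho_\alpha\ge 0$ such that the following holds. For every $(\alpha,x)\in(0,1)\times(0,1]$ there exists a partial derivative $\partial_\alpha\rho_\alpha(x)$, and both $\rho_\alpha(x)$ and $\partial_\alpha\rho_\alpha(x)$ are jointly continuous in $(\alpha,x)$ on $(0,1)\times(0,1]$. Moreover, for every interval $[\alpha_-,\alpha_+]\subset(0,1)$ with $\alpha_-<\alpha_+$ there exists a constant $K$ such that for all $x\in(0,1]$ and $\alpha\in[\alpha_-,\alpha_+]$ $$\rho_\alpha(x)\le K\,x^{-\alpha}\qquad\text{and}\qquad |\partial_\alpha\rho_\alpha(x)|\le K\,x^{-\alpha}(1-\log x).$$ In particular, for any $q\in((1-\alpha_+)^{-1},\infty]$ and any real-valued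 observable $\varphi\in L^q[0,1]$, the function $\varphi$ is $\nu_\alpha$-integrable for every $\alpha\in[\alpha_-,\alpha_+]$, and the map $\alpha\mapsto\int\varphi\,d\nu_\alpha$ is continuously differentiable on $[\alpha_-,\alpha_+]$. -/

import Mathlib

open Set MeasureTheory

/-- The Liverani–Saussol–Vaienti map `T_α`. It is used on `[0,1]` only, see `lsvMap_mapsTo`. -/
noncomputable def lsvMap (α x : ℝ) : ℝ :=
  if x ≤ 1 / 2 then x * (1 + (2 : ℝ) ^ α * x ^ α) else 2 * x - 1

theorem lsvMap_mapsTo {α : ℝ} (hα : 0 < α) : MapsTo (lsvMap α) (Icc 0 1) (Icc 0 1) := by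
  rintro x ⟨h0, h1⟩
  unfold lsvMap
  split_ifs with h
  · have e : (2 : ℝ) ^ α * x ^ α = (2 * x) ^ α := (Real.mul_rpow (by norm_num) h0).symm
    have p : 0 ≤ (2 * x) ^ α := Real.rpow_nonneg (by linarith) α
    have q : (2 * x) ^ α ≤ 1 := Real.rpow_le_one (by linarith) (by linarith) hα.le
    rw [e]
    constructor
    · positivity
    · nlinarith
  · constructor <;> linarith

theorem measurable_lsvMap (α : ℝ) : Measurable (lsvMap α) := by
  unfold lsvMap
  refine Measurable.ite measurableSet_Iic ?_ ?_ <;> fun_prop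

/-- `ν` is a `T_α`-invariant probability measure on `[0,1]` that is absolutely continuous with
respect to Lebesgue measure on `[0,1]`. -/
structure IsLSVAcip (α : ℝ) (ν : Measure ℝ) : Prop where
  isProbabilityMeasure : IsProbabilityMeasure ν
  absolutelyContinuous : ν ≪ volume.restrict (Icc (0 : ℝ) 1)
  measurePreserving : MeasurePreserving (lsvMap α) ν ν

/-! The regularity in α comes from holomorphy. The exponent is allowed to be complex near a real
one, the densities are shown to extend to jointly holomorphic functions of (α, z), and derivatives
in α are then controlled by Cauchy estimates.

The map is induced on (1/2, 1]. Its first return map has the inverse branches z ↦ (1 + gⁿ z)/2,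
where g is the inverse left branch of T_α, and the transfer operator L u(z) = ∑ₙ (gⁿ)'(z)/2 · u((1 +
gⁿ z)/2). In the coordinate v = -α log (2z) the left branch reads V ↦ V - α log (1 + e^{-V}), so g
is obtained from a fixed point argument on a half-strip, which it preserves also for complex α
(`GoodExponent.step_spec`). Along orbits of g the quantity e^{Re v} grows at least linearly. This
gives |(gⁿ)'| = O(n^{-κ}) with κ > 1 (`GoodExponent.norm_jac_le`), and ∑ₙ |(gⁿ)'(x)| = O(x^{-α}) for
real α.

For real α the branches contract by 1/2 with distortion bounded uniformly in n
(`GoodExponent.norm_invDeriv_le_exp_mul`), so L contracts a cone of functions with Lipschitz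
logarithm on [1/2, 1], and it preserves the Lebesgue mean m (`InvariantMean.abs_iterate_le`). Let K
u = L u - m(u). Some power of K halves sup norms of bounded holomorphic functions near [1/2, 1]
(`exists_iterate_lsvRemainder_le_half`). By the Schwarz lemma in the parameter the same power is a
3/4-contraction for nearby complex exponents, so the Neumann series h = ∑ₖ Kᵏ 1 converges to a
jointly holomorphic function with h = 1 + K h. For real α, taking means gives m(h) = 1, and then L h
= h.

The series L h also converges on (0, 1]. Separating its term n = 0 shows that ρ = L h is an
invariant density of T_α, up to normalisation. A complex exponent β with |β - α|(1 - log x) small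
keeps x in the domain and |x^{-β}| comparable to x^{-α}; Cauchy's estimate on this disc yields the
factor 1 - log x (`exists_local_bound_lsvDensity`).

Uniqueness follows from ergodicity: Lᵏ v → m(v) h forces every invariant set to be null or conull.
Finally, integrals of φ are differentiated under the integral sign with the majorant x^{-b}|φ|,
which is integrable by Hölder's inequality. -/

open Filter Topology Metric


/-! ### Cauchy and Schwarz estimates on complex normed spaces -/

section HolomorphicSeveralVariables

variable {E : Type*} [NormedAddCommGroup E] [NormedSpace ℂ E]

/-- A Cauchy estimate obtained from the Schwarz lemma: values of f stay within 2M of f c. -/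
theorem norm_fderiv_le_of_norm_le_ball {f : E → ℂ} {c : E} {R M : ℝ} (hR : 0 < R)
    (hd : DifferentiableOn ℂ f (ball c R)) (hM : ∀ w ∈ ball c R, ‖f w‖ ≤ M) :
    ‖fderiv ℂ f c‖ ≤ 2 * M / R := by
  refine Complex.norm_fderiv_le_div_of_mapsTo_ball hd (fun w hw => ?_) hR
  rw [mem_closedBall, dist_eq_norm]
  linarith [norm_sub_le (f w) (f c), hM w hw, hM c (mem_ball_self hR)]

theorem dist_le_of_norm_le_ball {f : E → ℂ} {c z : E} {R M : ℝ}
    (hd : DifferentiableOn ℂ f (ball c R)) (hM : ∀ w ∈ ball c R, ‖f w‖ ≤ M) (hz : z ∈ ball c R) :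
    ‖f z - f c‖ ≤ 2 * M / R * ‖z - c‖ := by
  have hR : 0 < R := nonempty_ball.mp ⟨_, hz⟩
  have := Complex.dist_le_div_mul_dist_of_mapsTo_ball (R₂ := 2 * M) hd (fun w hw => ?_) hz
  · rwa [dist_eq_norm, dist_eq_norm] at this
  · rw [mem_closedBall, dist_eq_norm]
    linarith [norm_sub_le (f w) (f c), hM w hw, hM c (mem_ball_self hR)]

/-- Weierstrass M-test for holomorphic functions on open subsets of a complex normed space. -/
theorem differentiableOn_tsum_of_norm_le {F : ℕ → E → ℂ} {u : ℕ → ℝ} {Ω : Set E}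
    (hu : Summable u) (hΩ : IsOpen Ω) (hF : ∀ i, DifferentiableOn ℂ (F i) Ω)
    (hle : ∀ i, ∀ w ∈ Ω, ‖F i w‖ ≤ u i) :
    DifferentiableOn ℂ (fun w => ∑' i, F i w) Ω := by
  intro x hx
  obtain ⟨R, hR, hsub⟩ := Metric.isOpen_iff.1 hΩ x hx
  have hsub' : ∀ y ∈ ball x (R / 2), ball y (R / 2) ⊆ Ω := fun y hy =>
    (ball_subset_ball' (by rw [mem_ball] at hy; linarith)).trans hsub
  have hR2 : 0 < R / 2 := by positivity
  have hmem : ∀ y ∈ ball x (R / 2), y ∈ Ω := fun y hy => hsub' y hy (mem_ball_self hR2)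
  let : NormedSpace ℝ E := NormedSpace.restrictScalars ℝ ℂ E
  refine (hasFDerivAt_tsum_of_isPreconnected (𝕜 := ℂ) (u := fun i => 2 * u i / (R / 2))
    (f' := fun i => fderiv ℂ (F i)) (x₀ := x) (s := ball x (R / 2))
    ((hu.mul_left 2).div_const _) isOpen_ball (convex_ball x _).isPreconnected ?_ ?_
    (mem_ball_self hR2) ?_ (mem_ball_self hR2)).differentiableAt.differentiableWithinAt
  · exact fun i y hy => ((hF i).differentiableAt (hΩ.mem_nhds (hmem y hy))).hasFDerivAt
  · exact fun i y hy => norm_fderiv_le_of_norm_le_ball hR2 ((hF i).mono (hsub' y hy))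
      fun w hw => hle i w (hsub' y hy hw)
  · exact Summable.of_norm_bounded hu fun i => hle i x hx

/-- The difference of the derivatives at y and x is the derivative at x of w ↦ f (w + (y - x)) - f
w. This function is O(‖y - x‖) by the Schwarz lemma, so the Cauchy estimate applies to it. -/
theorem continuousOn_fderiv_of_differentiableOn {f : E → ℂ} {Ω : Set E} (hΩ : IsOpen Ω)
    (hf : DifferentiableOn ℂ f Ω) : ContinuousOn (fderiv ℂ f) Ω := by
  intro x hx
  refine ContinuousAt.continuousWithinAt ?_
  obtain ⟨R, hR, hsub⟩ := Metric.mem_nhds_iff.1 (inter_mem (hΩ.mem_nhds hx)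
    ((hf.continuousOn.continuousAt (hΩ.mem_nhds hx)).norm.preimage_mem_nhds
      (Iio_mem_nhds (lt_add_one ‖f x‖))))
  have hΩs : ball x R ⊆ Ω := fun y hy => (hsub hy).1
  have hb : ∀ y ∈ ball x R, ‖f y‖ ≤ ‖f x‖ + 1 := fun y hy => (hsub hy).2.le
  set M := ‖f x‖ + 1
  have hM : 0 ≤ M := by positivity
  set δ := R / 4 with hδ
  have hδ0 : 0 < δ := by positivity
  have key : ∀ y ∈ ball x δ, ‖fderiv ℂ f y - fderiv ℂ f x‖
      ≤ 2 * (2 * M / δ * ‖y - x‖) / δ := by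
    intro y hy
    rw [mem_ball, dist_eq_norm] at hy
    have hsh : ∀ w ∈ ball x δ, w + (y - x) ∈ ball x R := fun w hw => by
      rw [mem_ball, dist_eq_norm] at hw ⊢
      have e : w + (y - x) - x = (w - x) + (y - x) := by abel
      rw [e]
      linarith [norm_add_le (w - x) (y - x)]
    have hin : ball x δ ⊆ ball x R := ball_subset_ball (by linarith)
    have hd1 : DifferentiableOn ℂ (fun w => f (w + (y - x))) (ball x δ) :=
      (hf.mono hΩs).comp (by fun_prop) hsh
    have hd2 : DifferentiableOn ℂ f (ball x δ) := hf.mono (hin.trans hΩs)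
    have h1 := norm_fderiv_le_of_norm_le_ball (f := fun w => f (w + (y - x)) - f w)
      (M := 2 * M / δ * ‖y - x‖) hδ0 (hd1.sub hd2) (fun w hw => ?_)
    · have e1 : fderiv ℂ (fun w => f (w + (y - x)) - f w) x = fderiv ℂ f y - fderiv ℂ f x := by
        rw [fderiv_fun_sub (hd1.differentiableAt (ball_mem_nhds _ hδ0))
          (hd2.differentiableAt (ball_mem_nhds _ hδ0)), fderiv_comp_add_right]
        simp
      rwa [e1] at h1
    · have hsub2 : ball w δ ⊆ ball x R := ball_subset_ball' (by
        rw [mem_ball] at hw; linarith)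
      have := dist_le_of_norm_le_ball (z := w + (y - x)) (hf.mono (hsub2.trans hΩs))
        (fun v hv => hb v (hsub2 hv)) (by simpa [mem_ball, dist_eq_norm] using hy)
      simpa using this
  rw [ContinuousAt, tendsto_iff_norm_sub_tendsto_zero]
  refine squeeze_zero' (Eventually.of_forall fun _ => norm_nonneg _)
    (mem_of_superset (ball_mem_nhds x hδ0) key) ?_
  have : Tendsto (fun y => ‖y - x‖) (𝓝 x) (𝓝 0) := by
    simpa using
      ((continuous_id.sub continuous_const).norm.tendsto x : Tendsto (fun y => ‖y - x‖) _ _)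
  simpa using ((this.const_mul (2 * M / δ)).const_mul 2).div_const δ

end HolomorphicSeveralVariables

theorem hasDerivAt_fst_of_differentiableOn {f : ℂ × ℂ → ℂ} {Ω : Set (ℂ × ℂ)} (hΩ : IsOpen Ω)
    (hf : DifferentiableOn ℂ f Ω) {p : ℂ × ℂ} (hp : p ∈ Ω) :
    HasDerivAt (fun a => f (a, p.2)) (fderiv ℂ f p (1, 0)) p.1 := by
  have h1 : HasFDerivAt f (fderiv ℂ f p) (p.1, p.2) :=
    (hf.differentiableAt (hΩ.mem_nhds hp)).hasFDerivAt
  have h2 : HasDerivAt (fun a : ℂ => (a, p.2)) ((1 : ℂ), (0 : ℂ)) p.1 :=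
    (hasDerivAt_id p.1).prodMk (hasDerivAt_const p.1 p.2)
  exact h1.comp_hasDerivAt p.1 h2

/-- A parameter integral of a bounded jointly holomorphic function is holomorphic. -/
theorem differentiableOn_intervalIntegral_of_bounded {u : ℂ × ℂ → ℂ} {B W : Set ℂ} {a b M : ℝ}
    (hB : IsOpen B) (hW : IsOpen W) (hab : a ≤ b) (hI : ∀ x ∈ Icc a b, (x : ℂ) ∈ W)
    (hu : DifferentiableOn ℂ u (B ×ˢ W)) (hM : ∀ p ∈ B ×ˢ W, ‖u p‖ ≤ M) :
    DifferentiableOn ℂ (fun α => ∫ x in a..b, u (α, (x : ℂ))) B := by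
  intro α hα
  obtain ⟨R, hR, hsub⟩ := Metric.isOpen_iff.1 hB α hα
  have hR2 : 0 < R / 2 := by positivity
  have hsub' : ∀ y ∈ ball α (R / 2), ball y (R / 2) ⊆ B := fun y hy =>
    (ball_subset_ball' (by rw [mem_ball] at hy; linarith)).trans hsub
  have hmem : ∀ y ∈ ball α (R / 2), y ∈ B := fun y hy => hsub' y hy (mem_ball_self hR2)
  have hΩ := hB.prod hW
  have hcu : ∀ y ∈ ball α (R / 2), ContinuousOn (fun x : ℝ => u (y, (x : ℂ))) (Icc a b) :=
    fun y hy => hu.continuousOn.comp (by fun_prop) fun x hx => ⟨hmem y hy, hI x hx⟩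
  have hcd : ContinuousOn (fun x : ℝ => fderiv ℂ u (α, (x : ℂ)) (1, 0)) (Icc a b) :=
    ((continuousOn_fderiv_of_differentiableOn hΩ hu).comp
      (f := fun x : ℝ => (α, (x : ℂ))) (by fun_prop)
      fun x hx => ⟨hα, hI x hx⟩).clm_apply continuousOn_const
  have hIoc : uIoc a b ⊆ Icc a b := by rw [uIoc_of_le hab]; exact Ioc_subset_Icc_self
  refine (intervalIntegral.hasDerivAt_integral_of_dominated_loc_of_deriv_le
    (F' := fun y x => fderiv ℂ u (y, (x : ℂ)) (1, 0)) (bound := fun _ => 2 * M / (R / 2))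
    (ball_mem_nhds α hR2) ?_ ?_ ?_ ?_ ?_ ?_).2.differentiableAt.differentiableWithinAt
  · filter_upwards [ball_mem_nhds α hR2] with y hy
    exact ((hcu y hy).mono hIoc).aestronglyMeasurable measurableSet_uIoc
  · exact ContinuousOn.intervalIntegrable (by rw [uIcc_of_le hab]; exact hcu α (mem_ball_self hR2))
  · exact (hcd.mono hIoc).aestronglyMeasurable measurableSet_uIoc
  · refine Eventually.of_forall fun x hx y hy => ?_
    have h1 := hasDerivAt_fst_of_differentiableOn hΩ hu (p := (y, (x : ℂ)))
      ⟨hmem y hy, hI x (hIoc hx)⟩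
    rw [← h1.deriv, norm_deriv_eq_norm_fderiv]
    refine norm_fderiv_le_of_norm_le_ball hR2 ?_ ?_
    · exact hu.comp (f := fun a : ℂ => (a, (x : ℂ))) (by fun_prop)
        fun w hw => ⟨hsub' y hy hw, hI x (hIoc hx)⟩
    · exact fun w hw => hM _ ⟨hsub' y hy hw, hI x (hIoc hx)⟩
  · exact intervalIntegrable_const
  · refine Eventually.of_forall fun x hx y hy => ?_
    exact hasDerivAt_fst_of_differentiableOn hΩ hu (p := (y, (x : ℂ))) ⟨hmem y hy, hI x (hIoc hx)⟩


/-! ### Contraction of cones of functions with Lipschitz logarithm -/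

section WeightedComposition

/-- The operator `u ↦ ∑ₙ wₙ · (u ∘ φₙ)`. -/
noncomputable def weightedComp {Z R : Type*} [NormedField R] (w : ℕ → Z → R) (φ : ℕ → Z → Z)
    (u : Z → R) (z : Z) : R :=
  ∑' n, w n z * u (φ n z)

theorem iterate_weightedComp_const_mul {Z : Type*} {φ : ℕ → Z → Z} (c : ℕ → Z → ℂ)
    (u : Z → ℂ) (a : ℂ) (k : ℕ) :
    (weightedComp c φ)^[k] (fun z => a * u z) = fun z => a * (weightedComp c φ)^[k] u z := by
  induction k with
  | zero => rfl
  | succ k ih =>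
    simp only [Function.iterate_succ_apply', ih]
    funext z
    unfold weightedComp
    rw [← tsum_mul_left]
    exact tsum_congr fun n => mul_left_comm _ _ _

variable {Z : Type*} [PseudoMetricSpace Z]

/-- Nonnegative functions on `s` whose logarithm is `D`-Lipschitz. -/
structure LogLip (D : ℝ) (s : Set Z) (u : Z → ℝ) : Prop where
  nonneg : ∀ x ∈ s, 0 ≤ u x
  le : ∀ x ∈ s, ∀ y ∈ s, u x ≤ Real.exp (D * dist x y) * u y

/-- Weights and `1/2`-contractions on a bounded set `s`, the weights with uniformly Lipschitz
logarithms. -/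
structure ContractingWeights (w : ℕ → Z → ℝ) (φ : ℕ → Z → Z) (s : Set Z) (K d : ℝ) : Prop where
  nonneg : ∀ n, ∀ x ∈ s, 0 ≤ w n x
  mapsTo : ∀ n, MapsTo (φ n) s s
  contr : ∀ n, ∀ x ∈ s, ∀ y ∈ s, dist (φ n x) (φ n y) ≤ dist x y / 2
  distortion : ∀ n, ∀ x ∈ s, ∀ y ∈ s, w n x ≤ Real.exp (K * dist x y) * w n y
  summable : ∀ x ∈ s, Summable fun n => w n x
  diam : ∀ x ∈ s, ∀ y ∈ s, dist x y ≤ d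

variable {w : ℕ → Z → ℝ} {φ : ℕ → Z → Z} {s t : Set Z} {K d D D' b : ℝ} {u v : Z → ℝ}

theorem ContractingWeights.mono (h : ContractingWeights w φ s K d) (hts : t ⊆ s)
    (ht : ∀ n, MapsTo (φ n) t t) : ContractingWeights w φ t K d where
  nonneg n x hx := h.nonneg n x (hts hx)
  mapsTo := ht
  contr n x hx y hy := h.contr n x (hts hx) y (hts hy)
  distortion n x hx y hy := h.distortion n x (hts hx) y (hts hy)
  summable x hx := h.summable x (hts hx)
  diam x hx y hy := h.diam x (hts hx) y (hts hy)

theorem ContractingWeights.summable_mul (h : ContractingWeights w φ s K d)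
    (hu : ∀ x ∈ s, |u x| ≤ b) {x : Z} (hx : x ∈ s) : Summable fun n => w n x * u (φ n x) := by
  refine Summable.of_norm_bounded ((h.summable x hx).mul_right b) fun n => ?_
  rw [Real.norm_eq_abs, abs_mul, abs_of_nonneg (h.nonneg n x hx)]
  exact mul_le_mul_of_nonneg_left (hu _ (h.mapsTo n hx)) (h.nonneg n x hx)

theorem LogLip.exists_bound (hu : LogLip D s u) (hD : 0 ≤ D) (hd : ∀ x ∈ s, ∀ y ∈ s, dist x y ≤ d) :
    ∃ b, ∀ x ∈ s, |u x| ≤ b := by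
  rcases s.eq_empty_or_nonempty with rfl | ⟨y, hy⟩
  · exact ⟨0, by simp⟩
  refine ⟨Real.exp (D * d) * u y, fun x hx => ?_⟩
  rw [abs_of_nonneg (hu.nonneg x hx)]
  refine (hu.le x hx y hy).trans (mul_le_mul_of_nonneg_right ?_ (hu.nonneg y hy))
  exact Real.exp_le_exp.2 (mul_le_mul_of_nonneg_left (hd x hx y hy) hD)

theorem LogLip.mono (hu : LogLip D s u) (h : D ≤ D') : LogLip D' s u where
  nonneg := hu.nonneg
  le := fun x hx y hy => (hu.le x hx y hy).trans (mul_le_mul_of_nonneg_right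
    (Real.exp_le_exp.2 (mul_le_mul_of_nonneg_right h dist_nonneg)) (hu.nonneg y hy))

theorem LogLip.const (hD : 0 ≤ D) (hb : 0 ≤ b) : LogLip D s fun _ : Z => b where
  nonneg := fun _ _ => hb
  le := fun _ _ _ _ => le_mul_of_one_le_left hb (Real.one_le_exp (mul_nonneg hD dist_nonneg))

/-- The contraction of the branches halves the Lipschitz constant of log u and the weights add K.
For D > 2K the cone is therefore mapped well inside itself. -/
theorem LogLip.weightedComp (hu : LogLip D s u) (hD : 0 ≤ D) (h : ContractingWeights w φ s K d) :
    LogLip (D / 2 + K) s (weightedComp w φ u) where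
  nonneg x hx := tsum_nonneg fun n => mul_nonneg (h.nonneg n x hx) (hu.nonneg _ (h.mapsTo n hx))
  le x hx y hy := by
    obtain ⟨b, hb⟩ := hu.exists_bound hD h.diam
    unfold _root_.weightedComp
    rw [← tsum_mul_left]
    refine (h.summable_mul hb hx).tsum_le_tsum (fun n => ?_) ((h.summable_mul hb hy).mul_left _)
    have h1 := h.distortion n x hx y hy
    have h2 := hu.le _ (h.mapsTo n hx) _ (h.mapsTo n hy)
    have h3 : Real.exp (D * dist (φ n x) (φ n y)) ≤ Real.exp (D * (dist x y / 2)) :=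
      Real.exp_le_exp.2 (mul_le_mul_of_nonneg_left (h.contr n x hx y hy) hD)
    have h4 := h.nonneg n y hy
    have h5 := hu.nonneg _ (h.mapsTo n hy)
    calc w n x * u (φ n x)
        ≤ (Real.exp (K * dist x y) * w n y) * (Real.exp (D * (dist x y / 2)) * u (φ n y)) := by
          refine mul_le_mul h1 (h2.trans (mul_le_mul_of_nonneg_right h3 h5))
            (hu.nonneg _ (h.mapsTo n hx)) (by positivity)
      _ = Real.exp ((D / 2 + K) * dist x y) * (w n y * u (φ n y)) := by
          rw [show (D / 2 + K) * dist x y = K * dist x y + D * (dist x y / 2) by ring, Real.exp_add]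
          ring

theorem LogLip.iterate (hu : LogLip D s u) (hD : 0 ≤ D) (hKD : D / 2 + K ≤ D)
    (h : ContractingWeights w φ s K d) (k : ℕ) : LogLip D s ((_root_.weightedComp w φ)^[k] u) := by
  induction k with
  | zero => exact hu
  | succ k ih =>
    rw [Function.iterate_succ_apply']
    exact (ih.weightedComp hD h).mono hKD

/-- The gap between D' and D leaves room for subtracting part of a lower bound of u. The factor is
what e^{Dτ} - 1 ≤ Dτ e^{Dd} allows against e^{Dτ} - e^{D'τ} ≥ (D - D')τ. -/
theorem LogLip.sub_const (hu : LogLip D' s u) (hD' : 0 ≤ D') (hDD : D' < D)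
    (hd : ∀ x ∈ s, ∀ y ∈ s, dist x y ≤ d) {c : ℝ} (hc : 0 ≤ c) (hcu : ∀ x ∈ s, c ≤ u x) :
    LogLip D s fun x => u x - (D - D') / D * Real.exp (-(D * d)) * c := by
  have hD : 0 < D := hD'.trans_lt hDD
  set ε := (D - D') / D * Real.exp (-(D * d)) with hε
  have hε0 : 0 ≤ ε := mul_nonneg (div_nonneg (by linarith) hD.le) (Real.exp_pos _).le
  refine ⟨fun x hx => ?_, fun x hx y hy => ?_⟩
  · have hd0 : 0 ≤ d := dist_nonneg.trans (hd x hx x hx)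
    have h1 : ε ≤ 1 := by
      rw [hε]
      refine mul_le_one₀ ((div_le_one hD).2 (by linarith)) (Real.exp_pos _).le ?_
      exact Real.exp_le_one_iff.2 (by nlinarith)
    nlinarith [hcu x hx]
  · set τ := dist x y
    have hτ : 0 ≤ τ := dist_nonneg
    have hτd : τ ≤ d := hd x hx y hy
    have e1 : Real.exp (D * τ) = Real.exp (D' * τ) * Real.exp ((D - D') * τ) := by
      rw [← Real.exp_add]; ring_nf
    have e2 : (D - D') * τ ≤ Real.exp ((D - D') * τ) - 1 := by
      linarith [Real.add_one_le_exp ((D - D') * τ)]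
    have e3 : 1 ≤ Real.exp (D' * τ) := Real.one_le_exp (by positivity)
    have e4 : (D - D') * τ ≤ Real.exp (D * τ) - Real.exp (D' * τ) := by
      rw [e1]; nlinarith [mul_nonneg (sub_nonneg.2 hDD.le) hτ]
    have e5 : Real.exp (D * τ) - 1 ≤ D * τ * Real.exp (D * d) := by
      have := Real.add_one_le_exp (-(D * τ))
      have h2 : Real.exp (D * τ) * Real.exp (-(D * τ)) = 1 := by rw [← Real.exp_add]; simp
      have h3 : Real.exp (D * τ) ≤ Real.exp (D * d) := Real.exp_le_exp.2 (by nlinarith)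
      have h4 := Real.exp_pos (D * τ)
      have h5 : 0 ≤ D * τ := by positivity
      nlinarith
    have e6 : ε * (Real.exp (D * τ) - 1) ≤ (D - D') * τ := by
      calc ε * (Real.exp (D * τ) - 1) ≤ ε * (D * τ * Real.exp (D * d)) :=
            mul_le_mul_of_nonneg_left e5 hε0
        _ = (D - D') * τ * (Real.exp (-(D * d)) * Real.exp (D * d)) := by
            rw [hε]; field_simp
        _ = (D - D') * τ := by rw [← Real.exp_add]; simp
    have h1 := hu.le x hx y hy
    have h2 := hcu y hy
    have h3 : 0 ≤ Real.exp (D * τ) - Real.exp (D' * τ) := by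
      nlinarith [mul_nonneg (sub_nonneg.2 hDD.le) hτ]
    have h4 : ε * (Real.exp (D * τ) - 1) * c ≤ (Real.exp (D * τ) - Real.exp (D' * τ)) * u y :=
      mul_le_mul (e6.trans e4) h2 hc h3
    nlinarith

/-- A mean value for functions with Lipschitz logarithm that a weighted composition operator
preserves. -/
structure InvariantMean (m : (Z → ℝ) → ℝ) (w : ℕ → Z → ℝ) (φ : ℕ → Z → Z) (s : Set Z)
    (D d : ℝ) : Prop where
  map_const : ∀ c : ℝ, m (fun _ => c) = c
  map_sub_const : ∀ u, LogLip D s u → ∀ c : ℝ, m (fun x => u x - c) = m u - c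
  map_weightedComp : ∀ u, LogLip D s u → m (weightedComp w φ u) = m u
  lower : ∀ u, LogLip D s u → ∀ x ∈ s, Real.exp (-(D * d)) * m u ≤ u x
  upper : ∀ u, LogLip D s u → ∀ x ∈ s, u x ≤ Real.exp (D * d) * m u
  nonneg : ∀ u, LogLip D s u → 0 ≤ m u

variable {m : (Z → ℝ) → ℝ}

/-- The contraction factor of a weighted composition operator on the cone of functions with
`D`-Lipschitz logarithm. -/
noncomputable def coneRate (K D d : ℝ) : ℝ :=
  1 - (D - (D / 2 + K)) / D * Real.exp (-(D * d)) * Real.exp (-(D * d))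

/-- A coupling argument. After each application of the operator the same constant is subtracted from
both functions: their difference is unaffected, both stay in the cone, and their common mean shrinks
by the factor `coneRate K D d`. -/
theorem InvariantMean.exists_sub_eq (hm : InvariantMean m w φ s D d)
    (h : ContractingWeights w φ s K d) (hK : 0 ≤ K) (hD : 0 < D) (hKD : D / 2 + K < D)
    (hu : LogLip D s u) (hv : LogLip D s v) (huv : m u = m v) (k : ℕ) :
    ∃ u' v', LogLip D s u' ∧ LogLip D s v' ∧ m u' = coneRate K D d ^ k * m u ∧
      m v' = coneRate K D d ^ k * m u ∧
      ∀ x ∈ s, (weightedComp w φ)^[k] u x - (weightedComp w φ)^[k] v x = u' x - v' x := by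
  induction k with
  | zero => exact ⟨u, v, hu, hv, by simp, by simp [huv], fun x _ => rfl⟩
  | succ k ih =>
    obtain ⟨u', v', hu', hv', hmu, hmv, he⟩ := ih
    -- A lower bound for the images of both u' and v', which share the same mean.
    set c := Real.exp (-(D * d)) * (coneRate K D d ^ k * m u) with hc
    set ε := (D - (D / 2 + K)) / D * Real.exp (-(D * d)) with hε
    have hTu := hu'.weightedComp hD.le h
    have hTv := hv'.weightedComp hD.le h
    have hTu' := hTu.mono hKD.le
    have hTv' := hTv.mono hKD.le
    have hmTu : m (weightedComp w φ u') = coneRate K D d ^ k * m u := by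
      rw [hm.map_weightedComp u' hu', hmu]
    have hmTv : m (weightedComp w φ v') = coneRate K D d ^ k * m u := by
      rw [hm.map_weightedComp v' hv', hmv]
    have hc0 : 0 ≤ c := mul_nonneg (Real.exp_pos _).le (hmu ▸ hm.nonneg u' hu')
    have hcr : (coneRate K D d) ^ k * m u - ε * c = coneRate K D d ^ (k + 1) * m u := by
      have aux : ∀ r ε E q : ℝ, r = 1 - ε * E → q - ε * (E * q) = r * q := by
        rintro r ε E q rfl; ring
      rw [pow_succ', mul_assoc (coneRate K D d)]
      exact aux (coneRate K D d) ε (Real.exp (-(D * d))) (coneRate K D d ^ k * m u) rfl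
    refine ⟨fun x => weightedComp w φ u' x - ε * c, fun x => weightedComp w φ v' x - ε * c,
      hTu.sub_const (by positivity) hKD h.diam hc0 fun x hx => ?_,
      hTv.sub_const (by positivity) hKD h.diam hc0 fun x hx => ?_, ?_, ?_, fun x hx => ?_⟩
    · rw [hc, ← hmTu]; exact hm.lower _ hTu' x hx
    · rw [hc, ← hmTv]; exact hm.lower _ hTv' x hx
    · rw [hm.map_sub_const _ hTu', hmTu, hcr]
    · rw [hm.map_sub_const _ hTv', hmTv, hcr]
    · rw [Function.iterate_succ_apply', Function.iterate_succ_apply']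
      obtain ⟨b1, hb1⟩ := (hu.iterate hD.le hKD.le h k).exists_bound hD.le h.diam
      obtain ⟨b2, hb2⟩ := (hv.iterate hD.le hKD.le h k).exists_bound hD.le h.diam
      obtain ⟨b3, hb3⟩ := hu'.exists_bound hD.le h.diam
      obtain ⟨b4, hb4⟩ := hv'.exists_bound hD.le h.diam
      have e : weightedComp w φ ((weightedComp w φ)^[k] u) x
          - weightedComp w φ ((weightedComp w φ)^[k] v) x
          = weightedComp w φ u' x - weightedComp w φ v' x := by
        simp only [weightedComp]
        rw [← (h.summable_mul hb3 hx).tsum_sub (h.summable_mul hb4 hx)]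
        refine ((h.summable_mul hb1 hx).tsum_sub (h.summable_mul hb2 hx)).symm.trans ?_
        refine tsum_congr fun n => ?_
        rw [← mul_sub, ← mul_sub, he _ (h.mapsTo n hx)]
      rw [e]; ring

theorem coneRate_mem (hK : 0 ≤ K) (hD : 0 < D) (hKD : D / 2 + K < D) (hd : 0 ≤ d) :
    coneRate K D d ∈ Ico (0 : ℝ) 1 := by
  unfold coneRate
  have h1 : 0 < (D - (D / 2 + K)) / D := div_pos (by linarith) hD
  have h2 : (D - (D / 2 + K)) / D ≤ 1 := (div_le_one hD).2 (by linarith)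
  have h3 := Real.exp_pos (-(D * d))
  have h4 : Real.exp (-(D * d)) ≤ 1 := Real.exp_le_one_iff.2 (by nlinarith)
  constructor
  · have := mul_le_one₀ (mul_le_one₀ h2 h3.le h4) h3.le h4
    linarith
  · have := mul_pos (mul_pos h1 h3) h3
    linarith

/-- A bounded Lipschitz function becomes log-Lipschitz after adding a large constant. -/
theorem LogLip.add_const (hD : 0 < D) {ℓ : ℝ} (hℓ : 0 ≤ ℓ) (hvb : ∀ x ∈ s, |v x| ≤ b)
    (hvl : ∀ x ∈ s, ∀ y ∈ s, |v x - v y| ≤ ℓ * dist x y) :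
    LogLip D s fun x => v x + (b + ℓ / D) := by
  refine ⟨fun x hx => ?_, fun x hx y hy => ?_⟩
  · have := (abs_le.1 (hvb x hx)).1
    have : 0 ≤ ℓ / D := by positivity
    linarith
  · have h2 := (abs_le.1 (hvb y hy)).1
    have h3 := (abs_le.1 (hvl x hx y hy)).2
    have h4 : ℓ / D ≤ v y + (b + ℓ / D) := by linarith
    have h5 : ℓ ≤ D * (v y + (b + ℓ / D)) := by rwa [div_le_iff₀' hD] at h4
    have h6 := Real.add_one_le_exp (D * dist x y)
    have h7 : (0 : ℝ) ≤ v y + (b + ℓ / D) := le_trans (by positivity) h4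
    have h8 : (0 : ℝ) ≤ dist x y := dist_nonneg
    nlinarith

/-- Exponential decay on Lipschitz functions of mean zero. -/
theorem InvariantMean.abs_iterate_le (hm : InvariantMean m w φ s D d)
    (h : ContractingWeights w φ s K d) (hK : 0 ≤ K) (hD : 0 < D) (hKD : D / 2 + K < D)
    {ℓ : ℝ} (hℓ : 0 ≤ ℓ) (hvb : ∀ x ∈ s, |v x| ≤ b) (hb : 0 ≤ b)
    (hvl : ∀ x ∈ s, ∀ y ∈ s, |v x - v y| ≤ ℓ * dist x y) (hmv : m v = 0) (k : ℕ) {x : Z}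
    (hx : x ∈ s) :
    |(weightedComp w φ)^[k] v x| ≤ Real.exp (D * d) * (coneRate K D d ^ k * (b + ℓ / D)) := by
  -- v is the difference of v + M and M, two members of the cone with the same mean M.
  set M := b + ℓ / D with hM
  have hM0 : 0 ≤ M := by positivity
  have h1 : LogLip D s fun x => v x + M := LogLip.add_const hD hℓ hvb hvl
  have h2 : LogLip D s fun _ : Z => M := LogLip.const hD.le hM0
  have hm1 : m (fun x => v x + M) = M := by
    have := hm.map_sub_const _ h1 M
    simp only [add_sub_cancel_right] at this
    change m v = _ at this
    linarith
  obtain ⟨u', v', hu', hv', hmu, hmv', he⟩ := hm.exists_sub_eq h hK hD hKD h1 h2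
    (by rw [hm1, hm.map_const]) k
  have hlin : ∀ k, ∀ x ∈ s, (weightedComp w φ)^[k] v x
      = (weightedComp w φ)^[k] (fun x => v x + M) x - (weightedComp w φ)^[k] (fun _ => M) x := by
    intro k
    induction k with
    | zero => intro x _; simp
    | succ k ih =>
      intro x hx
      simp only [Function.iterate_succ_apply']
      obtain ⟨b1, hb1⟩ := (h1.iterate hD.le hKD.le h k).exists_bound hD.le h.diam
      obtain ⟨b2, hb2⟩ := (h2.iterate hD.le hKD.le h k).exists_bound hD.le h.diam
      unfold weightedComp at *
      refine Eq.trans ?_ ((h.summable_mul hb1 hx).tsum_sub (h.summable_mul hb2 hx))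
      refine tsum_congr fun n => ?_
      rw [← mul_sub, ih _ (h.mapsTo n hx)]
  rw [hlin k x hx, he x hx]
  rw [hm1] at hmu hmv'
  have e1 := hm.upper u' hu' x hx
  have e2 := hm.upper v' hv' x hx
  rw [hmu] at e1
  rw [hmv'] at e2
  have e3 := hu'.nonneg x hx
  have e4 := hv'.nonneg x hx
  rw [abs_le]
  constructor <;> linarith

/-- Iterates of `1` stay bounded on a set `t ⊇ s` on which the distortion is controlled. -/
theorem InvariantMean.iterate_one_le (hm : InvariantMean m w φ s D d)
    (h : ContractingWeights w φ t K d) (hφ : ∀ n, MapsTo (φ n) s s) (hst : s ⊆ t)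
    (hs : s.Nonempty) (hD : 0 < D) (hKD : D / 2 + K < D) (k : ℕ) {z : Z} (hz : z ∈ t) :
    (weightedComp w φ)^[k] (fun _ => 1) z ≤ Real.exp (D * d) * Real.exp (D * d) := by
  obtain ⟨x, hx⟩ := hs
  have hone : LogLip D t fun _ : Z => (1 : ℝ) := LogLip.const hD.le zero_le_one
  have hone' : LogLip D s fun _ : Z => (1 : ℝ) := LogLip.const hD.le zero_le_one
  have h' := h.mono hst hφ
  have h1 := (hone.iterate hD.le hKD.le h k).le z hz x (hst hx)
  have hk : m ((weightedComp w φ)^[k] fun _ => 1) = 1 := by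
    induction k with
    | zero => exact hm.map_const 1
    | succ k ih =>
      rw [Function.iterate_succ_apply', hm.map_weightedComp _ (hone'.iterate hD.le hKD.le h' k), ih]
      exact (hone.iterate hD.le hKD.le h k).le z hz x (hst hx)
  have h2 := hm.upper _ (hone'.iterate hD.le hKD.le h' k) x hx
  rw [hk, mul_one] at h2
  have h3 : Real.exp (D * dist z x) ≤ Real.exp (D * d) :=
    Real.exp_le_exp.2 (mul_le_mul_of_nonneg_left (h.diam z hz x (hst hx)) hD.le)
  exact h1.trans (mul_le_mul h3 h2 ((hone'.iterate hD.le hKD.le h' k).nonneg x hx)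
    (Real.exp_pos _).le)

/-- A complex weighted composition operator is dominated by the positive one. -/
theorem norm_iterate_weightedComp_le {c : ℕ → Z → ℂ} (h : ContractingWeights w φ t K d)
    (hc : ∀ n, ∀ z ∈ t, ‖c n z‖ = w n z) (hφ : ∀ n, MapsTo (φ n) s s) (hst : s ⊆ t)
    (hK : 0 ≤ K)
    {u : Z → ℂ} {a ℓ : ℝ} (hℓ : 0 ≤ ℓ)
    (hu : ∀ z ∈ t, ∀ x ∈ s, ‖u z‖ ≤ a + ℓ * dist z x) (k : ℕ) :
    ∀ z ∈ t, ∀ x ∈ s, ‖(weightedComp c φ)^[k] u z‖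
      ≤ (a + ℓ * (dist z x / 2 ^ k)) * (weightedComp w φ)^[k] (fun _ => 1) z := by
  induction k with
  | zero => intro z hz x hx; simpa using hu z hz x hx
  | succ k ih =>
    intro z hz x hx
    simp only [Function.iterate_succ_apply']
    have hone : LogLip (2 * K) t ((weightedComp w φ)^[k] fun _ => 1) :=
      (LogLip.const (by positivity) zero_le_one).iterate (by positivity) (by linarith) h k
    obtain ⟨b, hb⟩ := hone.exists_bound (by positivity) h.diam
    nth_rw 2 [weightedComp]
    rw [← tsum_mul_left]
    refine tsum_of_norm_bounded ((h.summable_mul hb hz).mul_left _).hasSum fun n => ?_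
    rw [norm_mul, hc n z hz]
    have h1 := ih _ (h.mapsTo n hz) _ (hφ n hx)
    have h2 := h.contr n z hz x (hst hx)
    have h3 := hone.nonneg _ (h.mapsTo n hz)
    have h4 := h.nonneg n z hz
    -- The halving in each step makes the dependence on the distance to s fade with k, so that
    -- bounds on s pass to t.
    have h5 : dist (φ n z) (φ n x) / 2 ^ k ≤ dist z x / 2 ^ (k + 1) := by
      rw [pow_succ, mul_comm ((2 : ℝ) ^ k) 2, ← div_div]
      gcongr
    calc w n z * ‖(weightedComp c φ)^[k] u (φ n z)‖
        ≤ w n z * ((a + ℓ * (dist z x / 2 ^ (k + 1)))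
            * (weightedComp w φ)^[k] (fun _ => 1) (φ n z)) := by
          refine mul_le_mul_of_nonneg_left (h1.trans ?_) h4
          gcongr
      _ = _ := by ring

theorem re_iterate_weightedComp {c : ℕ → Z → ℂ} (h : ContractingWeights w φ s K d)
    (hc : ∀ n, ∀ x ∈ s, c n x = (w n x : ℂ)) {u : Z → ℂ} (hu : ∀ x ∈ s, ‖u x‖ ≤ b)
    (hK : 0 ≤ K) (k : ℕ) : ∀ x ∈ s, ((weightedComp c φ)^[k] u x).re
      = (weightedComp w φ)^[k] (fun x => (u x).re) x := by
  have hn : ∀ n, ∀ x ∈ s, ‖c n x‖ = w n x := fun n x hx => by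
    rw [hc n x hx, Complex.norm_real, Real.norm_eq_abs, abs_of_nonneg (h.nonneg n x hx)]
  induction k with
  | zero => intro x _; rfl
  | succ k ih =>
    intro x hx
    simp only [Function.iterate_succ_apply']
    have hone : LogLip (2 * K) s ((weightedComp w φ)^[k] fun _ => 1) :=
      (LogLip.const (by positivity) zero_le_one).iterate (by positivity) (by linarith) h k
    obtain ⟨b', hb'⟩ := hone.exists_bound (by positivity) h.diam
    have hbd := norm_iterate_weightedComp_le h hn h.mapsTo subset_rfl hK le_rfl
      (u := u) (by simpa using fun z hz _ _ => hu z hz) k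
    have hs : Summable fun n => c n x * (weightedComp c φ)^[k] u (φ n x) := by
      refine Summable.of_norm_bounded ((h.summable_mul hb' hx).mul_left b) fun n => ?_
      rw [norm_mul, hn n x hx]
      have := hbd _ (h.mapsTo n hx) _ (h.mapsTo n hx)
      simp only [dist_self, zero_div, mul_zero, add_zero] at this
      nlinarith [h.nonneg n x hx]
    unfold weightedComp at *
    rw [Complex.re_tsum hs]
    refine tsum_congr fun n => ?_
    rw [hc n x hx, Complex.re_ofReal_mul, ih _ (h.mapsTo n hx)]

end WeightedComposition


/-! ### The function log (1 + e^{-V}) on the strip |Im V| < π/2 -/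

section LogOneAddExpNeg

/-- In the coordinate `V`, the left branch of the LSV map is `V ↦ V - α log (1 + e⁻ⱽ)`. -/
noncomputable def logOneAddExpNeg (V : ℂ) : ℂ := Complex.log (1 + Complex.exp (-V))

theorem exp_neg_re_eq (V : ℂ) : (Complex.exp (-V)).re = Real.exp (-V.re) * Real.cos V.im := by
  rw [Complex.exp_re]; simp

theorem exp_neg_im_eq (V : ℂ) : (Complex.exp (-V)).im = -(Real.exp (-V.re) * Real.sin V.im) := by
  rw [Complex.exp_im]; simp

theorem norm_exp_neg (V : ℂ) : ‖Complex.exp (-V)‖ = Real.exp (-V.re) := by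
  rw [Complex.norm_exp]; simp

variable {V V' : ℂ} {θ : ℝ}

theorem cos_le_cos_im (hθ : θ < Real.pi / 2) (hV : |V.im| ≤ θ) : Real.cos θ ≤ Real.cos V.im := by
  rw [← Real.cos_abs V.im]
  exact Real.cos_le_cos_of_nonneg_of_le_pi (abs_nonneg _) (by linarith [Real.pi_pos]) hV

theorem exp_neg_re_pos (hV : |V.im| < Real.pi / 2) : 0 < (Complex.exp (-V)).re := by
  rw [exp_neg_re_eq]
  exact mul_pos (Real.exp_pos _) (Real.cos_pos_of_mem_Ioo (abs_lt.1 hV))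

theorem one_add_exp_neg_mem_slitPlane (hV : |V.im| < Real.pi / 2) :
    1 + Complex.exp (-V) ∈ Complex.slitPlane := by
  left
  have := exp_neg_re_pos hV
  simp only [Complex.add_re, Complex.one_re]
  linarith

theorem exp_re_pos (hV : |V.im| < Real.pi / 2) : 0 < (Complex.exp V).re := by
  rw [Complex.exp_re]
  exact mul_pos (Real.exp_pos _) (Real.cos_pos_of_mem_Ioo (abs_lt.1 hV))

theorem one_le_norm_one_add {z : ℂ} (hz : 0 ≤ z.re) : 1 ≤ ‖1 + z‖ := by
  refine le_trans ?_ (Complex.re_le_norm _)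
  simpa using hz

theorem one_add_ne_zero_of_re_nonneg {z : ℂ} (hz : 0 ≤ z.re) : 1 + z ≠ 0 :=
  norm_pos_iff.1 (zero_lt_one.trans_le (one_le_norm_one_add hz))

theorem hasDerivAt_logOneAddExpNeg (hV : |V.im| < Real.pi / 2) :
    HasDerivAt logOneAddExpNeg (-(1 + Complex.exp V)⁻¹) V := by
  have h1 : HasDerivAt (fun V : ℂ => 1 + Complex.exp (-V)) (Complex.exp (-V) * (-1)) V :=
    ((hasDerivAt_neg V).cexp).const_add 1
  have h2 := h1.clog (one_add_exp_neg_mem_slitPlane hV)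
  refine h2.congr_deriv ?_
  have h3 := one_add_ne_zero_of_re_nonneg (exp_neg_re_pos hV).le
  have h4 := one_add_ne_zero_of_re_nonneg (exp_re_pos hV).le
  have h5 : Complex.exp V * Complex.exp (-V) = 1 := by rw [← Complex.exp_add]; simp
  field_simp
  linear_combination (-1 : ℂ) * h5

/-- The derivative -1/(1 + e^V) has norm at most 1 because Re e^V > 0 on the strip, which is convex.
-/
theorem norm_logOneAddExpNeg_sub_le (hV : |V.im| < Real.pi / 2) (hV' : |V'.im| < Real.pi / 2) :
    ‖logOneAddExpNeg V - logOneAddExpNeg V'‖ ≤ ‖V - V'‖ := by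
  have hconv : Convex ℝ {V : ℂ | |V.im| < Real.pi / 2} := by
    have : {V : ℂ | |V.im| < Real.pi / 2} = Complex.imLm ⁻¹' (ball 0 (Real.pi / 2)) := by
      ext; simp [Complex.imLm]
    rw [this]
    exact (convex_ball _ _).linear_preimage _
  have := hconv.norm_image_sub_le_of_norm_hasDerivWithin_le (C := 1)
    (fun x hx => (hasDerivAt_logOneAddExpNeg hx).hasDerivWithinAt) (fun x hx => ?_) hV' hV
  · simpa using this
  · rw [norm_neg, norm_inv]
    exact inv_le_one_of_one_le₀ (one_le_norm_one_add (exp_re_pos hx).le)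

theorem norm_log_one_add_le {q : ℂ} (hq : 0 ≤ q.re) : ‖Complex.log (1 + q)‖ ≤ ‖q‖ := by
  have hconv : Convex ℝ {q : ℂ | 0 ≤ q.re} := convex_halfSpace_re_ge 0
  have := hconv.norm_image_sub_le_of_norm_hasDerivWithin_le (C := 1)
    (f := fun q => Complex.log (1 + q)) (f' := fun q => 1 / (1 + q)) (x := 0) (y := q)
    (fun x hx => (((hasDerivAt_id x).const_add 1).clog (Or.inl (by
      have : 0 ≤ x.re := hx
      simp only [id, Complex.add_re, Complex.one_re]; linarith))).hasDerivWithinAt)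
    (fun x hx => ?_) (by simp) hq
  · simpa using this
  · rw [norm_div, norm_one, one_div]
    exact inv_le_one_of_one_le₀ (one_le_norm_one_add hx)

theorem norm_logOneAddExpNeg_le (hV : |V.im| < Real.pi / 2) :
    ‖logOneAddExpNeg V‖ ≤ Real.exp (-V.re) :=
  (norm_log_one_add_le (exp_neg_re_pos hV).le).trans_eq (norm_exp_neg V)

theorem logOneAddExpNeg_conj (hV : |V.im| < Real.pi / 2) :
    logOneAddExpNeg (starRingEnd ℂ V) = starRingEnd ℂ (logOneAddExpNeg V) := by
  unfold logOneAddExpNeg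
  rw [← map_neg, Complex.exp_conj, ← Complex.log_conj, map_add, map_one]
  exact Complex.slitPlane_arg_ne_pi (one_add_exp_neg_mem_slitPlane hV)

theorem exp_logOneAddExpNeg (hV : |V.im| < Real.pi / 2) :
    Complex.exp (logOneAddExpNeg V) = 1 + Complex.exp (-V) :=
  Complex.exp_log (one_add_ne_zero_of_re_nonneg (exp_neg_re_pos hV).le)

/-- The real part is log |1 + e^{-V}| ≥ log (1 + cos θ · e^{-Re V}). The cut at Re V = -2 enters
through e^{-Re V} ≤ e², whence the denominator 1 + e². -/
theorem logOneAddExpNeg_re_ge (hθ : θ < Real.pi / 2) (hθ0 : 0 < θ) (hV : |V.im| ≤ θ)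
    (hre : -2 ≤ V.re) :
    Real.cos θ / (1 + Real.exp 2) * Real.exp (-V.re) ≤ (logOneAddExpNeg V).re := by
  have ht : 0 < Real.cos θ := Real.cos_pos_of_mem_Ioo ⟨by linarith, hθ⟩
  have he := Real.exp_pos (-V.re)
  have he2 : Real.exp (-V.re) ≤ Real.exp 2 := Real.exp_le_exp.2 (by linarith)
  have h1 : 1 + Real.cos θ * Real.exp (-V.re) ≤ ‖1 + Complex.exp (-V)‖ := by
    refine le_trans ?_ (Complex.re_le_norm _)
    rw [Complex.add_re, Complex.one_re, exp_neg_re_eq]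
    nlinarith [cos_le_cos_im hθ hV]
  have hpos : 0 < 1 + Real.cos θ * Real.exp (-V.re) := by positivity
  rw [logOneAddExpNeg, Complex.log_re]
  refine le_trans ?_ (Real.log_le_log hpos h1)
  refine le_trans ?_ (Real.one_sub_inv_le_log_of_pos hpos)
  have e : 1 - (1 + Real.cos θ * Real.exp (-V.re))⁻¹
      = Real.cos θ * Real.exp (-V.re) / (1 + Real.cos θ * Real.exp (-V.re)) := by
    field_simp; ring
  rw [e, div_mul_eq_mul_div]
  gcongr
  exact (mul_le_of_le_one_left he.le (Real.cos_le_one θ)).trans he2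

/-- For Im V ≥ 0 the argument of 1 + e^{-V} is nonpositive, hence at most its sine, which is Im
e^{-V} / |1 + e^{-V}|. -/
theorem logOneAddExpNeg_im_le (hθ : θ < Real.pi / 2) (h0 : 0 ≤ V.im) (hV : V.im ≤ θ)
    (hre : -2 ≤ V.re) :
    (logOneAddExpNeg V).im ≤ -(Real.sin V.im / (1 + Real.exp 2) * Real.exp (-V.re)) := by
  have he := Real.exp_pos (-V.re)
  have he2 : Real.exp (-V.re) ≤ Real.exp 2 := Real.exp_le_exp.2 (by linarith)
  have hs : 0 ≤ Real.sin V.im := Real.sin_nonneg_of_nonneg_of_le_pi h0 (by linarith [Real.pi_pos])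
  have hre1 : 0 < (Complex.exp (-V)).re :=
    exp_neg_re_pos (by rw [abs_of_nonneg h0]; linarith)
  have him : (1 + Complex.exp (-V)).im = -(Real.exp (-V.re) * Real.sin V.im) := by
    rw [Complex.add_im, Complex.one_im, zero_add, exp_neg_im_eq]
  have harg : Complex.arg (1 + Complex.exp (-V)) ≤ 0 := by
    by_contra! h
    rcases (Complex.arg_nonneg_iff.1 h.le).lt_or_eq with h' | h'
    · rw [him] at h'
      nlinarith [mul_nonneg he.le hs]
    · have : Complex.arg (1 + Complex.exp (-V)) = 0 := by
        rw [Complex.arg_eq_zero_iff]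
        exact ⟨by simp only [Complex.add_re, Complex.one_re]; linarith, h'.symm⟩
      linarith
  rw [logOneAddExpNeg, Complex.log_im]
  have h1 : Complex.arg (1 + Complex.exp (-V)) ≤ Real.sin (Complex.arg (1 + Complex.exp (-V))) := by
    have := Real.sin_le (neg_nonneg.2 harg)
    rw [Real.sin_neg] at this
    linarith
  refine h1.trans ?_
  rw [Complex.sin_arg, him, neg_div, neg_le_neg_iff, div_mul_eq_mul_div, mul_comm (Real.sin _)]
  have hn : ‖1 + Complex.exp (-V)‖ ≤ 1 + Real.exp 2 := by
    refine (norm_add_le _ _).trans ?_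
    rw [norm_one, norm_exp_neg]
    linarith
  have := one_le_norm_one_add hre1.le
  gcongr

end LogOneAddExpNeg

/-! ### The inverse left branch for complex exponents: existence and the invariant strip -/

section Step

/-- Admissible slope of a complex exponent for which the sector of opening `θ` is invariant. -/
noncomputable def sectorSlope (θ : ℝ) : ℝ :=
  -- The four entries serve, in this order, `GoodExponent.mul_log_re_ge`,
  -- `GoodExponent.mul_log_im_nonpos`, `GoodExponent.mul_log_im_le` and
  -- `GoodExponent.re_mul_inv_nonneg`.
  min (min (Real.cos θ / (1 + Real.exp 2) / 2) (Real.sin (θ / 2) / (1 + Real.exp 2)))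
    (min (θ / 2 / Real.exp 2) (Real.cos θ))

/-- Complex exponents close enough to a real one. -/
structure GoodExponent (θ κ a : ℝ) (α : ℂ) : Prop where
  theta_pos : 0 < θ
  theta_lt : θ < Real.pi / 2
  one_lt : 1 < κ
  pos : 0 < a
  re_pos : 0 < α.re
  re_ge : a ≤ α.re
  norm_lt : ‖α‖ < 1
  im_le : |α.im| ≤ sectorSlope θ * α.re
  inv_re : κ ≤ (α⁻¹).re
  inv_im : |(α⁻¹).im| ≤ 1
  -- `angle` gives |Im (V/α)| < π/2 for |Re V| ≤ 2 in the strip; `domain` puts the coordinates of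
  -- points of `lsvNhd` into the strip.
  angle : θ * (α⁻¹).re + 2 * |(α⁻¹).im| < Real.pi / 2
  domain : α.re * (Real.pi / 2 - 1 / 6) + |α.im| * Real.log 3 < θ

variable {α v V V' : ℂ} {θ κ a : ℝ}

theorem sectorSlope_pos (hθ0 : 0 < θ) (hθ : θ < Real.pi / 2) : 0 < sectorSlope θ := by
  have h1 : 0 < Real.cos θ := Real.cos_pos_of_mem_Ioo ⟨by linarith, hθ⟩
  have h2 : 0 < Real.sin (θ / 2) := Real.sin_pos_of_pos_of_lt_pi (by linarith) (by linarith)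
  unfold sectorSlope
  refine lt_min (lt_min ?_ ?_) (lt_min ?_ ?_) <;> positivity

theorem GoodExponent.re_lt_one (h : GoodExponent θ κ a α) : α.re < 1 :=
  (Complex.re_le_norm α).trans_lt h.norm_lt

theorem GoodExponent.ne_zero (h : GoodExponent θ κ a α) : α ≠ 0 := by
  rintro rfl
  exact lt_irrefl _ h.re_pos

theorem GoodExponent.abs_im_le_cos_mul (h : GoodExponent θ κ a α) :
    |α.im| ≤ Real.cos θ / (1 + Real.exp 2) / 2 * α.re :=
  h.im_le.trans (mul_le_mul_of_nonneg_right ((min_le_left _ _).trans (min_le_left _ _))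
    h.re_pos.le)

theorem GoodExponent.abs_im_le_sin_mul (h : GoodExponent θ κ a α) :
    |α.im| ≤ Real.sin (θ / 2) / (1 + Real.exp 2) * α.re :=
  h.im_le.trans (mul_le_mul_of_nonneg_right ((min_le_left _ _).trans (min_le_right _ _))
    h.re_pos.le)

theorem GoodExponent.abs_im_mul_exp_le (h : GoodExponent θ κ a α) (hθ0 : 0 < θ) :
    |α.im| * Real.exp 2 ≤ θ / 2 := by
  have h1 : |α.im| ≤ θ / 2 / Real.exp 2 * α.re :=
    h.im_le.trans (mul_le_mul_of_nonneg_right ((min_le_right _ _).trans (min_le_left _ _))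
      h.re_pos.le)
  have h2 : θ / 2 / Real.exp 2 * α.re ≤ θ / 2 / Real.exp 2 :=
    mul_le_of_le_one_right (by positivity) h.re_lt_one.le
  rw [← le_div_iff₀ (Real.exp_pos 2)]
  exact h1.trans h2

theorem GoodExponent.abs_im_le_cos (h : GoodExponent θ κ a α) : |α.im| ≤ Real.cos θ * α.re :=
  h.im_le.trans (mul_le_mul_of_nonneg_right ((min_le_right _ _).trans (min_le_right _ _))
    h.re_pos.le)

theorem GoodExponent.mul_log_re_ge (h : GoodExponent θ κ a α) (hθ0 : 0 < θ)
    (hθ : θ < Real.pi / 2) (hV : |V.im| ≤ θ) (hre : -2 ≤ V.re) :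
    a * (Real.cos θ / (1 + Real.exp 2) / 2) * Real.exp (-V.re)
      ≤ (α * logOneAddExpNeg V).re := by
  have h1 := logOneAddExpNeg_re_ge hθ hθ0 hV hre
  have h2 := (Complex.abs_im_le_norm _).trans (norm_logOneAddExpNeg_le (hV.trans_lt hθ))
  have h3 := h.abs_im_le_cos_mul
  have he := Real.exp_pos (-V.re)
  have ht : 0 < Real.cos θ := Real.cos_pos_of_mem_Ioo ⟨by linarith, hθ⟩
  set k := Real.cos θ / (1 + Real.exp 2) with hk
  have hk0 : 0 < k := by positivity
  rw [Complex.mul_re]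
  have h4 : |α.im * (logOneAddExpNeg V).im| ≤ k / 2 * α.re * Real.exp (-V.re) := by
    rw [abs_mul]
    exact mul_le_mul h3 h2 (abs_nonneg _) (mul_nonneg (by positivity) h.re_pos.le)
  have h5 := (abs_le.1 h4).2
  have h6 := mul_le_mul_of_nonneg_left h1 h.re_pos.le
  have h7 : a * (k / 2) * Real.exp (-V.re) ≤ α.re * (k / 2) * Real.exp (-V.re) := by
    have := h.re_ge
    gcongr
  nlinarith

theorem GoodExponent.mul_log_im_le (h : GoodExponent θ κ a α) (hθ0 : 0 < θ)
    (hθ : θ < Real.pi / 2) (h0 : 0 ≤ V.im) (hV : V.im ≤ θ) (hre : -2 ≤ V.re) :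
    (α * logOneAddExpNeg V).im ≤ θ / 2 := by
  have h1 := logOneAddExpNeg_im_le hθ h0 hV hre
  have h2 := (Complex.abs_re_le_norm _).trans (norm_logOneAddExpNeg_le (V := V)
    (by rw [abs_of_nonneg h0]; linarith))
  have he2 : Real.exp (-V.re) ≤ Real.exp 2 := Real.exp_le_exp.2 (by linarith)
  have hs : 0 ≤ Real.sin V.im := Real.sin_nonneg_of_nonneg_of_le_pi h0 (by linarith [Real.pi_pos])
  have h3 : (logOneAddExpNeg V).im ≤ 0 := h1.trans (neg_nonpos.2 (by positivity))
  have h4 : |α.im * (logOneAddExpNeg V).re| ≤ |α.im| * Real.exp 2 := by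
    rw [abs_mul]
    exact mul_le_mul_of_nonneg_left (h2.trans he2) (abs_nonneg _)
  have h5 := (abs_le.1 h4).2
  have h6 := h.abs_im_mul_exp_le hθ0
  have h7 := mul_nonpos_of_nonneg_of_nonpos h.re_pos.le h3
  rw [Complex.mul_im]
  linarith

/-- In the outer part of the strip the contribution of Re α outweighs that of Im α, so the
correction points towards the real axis. This is what makes the strip invariant for complex
exponents. -/
theorem GoodExponent.mul_log_im_nonpos (h : GoodExponent θ κ a α) (hθ0 : 0 < θ)
    (hθ : θ < Real.pi / 2) (h0 : θ / 2 ≤ V.im) (hV : V.im ≤ θ) (hre : -2 ≤ V.re) :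
    (α * logOneAddExpNeg V).im ≤ 0 := by
  have h1 := logOneAddExpNeg_im_le hθ (by linarith) hV hre
  have h2 := (Complex.abs_re_le_norm _).trans (norm_logOneAddExpNeg_le (V := V)
    (by rw [abs_of_nonneg (by linarith)]; linarith))
  have hs : Real.sin (θ / 2) ≤ Real.sin V.im :=
    Real.sin_le_sin_of_le_of_le_pi_div_two (by linarith) (by linarith) h0
  have hs0 : 0 < Real.sin (θ / 2) := Real.sin_pos_of_pos_of_lt_pi (by linarith) (by linarith)
  have h3 : (logOneAddExpNeg V).im ≤ -(Real.sin (θ / 2) / (1 + Real.exp 2) * Real.exp (-V.re)) := by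
    refine h1.trans (neg_le_neg ?_)
    gcongr
  have h4 : |α.im * (logOneAddExpNeg V).re|
      ≤ Real.sin (θ / 2) / (1 + Real.exp 2) * α.re * Real.exp (-V.re) := by
    rw [abs_mul]
    exact mul_le_mul h.abs_im_le_sin_mul h2 (abs_nonneg _)
      (mul_nonneg (by positivity) h.re_pos.le)
  have h5 := (abs_le.1 h4).2
  have h7 := mul_le_mul_of_nonneg_left h3 h.re_pos.le
  rw [Complex.mul_im]
  nlinarith

theorem GoodExponent.conj (h : GoodExponent θ κ a α) : GoodExponent θ κ a (starRingEnd ℂ α) where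
  theta_pos := h.theta_pos
  theta_lt := h.theta_lt
  one_lt := h.one_lt
  pos := h.pos
  re_pos := by simpa using h.re_pos
  re_ge := by simpa using h.re_ge
  norm_lt := by simpa using h.norm_lt
  im_le := by simpa using h.im_le
  inv_re := by rw [← map_inv₀]; simpa using h.inv_re
  inv_im := by rw [← map_inv₀, Complex.conj_im, abs_neg]; exact h.inv_im
  angle := by rw [← map_inv₀, Complex.conj_im, abs_neg, Complex.conj_re]; exact h.angle
  domain := by simpa using h.domain

theorem sub_mul_log_dist (hV : |V.im| < Real.pi / 2) (hV' : |V'.im| < Real.pi / 2) :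
    (1 - ‖α‖) * ‖V - V'‖
      ≤ ‖(V - α * logOneAddExpNeg V) - (V' - α * logOneAddExpNeg V')‖ := by
  have e : (V - α * logOneAddExpNeg V) - (V' - α * logOneAddExpNeg V')
      = (V - V') - α * (logOneAddExpNeg V - logOneAddExpNeg V') := by ring
  rw [e]
  have h1 := norm_sub_norm_le (V - V') (α * (logOneAddExpNeg V - logOneAddExpNeg V'))
  rw [norm_mul] at h1
  have h2 := mul_le_mul_of_nonneg_left (norm_logOneAddExpNeg_sub_le hV hV') (norm_nonneg α)
  linarith

theorem eq_of_sub_mul_log_eq (hα : ‖α‖ < 1) (hV : |V.im| < Real.pi / 2)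
    (hV' : |V'.im| < Real.pi / 2)
    (h : V - α * logOneAddExpNeg V = V' - α * logOneAddExpNeg V') : V = V' := by
  have h1 := sub_mul_log_dist (α := α) hV hV'
  rw [h, sub_self, norm_zero] at h1
  have h2 : ‖V - V'‖ ≤ 0 := by nlinarith [norm_nonneg (V - V')]
  exact sub_eq_zero.1 (norm_le_zero_iff.1 h2)

/-- The equation V = v + α log (1 + e^{-V}) is solved by a damped fixed point iteration. Without
damping the imaginary part may overshoot the opposite edge of the strip. -/
theorem GoodExponent.exists_step (h : GoodExponent θ κ a α) (hθ0 : 0 < θ)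
    (hθ : θ < Real.pi / 2) (hv : |v.im| ≤ θ) (hre : -2 ≤ v.re) (ha : 0 ≤ a) :
    ∃ V : ℂ, (|V.im| ≤ θ ∧ -2 ≤ V.re) ∧ V - α * logOneAddExpNeg V = v := by
  set C : Set ℂ := {V : ℂ | |V.im| ≤ θ ∧ -2 ≤ V.re} with hC
  have hCc : IsClosed C :=
    (isClosed_le (Complex.continuous_im.abs) continuous_const).inter
      (isClosed_le continuous_const Complex.continuous_re)
  have hexp : θ ≤ Real.exp 2 := by
    have := Real.add_one_le_exp 2
    linarith [Real.pi_lt_four]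
  have hE := Real.exp_pos 2
  -- τ (θ + e²) = θ keeps the new imaginary part above -θ when Im V ≥ 0, since v.im ≥ -θ and |α log
  -- (1 + e^{-V})| ≤ e². The bound τ ≤ 1/2 keeps it below θ when Im V ≤ θ/2.
  set τ : ℝ := θ / (θ + Real.exp 2) with hτ
  have hτ0 : 0 < τ := by positivity
  have hτ2 : τ ≤ 1 / 2 := by
    rw [hτ, div_le_div_iff₀ (by positivity) (by norm_num)]; linarith
  have hτ3 : τ * (θ + Real.exp 2) = θ := by rw [hτ]; field_simp
  have ht : 0 < Real.cos θ := Real.cos_pos_of_mem_Ioo ⟨by linarith, hθ⟩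
  set N : ℂ → ℂ := fun V => V + (τ : ℂ) * (v + α * logOneAddExpNeg V - V) with hN
  have hNim : ∀ V, (N V).im = (1 - τ) * V.im + τ * (v.im + (α * logOneAddExpNeg V).im) := by
    intro V; simp only [hN, Complex.add_im, Complex.im_ofReal_mul, Complex.sub_im]; ring
  have hNre : ∀ V, (N V).re = (1 - τ) * V.re + τ * (v.re + (α * logOneAddExpNeg V).re) := by
    intro V; simp only [hN, Complex.add_re, Complex.re_ofReal_mul, Complex.sub_re]; ring
  have hupper : ∀ {α v V : ℂ}, GoodExponent θ κ a α → |v.im| ≤ θ → 0 ≤ V.im → V ∈ C →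
      |(1 - τ) * V.im + τ * (v.im + (α * logOneAddExpNeg V).im)| ≤ θ := by
    intro α v V h hv h0 hVC
    have hVim := (abs_le.1 hVC.1).2
    obtain ⟨hv1, hv2⟩ := abs_le.1 hv
    rw [abs_le]
    constructor
    · have h1 : ‖α * logOneAddExpNeg V‖ ≤ Real.exp 2 := by
        rw [norm_mul]
        have h2 := norm_logOneAddExpNeg_le (hVC.1.trans_lt hθ)
        have he2 : Real.exp (-V.re) ≤ Real.exp 2 := Real.exp_le_exp.2 (by linarith [hVC.2])
        have := norm_nonneg (logOneAddExpNeg V)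
        nlinarith [h.norm_lt, norm_nonneg α]
      have h2 := (abs_le.1 ((Complex.abs_im_le_norm _).trans h1)).1
      nlinarith
    · rcases le_total (θ / 2) V.im with h2 | h2
      · have := h.mul_log_im_nonpos hθ0 hθ h2 hVim hVC.2
        nlinarith
      · have := h.mul_log_im_le hθ0 hθ h0 hVim hVC.2
        nlinarith
  have hmaps : MapsTo N C C := by
    intro V hVC
    refine ⟨?_, ?_⟩
    · rw [hNim]
      -- The lower half of the strip is reduced to the upper half by complex conjugation.
      rcases le_total 0 V.im with h0 | h0
      · exact hupper h hv h0 hVC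
      · have h1 := hupper (V := starRingEnd ℂ V) (v := starRingEnd ℂ v) h.conj (by simpa using hv)
          (by simpa using h0) (by simpa [hC] using hVC)
        rw [logOneAddExpNeg_conj (hVC.1.trans_lt hθ), ← map_mul] at h1
        simp only [Complex.conj_im] at h1
        rw [← abs_neg]
        convert h1 using 2
        ring
    · rw [hNre]
      have h1 := h.mul_log_re_ge hθ0 hθ hVC.1 hVC.2
      have h2 : 0 ≤ (α * logOneAddExpNeg V).re := le_trans (by positivity) h1
      have := hVC.2
      nlinarith
  have hrate : 0 ≤ 1 - τ + τ * ‖α‖ := by nlinarith [norm_nonneg α]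
  have hcontr : ContractingWith (Real.toNNReal (1 - τ + τ * ‖α‖)) (hmaps.restrict N C C) := by
    refine ⟨?_, LipschitzWith.of_dist_le_mul fun x y => ?_⟩
    · rw [Real.toNNReal_lt_one]
      nlinarith [h.norm_lt]
    · obtain ⟨x, hx⟩ := x
      obtain ⟨y, hy⟩ := y
      change dist (N x) (N y) ≤ (Real.toNNReal (1 - τ + τ * ‖α‖) : ℝ) * dist x y
      rw [Real.coe_toNNReal _ hrate, dist_eq_norm, dist_eq_norm]
      have e : N x - N y = ((1 - τ : ℝ) : ℂ) * (x - y)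
          + (τ : ℂ) * (α * (logOneAddExpNeg x - logOneAddExpNeg y)) := by
        simp only [hN]; push_cast; ring
      rw [e]
      refine (norm_add_le _ _).trans ?_
      rw [norm_mul, norm_mul, norm_mul, Complex.norm_real, Complex.norm_real, Real.norm_eq_abs,
        Real.norm_eq_abs, abs_of_nonneg (by linarith), abs_of_pos hτ0]
      have h1 := norm_logOneAddExpNeg_sub_le (hx.1.trans_lt hθ) (hy.1.trans_lt hθ)
      have h2 := mul_le_mul_of_nonneg_left h1 (mul_nonneg hτ0.le (norm_nonneg α))
      nlinarith
  obtain ⟨V, hVC, hfix, -⟩ := hcontr.exists_fixedPoint' (x := v) hCc.isComplete hmaps ⟨hv, hre⟩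
    (edist_ne_top _ _)
  refine ⟨V, hVC, ?_⟩
  have h1 : (τ : ℂ) * (v + α * logOneAddExpNeg V - V) = 0 := by
    have : N V = V := hfix
    simpa [hN] using this
  have h2 : (τ : ℂ) ≠ 0 := by exact_mod_cast hτ0.ne'
  have h3 := (mul_eq_zero.1 h1).resolve_left h2
  linear_combination -h3

open Classical in
/-- The inverse left branch of the LSV map in the coordinate `v = -α log (2 z)`. -/
noncomputable def lsvStep (α v : ℂ) : ℂ :=
  -- For ‖α‖ < 1 the choice is unique by `eq_of_sub_mul_log_eq`. For good exponents the default 0 is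
  -- not used on `lsvStrip θ`.
  if h : ∃ V : ℂ, |V.im| < Real.pi / 2 ∧ V - α * logOneAddExpNeg V = v then h.choose else 0

theorem lsvStep_eq (hα : ‖α‖ < 1) (hV : |V.im| < Real.pi / 2)
    (h : V - α * logOneAddExpNeg V = v) : lsvStep α v = V := by
  have hex : ∃ V : ℂ, |V.im| < Real.pi / 2 ∧ V - α * logOneAddExpNeg V = v := ⟨V, hV, h⟩
  rw [lsvStep, dif_pos hex]
  exact eq_of_sub_mul_log_eq hα hex.choose_spec.1 hV (hex.choose_spec.2.trans h.symm)

/-- The truncated strip that is invariant under `lsvStep`. -/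
def lsvStrip (θ : ℝ) : Set ℂ := {V : ℂ | |V.im| < θ ∧ -2 < V.re}

theorem isOpen_lsvStrip (θ : ℝ) : IsOpen (lsvStrip θ) :=
  (isOpen_lt (Complex.continuous_im.abs) continuous_const).inter
    (isOpen_lt continuous_const Complex.continuous_re)

/-- A solution on a horizontal edge of the closed strip is impossible: there the correction points
inwards, so v would lie on or beyond that edge. -/
theorem GoodExponent.step_spec (h : GoodExponent θ κ a α) (hθ0 : 0 < θ)
    (hθ : θ < Real.pi / 2) (ha : 0 ≤ a) (hv : v ∈ lsvStrip θ) :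
    lsvStep α v ∈ lsvStrip θ ∧ lsvStep α v - α * logOneAddExpNeg (lsvStep α v) = v := by
  obtain ⟨V, hV, he⟩ := h.exists_step hθ0 hθ hv.1.le hv.2.le ha
  rw [lsvStep_eq h.norm_lt (hV.1.trans_lt hθ) he]
  refine ⟨⟨lt_of_le_of_ne hV.1 fun hcon => ?_, ?_⟩, he⟩
  · have key : ∀ {α v V : ℂ}, GoodExponent θ κ a α → v.im < θ → -2 ≤ V.re → V.im = θ →
        V - α * logOneAddExpNeg V = v → False := by
      intro α v V h hv hre him he
      have := h.mul_log_im_nonpos hθ0 hθ (by linarith) him.le hre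
      rw [← he, Complex.sub_im] at hv
      linarith
    rcases abs_choice V.im with h1 | h1
    · exact key h (abs_lt.1 hv.1).2 hV.2 (h1.symm.trans hcon) he
    · refine key (V := starRingEnd ℂ V) (v := starRingEnd ℂ v) h.conj ?_ (by simpa using hV.2)
        (by rw [Complex.conj_im, ← h1, hcon]) ?_
      · rw [Complex.conj_im]; linarith [(abs_lt.1 hv.1).1]
      · rw [logOneAddExpNeg_conj (hV.1.trans_lt hθ), ← map_mul, ← map_sub, he]
  · have h1 := h.mul_log_re_ge hθ0 hθ hV.1 hV.2
    have ht : 0 < Real.cos θ := Real.cos_pos_of_mem_Ioo ⟨by linarith, hθ⟩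
    have h2 : 0 ≤ (α * logOneAddExpNeg V).re := le_trans (by positivity) h1
    have h3 := hv.2
    rw [← he, Complex.sub_re] at h3
    linarith

end Step


/-! ### Holomorphy of the inverse left branch in the exponent and the coordinate -/

section StepDerivative

variable {α α₀ v v₀ V : ℂ} {θ κ a : ℝ} {B : Set ℂ}

theorem GoodExponent.cos_pos (h : GoodExponent θ κ a α) : 0 < Real.cos θ :=
  Real.cos_pos_of_mem_Ioo ⟨by linarith [h.theta_pos, Real.pi_pos], h.theta_lt⟩

theorem GoodExponent.step_mem (h : GoodExponent θ κ a α) (hv : v ∈ lsvStrip θ) :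
    lsvStep α v ∈ lsvStrip θ :=
  (h.step_spec h.theta_pos h.theta_lt h.pos.le hv).1

theorem GoodExponent.step_eq (h : GoodExponent θ κ a α) (hv : v ∈ lsvStrip θ) :
    lsvStep α v - α * logOneAddExpNeg (lsvStep α v) = v :=
  (h.step_spec h.theta_pos h.theta_lt h.pos.le hv).2

theorem GoodExponent.im_lt (h : GoodExponent θ κ a α) (hv : v ∈ lsvStrip θ) :
    |v.im| < Real.pi / 2 := hv.1.trans h.theta_lt

theorem GoodExponent.norm_log_le (h : GoodExponent θ κ a α) (hv : v ∈ lsvStrip θ) :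
    ‖logOneAddExpNeg v‖ ≤ Real.exp 2 :=
  (norm_logOneAddExpNeg_le (h.im_lt hv)).trans (Real.exp_le_exp.2 (by linarith [hv.2]))

/-- Supplies the continuity of the local inverse on which the two differentiability proofs below
rely. -/
theorem GoodExponent.step_dist_le (h₀ : GoodExponent θ κ a α₀) (h : GoodExponent θ κ a α)
    (hv₀ : v₀ ∈ lsvStrip θ) (hv : v ∈ lsvStrip θ) :
    (1 - ‖α₀‖) * ‖lsvStep α v - lsvStep α₀ v₀‖ ≤ ‖v - v₀‖ + ‖α - α₀‖ * Real.exp 2 := by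
  refine (sub_mul_log_dist (α := α₀) (h.im_lt (h.step_mem hv))
    (h₀.im_lt (h₀.step_mem hv₀))).trans ?_
  rw [h₀.step_eq hv₀]
  have e : lsvStep α v - α₀ * logOneAddExpNeg (lsvStep α v) - v₀
      = (v - v₀) + (α - α₀) * logOneAddExpNeg (lsvStep α v) := by
    linear_combination h.step_eq hv
  rw [e]
  refine (norm_add_le _ _).trans ?_
  rw [norm_mul]
  gcongr
  exact h.norm_log_le (h.step_mem hv)

theorem continuousAt_lsvStep (hB : IsOpen B) (hgood : ∀ α ∈ B, GoodExponent θ κ a α)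
    (hα₀ : α₀ ∈ B) (hv₀ : v₀ ∈ lsvStrip θ) :
    ContinuousAt (fun p : ℂ × ℂ => lsvStep p.1 p.2) (α₀, v₀) := by
  have h₀ := hgood α₀ hα₀
  have hpos : 0 < 1 - ‖α₀‖ := by linarith [h₀.norm_lt]
  rw [ContinuousAt, tendsto_iff_norm_sub_tendsto_zero]
  refine squeeze_zero' (g := fun p : ℂ × ℂ =>
    (‖p.2 - v₀‖ + ‖p.1 - α₀‖ * Real.exp 2) / (1 - ‖α₀‖))
    (Eventually.of_forall fun _ => norm_nonneg _) ?_ ?_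
  · filter_upwards [prod_mem_nhds (hB.mem_nhds hα₀) ((isOpen_lsvStrip θ).mem_nhds hv₀)] with p hp
    rw [le_div_iff₀' hpos]
    exact h₀.step_dist_le (hgood _ hp.1) hv₀ hp.2
  · have : ContinuousAt (fun p : ℂ × ℂ =>
      (‖p.2 - v₀‖ + ‖p.1 - α₀‖ * Real.exp 2) / (1 - ‖α₀‖)) (α₀, v₀) := by fun_prop
    simpa [ContinuousAt] using this

theorem one_add_div_ne_zero (hα : ‖α‖ < 1) (hV : |V.im| < Real.pi / 2) :
    1 + α * (1 + Complex.exp V)⁻¹ ≠ 0 := by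
  have h1 : ‖α * (1 + Complex.exp V)⁻¹‖ < 1 := by
    rw [norm_mul, norm_inv]
    exact mul_lt_one_of_nonneg_of_lt_one_left (norm_nonneg _) hα
      (inv_le_one_of_one_le₀ (one_le_norm_one_add (exp_re_pos hV).le))
  intro h
  rw [add_eq_zero_iff_neg_eq] at h
  rw [← h] at h1
  simp at h1

theorem GoodExponent.hasDerivAt_step (h : GoodExponent θ κ a α) (hv : v ∈ lsvStrip θ) :
    HasDerivAt (lsvStep α) (1 + α * (1 + Complex.exp (lsvStep α v))⁻¹)⁻¹ v := by
  have hV := h.im_lt (h.step_mem hv)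
  have hnhds := (isOpen_lsvStrip θ).mem_nhds hv
  refine HasDerivAt.of_local_left_inverse (f := fun V => V - α * logOneAddExpNeg V) ?_ ?_
    (one_add_div_ne_zero h.norm_lt hV) (mem_of_superset hnhds fun w hw => h.step_eq hw)
  · have hpos : 0 < 1 - ‖α‖ := by linarith [h.norm_lt]
    rw [ContinuousAt, tendsto_iff_norm_sub_tendsto_zero]
    refine squeeze_zero' (g := fun w : ℂ => ‖w - v‖ / (1 - ‖α‖))
      (Eventually.of_forall fun _ => norm_nonneg _) ?_ ?_
    · filter_upwards [hnhds] with w hw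
      rw [le_div_iff₀' hpos]
      simpa using h.step_dist_le h hv hw
    · have : ContinuousAt (fun w : ℂ => ‖w - v‖ / (1 - ‖α‖)) v := by fun_prop
      simpa [ContinuousAt] using this
  · exact ((hasDerivAt_id _).sub ((hasDerivAt_logOneAddExpNeg hV).const_mul α)).congr_deriv
      (by ring)

/-- The map (α, V) ↦ (α, V - α log (1 + e^{-V})) has a triangular derivative with invertible
diagonal, and (α, v) ↦ (α, `lsvStep α v`) is its continuous local inverse. -/
theorem differentiableOn_lsvStep (hB : IsOpen B) (hgood : ∀ α ∈ B, GoodExponent θ κ a α) :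
    DifferentiableOn ℂ (fun p : ℂ × ℂ => lsvStep p.1 p.2) (B ×ˢ lsvStrip θ) := by
  rintro ⟨α₀, v₀⟩ ⟨hα₀, hv₀⟩
  have h₀ := hgood α₀ hα₀
  have hV := h₀.im_lt (h₀.step_mem hv₀)
  set V := lsvStep α₀ v₀ with hVdef
  have hc := one_add_div_ne_zero h₀.norm_lt hV
  set e : (ℂ × ℂ) ≃L[ℂ] (ℂ × ℂ) := (ContinuousLinearEquiv.refl ℂ ℂ).skewProd
    (ContinuousLinearEquiv.unitsEquivAut ℂ (Units.mk0 _ hc))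
    (-(logOneAddExpNeg V) • ContinuousLinearMap.id ℂ ℂ) with he
  have hΦ : HasFDerivAt (fun p : ℂ × ℂ => (p.1, p.2 - p.1 * logOneAddExpNeg p.2))
      (e : (ℂ × ℂ) →L[ℂ] (ℂ × ℂ)) (α₀, V) := by
    have hL : HasFDerivAt (fun p : ℂ × ℂ => logOneAddExpNeg p.2)
        ((-(1 + Complex.exp V)⁻¹) • ContinuousLinearMap.snd ℂ ℂ ℂ) (α₀, V) :=
      HasDerivAt.comp_hasFDerivAt (h₂ := logOneAddExpNeg) (f := Prod.snd) (α₀, V)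
        (hasDerivAt_logOneAddExpNeg hV) hasFDerivAt_snd
    refine (hasFDerivAt_fst.prodMk (hasFDerivAt_snd.sub (hasFDerivAt_fst.mul hL))).congr_fderiv ?_
    ext <;> simp [he, mul_comm]
  have hg : ContinuousAt (fun p : ℂ × ℂ => (p.1, lsvStep p.1 p.2)) (α₀, v₀) :=
    continuousAt_fst.prodMk (continuousAt_lsvStep hB hgood hα₀ hv₀)
  have := HasFDerivAt.of_local_left_inverse
    (f := fun p : ℂ × ℂ => (p.1, p.2 - p.1 * logOneAddExpNeg p.2)) hg hΦ ?_
  · exact (differentiableAt_snd.comp (α₀, v₀) this.differentiableAt).differentiableWithinAt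
  · filter_upwards [prod_mem_nhds (hB.mem_nhds hα₀) ((isOpen_lsvStrip θ).mem_nhds hv₀)] with p hp
    simp only [(hgood _ hp.1).step_eq hp.2]

end StepDerivative

/-! ### Iterates of the inverse left branch: derivatives and decay -/

section Iterates

variable {α v : ℂ} {θ κ a : ℝ} {B : Set ℂ}

/-- Iterates of the inverse left branch in the coordinate `v = -α log (2 z)`. -/
noncomputable def lsvIter (α : ℂ) (n : ℕ) (v : ℂ) : ℂ := (lsvStep α)^[n] v

theorem lsvIter_zero : lsvIter α 0 v = v := rfl

theorem lsvIter_succ (n : ℕ) : lsvIter α (n + 1) v = lsvStep α (lsvIter α n v) :=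
  Function.iterate_succ_apply' _ _ _

theorem lsvIter_succ' (n : ℕ) : lsvIter α (n + 1) v = lsvIter α n (lsvStep α v) :=
  Function.iterate_succ_apply _ _ _

theorem GoodExponent.iter_mem (h : GoodExponent θ κ a α) (hv : v ∈ lsvStrip θ) (n : ℕ) :
    lsvIter α n v ∈ lsvStrip θ := by
  induction n with
  | zero => exact hv
  | succ n ih => rw [lsvIter_succ]; exact h.step_mem ih

theorem differentiableOn_lsvIter (hB : IsOpen B) (hgood : ∀ α ∈ B, GoodExponent θ κ a α) (n : ℕ) :
    DifferentiableOn ℂ (fun p : ℂ × ℂ => lsvIter p.1 n p.2) (B ×ˢ lsvStrip θ) := by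
  induction n with
  | zero => simp only [lsvIter_zero]; exact differentiableOn_snd
  | succ n ih =>
    simp only [lsvIter_succ]
    exact (differentiableOn_lsvStep hB hgood).comp (differentiableOn_fst.prodMk ih)
      fun p hp => ⟨hp.1, (hgood _ hp.1).iter_mem hp.2 n⟩

/-- The derivative of `lsvIter α n` at `v`. -/
noncomputable def lsvIterDeriv (α : ℂ) (n : ℕ) (v : ℂ) : ℂ :=
  ∏ j ∈ Finset.range n, (1 + α * (1 + Complex.exp (lsvIter α (j + 1) v))⁻¹)⁻¹

/-- The derivative of the `n`-th iterate of the inverse left branch, in the coordinate `v`. -/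
noncomputable def lsvJac (α : ℂ) (n : ℕ) (v : ℂ) : ℂ :=
  ∏ j ∈ Finset.range n, (1 + (1 + α) * Complex.exp (-lsvIter α (j + 1) v))⁻¹

theorem GoodExponent.hasDerivAt_iter (h : GoodExponent θ κ a α) (hv : v ∈ lsvStrip θ) (n : ℕ) :
    HasDerivAt (lsvIter α n) (lsvIterDeriv α n v) v := by
  induction n with
  | zero =>
    rw [lsvIterDeriv, Finset.range_zero, Finset.prod_empty]
    exact hasDerivAt_id v
  | succ n ih =>
    have h1 := (h.hasDerivAt_step (h.iter_mem hv n)).comp v ih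
    have e : lsvIter α (n + 1) = lsvStep α ∘ lsvIter α n := funext fun _ => lsvIter_succ n
    rw [e]
    refine h1.congr_deriv ?_
    rw [lsvIterDeriv, lsvIterDeriv, Finset.prod_range_succ, lsvIter_succ, mul_comm]

theorem GoodExponent.exp_neg_ne (h : GoodExponent θ κ a α) (hv : v ∈ lsvStrip θ) :
    1 + Complex.exp (-v) ≠ 0 :=
  one_add_ne_zero_of_re_nonneg (exp_neg_re_pos (h.im_lt hv)).le

theorem one_add_mul_factor {V : ℂ} (hV : |V.im| < Real.pi / 2) (α : ℂ) :
    1 + (1 + α) * Complex.exp (-V)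
      = (1 + Complex.exp (-V)) * (1 + α * (1 + Complex.exp V)⁻¹) := by
  have h4 := one_add_ne_zero_of_re_nonneg (exp_re_pos hV).le
  have h5 : Complex.exp V * Complex.exp (-V) = 1 := by rw [← Complex.exp_add]; simp
  field_simp
  linear_combination α * h5

/-- For z = e^{-v/α}/2 one has dzₙ/dz = (zₙ/z) · (dvₙ/dv), and by `GoodExponent.exp_iter` the
product here is zₙ/z. -/
theorem GoodExponent.jac_eq (h : GoodExponent θ κ a α) (hv : v ∈ lsvStrip θ) (n : ℕ) :
    lsvJac α n v = (∏ j ∈ Finset.range n, (1 + Complex.exp (-lsvIter α (j + 1) v))⁻¹)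
      * lsvIterDeriv α n v := by
  rw [lsvJac, lsvIterDeriv, ← Finset.prod_mul_distrib]
  refine Finset.prod_congr rfl fun j _ => ?_
  rw [one_add_mul_factor (h.im_lt (h.iter_mem hv _)), mul_inv]

theorem GoodExponent.exp_iter (h : GoodExponent θ κ a α) (hv : v ∈ lsvStrip θ) (n : ℕ) :
    Complex.exp (-(lsvIter α n v / α)) = Complex.exp (-(v / α))
      * ∏ j ∈ Finset.range n, (1 + Complex.exp (-lsvIter α (j + 1) v))⁻¹ := by
  induction n with
  | zero => simp [lsvIter_zero]
  | succ n ih =>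
    rw [Finset.prod_range_succ, ← mul_assoc, ← ih]
    have h1 := h.step_eq (h.iter_mem hv n)
    rw [← lsvIter_succ] at h1
    have h2 := h.ne_zero
    rw [← exp_logOneAddExpNeg (h.im_lt (h.iter_mem hv _)), ← Complex.exp_neg, ← Complex.exp_add]
    congr 1
    field_simp
    linear_combination -h1

/-- |Im α| ≤ cos θ · Re α keeps the angle between α and 1 + e^v at most a right angle. Hence every
factor of `lsvIterDeriv` has norm at most 1. -/
theorem GoodExponent.re_mul_inv_nonneg (h : GoodExponent θ κ a α) (hv : v ∈ lsvStrip θ) :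
    0 ≤ (α * (1 + Complex.exp v)⁻¹).re := by
  have hc : 0 < Real.cos θ := h.cos_pos
  have h1 : (Complex.exp v).re ≥ Real.exp v.re * Real.cos θ := by
    rw [Complex.exp_re]
    exact mul_le_mul_of_nonneg_left (cos_le_cos_im h.theta_lt hv.1.le) (Real.exp_pos _).le
  have h2 : |(Complex.exp v).im| ≤ Real.exp v.re :=
    (Complex.abs_im_le_norm _).trans (Complex.norm_exp v).le
  have h3 := h.abs_im_le_cos
  rw [Complex.mul_re, Complex.inv_re, Complex.inv_im]
  have h4 : 0 ≤ α.re * (1 + Complex.exp v).re + α.im * (1 + Complex.exp v).im := by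
    simp only [Complex.add_re, Complex.one_re, Complex.add_im, Complex.one_im, zero_add]
    have h5 : |α.im * (Complex.exp v).im| ≤ Real.cos θ * α.re * Real.exp v.re := by
      rw [abs_mul]
      exact mul_le_mul h3 h2 (abs_nonneg _) (mul_nonneg hc.le h.re_pos.le)
    have h6 := (abs_le.1 h5).1
    nlinarith [h.re_pos]
  have e : α.re * ((1 + Complex.exp v).re / Complex.normSq (1 + Complex.exp v))
      - α.im * (-(1 + Complex.exp v).im / Complex.normSq (1 + Complex.exp v))
      = (α.re * (1 + Complex.exp v).re + α.im * (1 + Complex.exp v).im)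
        / Complex.normSq (1 + Complex.exp v) := by ring
  rw [e]
  exact div_nonneg h4 (Complex.normSq_nonneg _)

theorem GoodExponent.norm_iterDeriv_le_one (h : GoodExponent θ κ a α) (hv : v ∈ lsvStrip θ)
    (n : ℕ) : ‖lsvIterDeriv α n v‖ ≤ 1 := by
  rw [lsvIterDeriv, norm_prod]
  refine Finset.prod_le_one (fun _ _ => norm_nonneg _) fun j _ => ?_
  rw [norm_inv]
  exact inv_le_one_of_one_le₀ (one_le_norm_one_add (h.re_mul_inv_nonneg (h.iter_mem hv _)))

/-- Growth constant of `exp (re (lsvIter α n v))`. -/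
noncomputable def lsvGrowth (θ a : ℝ) : ℝ :=
  a * (Real.cos θ / (1 + Real.exp 2) / 2) * Real.exp (-Real.exp 2)

theorem GoodExponent.growth_pos (h : GoodExponent θ κ a α) : 0 < lsvGrowth θ a := by
  have hc : 0 < Real.cos θ := h.cos_pos
  have := h.pos
  unfold lsvGrowth
  positivity

/-- A step increases Re v by at least a multiple of e^{-Re V}, that is, it increases e^{Re v} by at
least a constant. The linear growth that results is the complex counterpart of gⁿ(x) = O(n^{-1/α}).
-/
theorem GoodExponent.step_re_le (h : GoodExponent θ κ a α) (hv : v ∈ lsvStrip θ) :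
    v.re ≤ (lsvStep α v).re ∧
      Real.exp v.re + lsvGrowth θ a ≤ Real.exp (lsvStep α v).re := by
  have hV := h.step_mem hv
  have h1 := h.mul_log_re_ge h.theta_pos h.theta_lt hV.1.le hV.2.le
  have h2 : (lsvStep α v).re - (α * logOneAddExpNeg (lsvStep α v)).re = v.re := by
    rw [← Complex.sub_re, h.step_eq hv]
  have h3 : (α * logOneAddExpNeg (lsvStep α v)).re ≤ Real.exp 2 := by
    refine (Complex.re_le_norm _).trans ?_
    rw [norm_mul]
    have := h.norm_log_le hV
    nlinarith [h.norm_lt, norm_nonneg α, norm_nonneg (logOneAddExpNeg (lsvStep α v))]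
  have hc : 0 < Real.cos θ := h.cos_pos
  have ha := h.pos
  set δ := (α * logOneAddExpNeg (lsvStep α v)).re
  set X := (lsvStep α v).re
  set k := a * (Real.cos θ / (1 + Real.exp 2) / 2) with hk
  have hk0 : 0 < k := by positivity
  have hδ0 : 0 ≤ δ := le_trans (by positivity) h1
  refine ⟨by linarith, ?_⟩
  have hv' : v.re = X - δ := h2.symm
  have e1 : Real.exp X = Real.exp v.re * Real.exp δ := by rw [← Real.exp_add]; congr 1; linarith
  have e2 := Real.add_one_le_exp δ
  have e3 : Real.exp v.re * (k * Real.exp (-X)) = k * Real.exp (-δ) := by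
    rw [mul_left_comm, ← Real.exp_add]; congr 2; linarith
  have e4 : Real.exp (-Real.exp 2) ≤ Real.exp (-δ) := Real.exp_le_exp.2 (by linarith)
  have e5 : lsvGrowth θ a = k * Real.exp (-Real.exp 2) := rfl
  have e6 := Real.exp_pos v.re
  rw [e1, e5]
  nlinarith

theorem GoodExponent.iter_re_ge (h : GoodExponent θ κ a α) (hv : v ∈ lsvStrip θ) (n : ℕ) :
    v.re ≤ (lsvIter α n v).re ∧
      Real.exp v.re + lsvGrowth θ a * n ≤ Real.exp (lsvIter α n v).re := by
  induction n with
  | zero => simp [lsvIter_zero]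
  | succ n ih =>
    have h1 := h.step_re_le (h.iter_mem hv n)
    rw [lsvIter_succ]
    refine ⟨ih.1.trans h1.1, ?_⟩
    push_cast
    linarith [ih.2, h1.2]

/-- The decay comes from zₙ/z = e^{-(vₙ - v)/α} alone, with dvₙ/dv bounded by 1. Since |Im (vₙ - v)|
≤ 2θ and |Im α⁻¹| ≤ 1, the imaginary parts cost at most e^{2θ}. -/
theorem GoodExponent.norm_jac_le (h : GoodExponent θ κ a α) (hv : v ∈ lsvStrip θ) (n : ℕ) :
    ‖lsvJac α n v‖ ≤ Real.exp (2 * θ)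
      * (1 + lsvGrowth θ a / Real.exp v.re * n) ^ (-κ) := by
  have hne : Complex.exp (-(v / α)) ≠ 0 := Complex.exp_ne_zero _
  have e1 : (∏ j ∈ Finset.range n, (1 + Complex.exp (-lsvIter α (j + 1) v))⁻¹)
      = Complex.exp (-((lsvIter α n v - v) / α)) := by
    have h1 := h.exp_iter hv n
    have h2 : Complex.exp (-((lsvIter α n v - v) / α))
        = Complex.exp (-(lsvIter α n v / α)) * (Complex.exp (-(v / α)))⁻¹ := by
      rw [← Complex.exp_neg, ← Complex.exp_add]; congr 1; ring
    rw [h2, h1]; field_simp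
  rw [h.jac_eq hv, norm_mul, e1, Complex.norm_exp]
  have h1 := h.norm_iterDeriv_le_one hv n
  have h2 := h.iter_re_ge hv n
  have him1 := abs_lt.1 hv.1
  have him2 := abs_lt.1 (h.iter_mem hv n).1
  set V := lsvIter α n v
  have h3 : κ * (V.re - v.re) - 2 * θ ≤ ((V - v) / α).re := by
    rw [div_eq_mul_inv, Complex.mul_re, Complex.sub_re, Complex.sub_im]
    have h4 : |(V.im - v.im) * (α⁻¹).im| ≤ 2 * θ * 1 := by
      rw [abs_mul]
      refine mul_le_mul (abs_le.2 ⟨by linarith, by linarith⟩) h.inv_im (abs_nonneg _)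
        (by linarith [h.theta_pos])
    have h5 := (abs_le.1 h4).2
    have h6 := mul_le_mul_of_nonneg_right h.inv_re (sub_nonneg.2 h2.1)
    linarith
  have hE := Real.exp_pos v.re
  have hg := h.growth_pos
  have h7 : 1 + lsvGrowth θ a / Real.exp v.re * n ≤ Real.exp (V.re - v.re) := by
    rw [Real.exp_sub, le_div_iff₀ hE]
    have : (1 + lsvGrowth θ a / Real.exp v.re * n) * Real.exp v.re
        = Real.exp v.re + lsvGrowth θ a * n := by field_simp
    rw [this]; exact h2.2
  have h8 : Real.exp (V.re - v.re) ^ (-κ) ≤ (1 + lsvGrowth θ a / Real.exp v.re * n) ^ (-κ) :=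
    Real.rpow_le_rpow_of_nonpos (by positivity) h7 (by linarith [h.one_lt])
  rw [← Real.exp_mul] at h8
  calc Real.exp (-((V - v) / α)).re * ‖lsvIterDeriv α n v‖
      ≤ Real.exp (-((V - v) / α)).re * 1 := by gcongr
    _ ≤ Real.exp (2 * θ) * Real.exp ((V.re - v.re) * -κ) := by
        rw [mul_one, ← Real.exp_add, Complex.neg_re]
        exact Real.exp_le_exp.2 (by linarith)
    _ ≤ _ := by gcongr

theorem GoodExponent.norm_prod_le_one (h : GoodExponent θ κ a α) (hv : v ∈ lsvStrip θ) (n : ℕ) :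
    ‖∏ j ∈ Finset.range n, (1 + Complex.exp (-lsvIter α (j + 1) v))⁻¹‖ ≤ 1 := by
  rw [norm_prod]
  refine Finset.prod_le_one (fun _ _ => norm_nonneg _) fun j _ => ?_
  rw [norm_inv]
  exact inv_le_one_of_one_le₀ (one_le_norm_one_add
    (exp_neg_re_pos (h.im_lt (h.iter_mem hv _))).le)

theorem GoodExponent.norm_jac_le_one (h : GoodExponent θ κ a α) (hv : v ∈ lsvStrip θ) (n : ℕ) :
    ‖lsvJac α n v‖ ≤ 1 := by
  rw [h.jac_eq hv, norm_mul]
  exact mul_le_one₀ (h.norm_prod_le_one hv n) (norm_nonneg _) (h.norm_iterDeriv_le_one hv n)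

theorem GoodExponent.jac_factor_ne (h : GoodExponent θ κ a α) (hv : v ∈ lsvStrip θ) :
    1 + (1 + α) * Complex.exp (-v) ≠ 0 := by
  rw [one_add_mul_factor (h.im_lt hv)]
  exact mul_ne_zero (h.exp_neg_ne hv) (one_add_div_ne_zero h.norm_lt (h.im_lt hv))

theorem differentiableOn_lsvJac (hB : IsOpen B) (hgood : ∀ α ∈ B, GoodExponent θ κ a α) (n : ℕ) :
    DifferentiableOn ℂ (fun p : ℂ × ℂ => lsvJac p.1 n p.2) (B ×ˢ lsvStrip θ) := by
  induction n with
  | zero => simp only [lsvJac, Finset.range_zero, Finset.prod_empty]; fun_prop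
  | succ n ih =>
    simp only [lsvJac, Finset.prod_range_succ] at ih ⊢
    refine ih.mul (DifferentiableOn.inv ?_ fun p hp =>
      (hgood _ hp.1).jac_factor_ne ((hgood _ hp.1).iter_mem hp.2 _))
    exact ((differentiableOn_fst.const_add 1).mul
      (differentiableOn_lsvIter hB hgood (n + 1)).fun_neg.cexp).const_add 1

end Iterates

/-! ### Sums of negative powers along arithmetic progressions -/

section SumBound

/-- Comparison with an integral in telescoping form: b^{-κ} ≤ ((b - ε)^{1-κ} - b^{1-κ}) / (ε(κ -
1)). -/
theorem sum_one_add_mul_rpow_le {ε κ : ℝ} (hε : 0 < ε) (hκ : 1 < κ) (N : ℕ) :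
    ∑ n ∈ Finset.range (N + 1), (1 + ε * n) ^ (-κ)
      ≤ 1 + (1 - (1 + ε * N) ^ (1 - κ)) / (ε * (κ - 1)) := by
  have hd : 0 < ε * (κ - 1) := mul_pos hε (by linarith)
  induction N with
  | zero => simp
  | succ N ih =>
    rw [Finset.sum_range_succ]
    have key : (1 + ε * (N + 1 : ℕ)) ^ (-κ)
        ≤ ((1 + ε * N) ^ (1 - κ) - (1 + ε * (N + 1 : ℕ)) ^ (1 - κ)) / (ε * (κ - 1)) := by
      set b : ℝ := 1 + ε * (N + 1 : ℕ) with hb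
      have ha : 1 + ε * (N : ℝ) = b - ε := by rw [hb]; push_cast; ring
      have hb0 : 0 < b := by positivity
      have ha0 : 0 < b - ε := by rw [← ha]; positivity
      rw [ha, le_div_iff₀ hd]
      have h1 : (b - ε) ^ (1 - κ) = b ^ (1 - κ) * ((b - ε) / b) ^ (1 - κ) := by
        rw [Real.div_rpow ha0.le hb0.le]
        have := (Real.rpow_pos_of_pos hb0 (1 - κ)).ne'
        field_simp
      have h2 : 1 + (κ - 1) * (ε / b) ≤ ((b - ε) / b) ^ (1 - κ) := by
        have hq : 0 < (b - ε) / b := div_pos ha0 hb0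
        rw [Real.rpow_def_of_pos hq]
        have h3 := Real.log_le_sub_one_of_pos hq
        have h4 : (b - ε) / b - 1 = -(ε / b) := by field_simp; ring
        rw [h4] at h3
        have h5 := Real.add_one_le_exp (Real.log ((b - ε) / b) * (1 - κ))
        nlinarith
      have h3 : b ^ (-κ) = b ^ (1 - κ) / b := by
        rw [← Real.rpow_sub_one hb0.ne']; congr 1; ring
      have h4 := Real.rpow_pos_of_pos hb0 (1 - κ)
      rw [h1, h3]
      have h5 := mul_le_mul_of_nonneg_left h2 h4.le
      have h6 : b ^ (1 - κ) / b * (ε * (κ - 1)) = b ^ (1 - κ) * ((κ - 1) * (ε / b)) := by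
        field_simp
      linarith
    refine (add_le_add ih key).trans_eq ?_
    ring

/-- The order 1/ε is what matters: with ε proportional to e^{-Re v} the sum is O(e^{Re v}) for Re v
> -2, and this becomes the factor x^{-α} of the density. -/
theorem summable_one_add_mul_rpow {ε κ : ℝ} (hε : 0 < ε) (hκ : 1 < κ) :
    Summable (fun n : ℕ => (1 + ε * n) ^ (-κ)) ∧
      ∑' n : ℕ, (1 + ε * n) ^ (-κ) ≤ 1 + 1 / (ε * (κ - 1)) := by
  have hd : 0 < ε * (κ - 1) := mul_pos hε (by linarith)
  have h0 : ∀ n : ℕ, 0 ≤ (1 + ε * (n : ℝ)) ^ (-κ) := fun n => by positivity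
  have h1 : ∀ n : ℕ, ∑ i ∈ Finset.range n, (1 + ε * (i : ℝ)) ^ (-κ) ≤ 1 + 1 / (ε * (κ - 1)) := by
    intro n
    refine (Finset.sum_le_sum_of_subset_of_nonneg (Finset.range_mono (Nat.le_succ n))
      fun i _ _ => h0 i).trans ((sum_one_add_mul_rpow_le hε hκ n).trans ?_)
    gcongr
    have : 0 ≤ (1 + ε * (n : ℝ)) ^ (1 - κ) := by positivity
    linarith
  exact ⟨summable_of_sum_range_le h0 h1, Real.tsum_le_of_sum_range_le h0 h1⟩

end SumBound


/-! ### Inverse branches of the first return map and its transfer operator -/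

section Branches

variable {α z : ℂ} {θ κ a b : ℝ} {B : Set ℂ}

/-- The coordinate in which the inverse left branch becomes `lsvStep`. -/
noncomputable def lsvCoord (α z : ℂ) : ℂ := -α * Complex.log (2 * z)

/-- The `n`-th iterate of the inverse left branch of the LSV map. -/
noncomputable def lsvInv (α : ℂ) (n : ℕ) (z : ℂ) : ℂ :=
  Complex.exp (-(lsvIter α n (lsvCoord α z) / α)) / 2

/-- The derivative of `lsvInv α n`. -/
noncomputable def lsvInvDeriv (α : ℂ) (n : ℕ) (z : ℂ) : ℂ := lsvJac α n (lsvCoord α z)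

/-- Inverse branches of the first return map to `(1/2, 1]`. -/
noncomputable def lsvBranch (α : ℂ) (n : ℕ) (z : ℂ) : ℂ := (1 + lsvInv α n z) / 2

/-- The transfer operator of the first return map to `(1/2, 1]`. -/
noncomputable def lsvTransfer (α : ℂ) : (ℂ → ℂ) → ℂ → ℂ :=
  weightedComp (fun n z => lsvInvDeriv α n z / 2) (lsvBranch α)

/-- Domain on which the inverse branches with exponent `α` are holomorphic. -/
def lsvDomain (θ : ℝ) (α : ℂ) : Set ℂ :=
  {z : ℂ | z ∈ Complex.slitPlane ∧ ‖z‖ < 3 / 2 ∧ lsvCoord α z ∈ lsvStrip θ}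

/-- A complex neighbourhood of `[1/2, 1]` that all inverse branches preserve. -/
def lsvNhd : Set ℂ := {z : ℂ | 1 / 4 < z.re ∧ ‖z‖ < 3 / 2}

theorem isOpen_lsvNhd : IsOpen lsvNhd :=
  (isOpen_lt continuous_const Complex.continuous_re).inter
    (isOpen_lt continuous_norm continuous_const)

theorem convex_lsvNhd : Convex ℝ lsvNhd := by
  have : lsvNhd = {z : ℂ | 1 / 4 < z.re} ∩ ball 0 (3 / 2) := by
    ext; simp [lsvNhd]
  rw [this]
  exact (convex_halfSpace_re_gt _).inter (convex_ball _ _)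

theorem two_mul_mem_slitPlane (hz : z ∈ Complex.slitPlane) : 2 * z ∈ Complex.slitPlane := by
  rw [Complex.mem_slitPlane_iff] at hz ⊢
  simpa using hz

theorem abs_log_norm_le (hz : z ∈ lsvNhd) : |Real.log ‖2 * z‖| ≤ Real.log 3 := by
  have h1 : 1 / 4 < ‖z‖ := hz.1.trans_le (Complex.re_le_norm z)
  have h2 : ‖2 * z‖ = 2 * ‖z‖ := by simp
  have h3 := hz.2
  rw [h2, abs_le, ← Real.log_inv]
  constructor
  · exact Real.log_le_log (by norm_num) (by linarith)
  · exact Real.log_le_log (by linarith) (by linarith)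

/-- The cosine of the argument is Re z / |z| > (1/4)/(3/2) = 1/6, and π/2 - |arg| is at least its
own sine, which is that cosine. -/
theorem abs_arg_two_mul_le (hz : z ∈ lsvNhd) :
    |Complex.arg (2 * z)| ≤ Real.pi / 2 - 1 / 6 := by
  have h0 : 0 < z.re := by linarith [hz.1]
  have hre : (2 * z).re = 2 * z.re := by simp
  have hlt : |Complex.arg (2 * z)| < Real.pi / 2 :=
    Complex.abs_arg_lt_pi_div_two_iff.2 (Or.inl (by rw [hre]; linarith))
  have hne : 2 * z ≠ 0 := fun h => by rw [h] at hre; simp at hre; linarith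
  have hcos := Complex.cos_arg hne
  rw [← Real.cos_abs, ← Real.sin_pi_div_two_sub] at hcos
  have h2 : ‖2 * z‖ = 2 * ‖z‖ := by simp
  have h3 : 1 / 6 ≤ (2 * z).re / ‖2 * z‖ := by
    have h1 : 0 < ‖z‖ := h0.trans_le (Complex.re_le_norm z)
    rw [hre, h2, le_div_iff₀ (by linarith)]
    linarith [hz.1, hz.2]
  rw [← hcos] at h3
  have h4 := Real.sin_le (x := Real.pi / 2 - |Complex.arg (2 * z)|) (by linarith)
  linarith

theorem lsvCoord_re (α z : ℂ) :
    (lsvCoord α z).re = -(α.re * Real.log ‖2 * z‖) + α.im * Complex.arg (2 * z) := by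
  rw [lsvCoord, Complex.mul_re, Complex.log_re, Complex.log_im]; simp

theorem lsvCoord_im (α z : ℂ) :
    (lsvCoord α z).im = -(α.re * Complex.arg (2 * z)) - α.im * Real.log ‖2 * z‖ := by
  rw [lsvCoord, Complex.mul_im, Complex.log_re, Complex.log_im]; simp; ring

theorem log_three_lt : Real.log 3 < 1.4 := by
  have h1 : Real.log 3 ≤ Real.log (2 ^ 2) := Real.log_le_log (by norm_num) (by norm_num)
  rw [Real.log_pow] at h1
  push_cast at h1
  linarith [Real.log_two_lt_d9]

theorem GoodExponent.abs_im_le_half (h : GoodExponent θ κ a α) : |α.im| ≤ 1 / 3 := by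
  have h1 := h.abs_im_mul_exp_le h.theta_pos
  have h2 := Real.add_one_le_exp 2
  have h3 := h.theta_lt
  have h4 := Real.pi_lt_four
  nlinarith [abs_nonneg α.im]

/-- Numerically 1.4 + (π/2 - 1/6)/3 < 2; the lower bound is the one that the cut of `lsvStrip` at -2
requires. -/
theorem GoodExponent.abs_coord_re_lt (h : GoodExponent θ κ a α) (hz : z ∈ lsvNhd) :
    |(lsvCoord α z).re| < 2 := by
  have h1 := abs_log_norm_le hz
  have h2 := abs_arg_two_mul_le hz
  have h3 := h.abs_im_le_half
  rw [lsvCoord_re]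
  have h4 : |α.re * Real.log ‖2 * z‖| ≤ 1 * Real.log 3 := by
    rw [abs_mul, abs_of_pos h.re_pos]
    exact mul_le_mul h.re_lt_one.le h1 (abs_nonneg _) zero_le_one
  have h5 : |α.im * Complex.arg (2 * z)| ≤ 1 / 3 * (Real.pi / 2 - 1 / 6) := by
    rw [abs_mul]
    exact mul_le_mul h3 h2 (abs_nonneg _) (by norm_num)
  have h6 := log_three_lt
  have h7 := Real.pi_lt_d2
  rw [abs_le] at h4 h5
  rw [abs_lt]
  constructor <;> linarith [h4.1, h4.2, h5.1, h5.2]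

theorem GoodExponent.nhd_subset (h : GoodExponent θ κ a α) : lsvNhd ⊆ lsvDomain θ α := by
  intro z hz
  refine ⟨Or.inl (by linarith [hz.1]), hz.2, ?_, (abs_lt.1 (h.abs_coord_re_lt hz)).1⟩
  rw [lsvCoord_im]
  have h1 := abs_log_norm_le hz
  have h2 := abs_arg_two_mul_le hz
  have h4 : |α.im * Real.log ‖2 * z‖| ≤ |α.im| * Real.log 3 := by
    rw [abs_mul]
    exact mul_le_mul_of_nonneg_left h1 (abs_nonneg _)
  have h5 : |α.re * Complex.arg (2 * z)| ≤ α.re * (Real.pi / 2 - 1 / 6) := by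
    rw [abs_mul, abs_of_pos h.re_pos]
    exact mul_le_mul_of_nonneg_left h2 h.re_pos.le
  have h6 := h.domain
  rw [abs_le] at h4 h5
  rw [abs_lt]
  constructor <;> linarith [h4.1, h4.2, h5.1, h5.2]

theorem lsvDomain.ne_zero (hz : z ∈ lsvDomain θ α) : 2 * z ≠ 0 :=
  Complex.slitPlane_ne_zero (two_mul_mem_slitPlane hz.1)

theorem GoodExponent.exp_coord (h : GoodExponent θ κ a α) (hz : z ∈ lsvDomain θ α) :
    Complex.exp (-(lsvCoord α z / α)) = 2 * z := by
  have h1 := h.ne_zero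
  have : -(lsvCoord α z / α) = Complex.log (2 * z) := by rw [lsvCoord]; field_simp
  rw [this, Complex.exp_log (lsvDomain.ne_zero hz)]

theorem GoodExponent.inv_eq (h : GoodExponent θ κ a α) (hz : z ∈ lsvDomain θ α) (n : ℕ) :
    lsvInv α n z = z * ∏ j ∈ Finset.range n,
      (1 + Complex.exp (-lsvIter α (j + 1) (lsvCoord α z)))⁻¹ := by
  rw [lsvInv, h.exp_iter hz.2.2, h.exp_coord hz]; ring

theorem GoodExponent.norm_inv_le (h : GoodExponent θ κ a α) (hz : z ∈ lsvDomain θ α) (n : ℕ) :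
    ‖lsvInv α n z‖ ≤ ‖z‖ := by
  rw [h.inv_eq hz, norm_mul]
  exact mul_le_of_le_one_right (norm_nonneg _) (h.norm_prod_le_one hz.2.2 n)

theorem GoodExponent.hasDerivAt_inv (h : GoodExponent θ κ a α) (hz : z ∈ lsvDomain θ α) (n : ℕ) :
    HasDerivAt (lsvInv α n) (lsvInvDeriv α n z) z := by
  have h1 : HasDerivAt (lsvCoord α) (-α * (2 * z)⁻¹ * 2) z := by
    refine ((((hasDerivAt_id z).const_mul 2).clog (two_mul_mem_slitPlane hz.1)).const_mul
      (-α)).congr_deriv ?_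
    simp only [id]; ring
  have h2 := (h.hasDerivAt_iter hz.2.2 n).comp z h1
  have h3 := ((h2.div_const α).fun_neg.cexp).div_const 2
  refine h3.congr_deriv ?_
  have hα := h.ne_zero
  have hz0 : z ≠ 0 := fun h0 => lsvDomain.ne_zero hz (by simp [h0])
  simp only [Function.comp_apply]
  rw [h.exp_iter hz.2.2, h.exp_coord hz, lsvInvDeriv, h.jac_eq hz.2.2]
  field_simp

/-- For Re V ≥ 2 the modulus of e^{-V/α}/2 is below 1/2; otherwise the real part is positive by the
condition `angle`. The bound -1/2 is what places (1 + gⁿ z)/2 in the half-plane Re > 1/4. -/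
theorem GoodExponent.inv_re_gt (h : GoodExponent θ κ a α) (hz : z ∈ lsvDomain θ α) (n : ℕ) :
    -1 / 2 < (lsvInv α n z).re := by
  have hV := h.iter_mem hz.2.2 n
  rw [lsvInv]
  set V := lsvIter α n (lsvCoord α z)
  have hinv1 := h.inv_re
  have hinv2 := h.inv_im
  have hκ := h.one_lt
  have hpi := Real.pi_lt_four
  have hθ := h.theta_lt
  have him := h.inv_im
  rcases le_or_gt 2 V.re with h2 | h2
  · have h3 : 0 < (V / α).re := by
      rw [div_eq_mul_inv, Complex.mul_re]
      have h4 : |V.im * (α⁻¹).im| ≤ θ * 1 := by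
        rw [abs_mul]; exact mul_le_mul hV.1.le him (abs_nonneg _) h.theta_pos.le
      have h5 := (abs_le.1 h4).2
      nlinarith
    have h4 : ‖Complex.exp (-(V / α)) / 2‖ < 1 / 2 := by
      rw [norm_div, Complex.norm_exp, Complex.neg_re]
      have : Real.exp (-(V / α).re) < 1 := Real.exp_lt_one_iff.2 (by linarith)
      norm_num
      linarith
    have h5 := (abs_le.1 ((Complex.abs_re_le_norm _).trans h4.le)).1
    have h6 := (abs_lt.1 ((Complex.abs_re_le_norm _).trans_lt h4)).1
    linarith
  · have h3 : |(-(V / α)).im| < Real.pi / 2 := by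
      rw [Complex.neg_im, abs_neg, div_eq_mul_inv, Complex.mul_im]
      refine (abs_add_le _ _).trans_lt ?_
      rw [abs_mul, abs_mul, abs_of_pos (show 0 < (α⁻¹).re by linarith)]
      have h4 : |V.re| ≤ 2 := abs_le.2 ⟨hV.2.le, h2.le⟩
      have h5 := mul_le_mul_of_nonneg_right h4 (abs_nonneg (α⁻¹).im)
      have h6 := mul_le_mul_of_nonneg_right hV.1.le (show 0 ≤ (α⁻¹).re by linarith)
      linarith [h.angle]
    have h4 := exp_re_pos h3
    have h5 : (Complex.exp (-(V / α)) / 2).re = (Complex.exp (-(V / α))).re / 2 := by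
      simp
    rw [h5]; linarith

theorem GoodExponent.branch_mem (h : GoodExponent θ κ a α) (hz : z ∈ lsvDomain θ α) (n : ℕ) :
    lsvBranch α n z ∈ lsvNhd := by
  constructor
  · have h1 := h.inv_re_gt hz n
    have : (lsvBranch α n z).re = (1 + (lsvInv α n z).re) / 2 := by
      rw [lsvBranch]; simp
    rw [this]; linarith
  · have h1 := h.norm_inv_le hz n
    have h2 := hz.2.1
    rw [lsvBranch, norm_div]
    have h3 := norm_add_le 1 (lsvInv α n z)
    rw [norm_one] at h3
    norm_num
    linarith

theorem GoodExponent.norm_invDeriv_le_one (h : GoodExponent θ κ a α) (hz : z ∈ lsvDomain θ α)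
    (n : ℕ) : ‖lsvInvDeriv α n z‖ ≤ 1 :=
  h.norm_jac_le_one hz.2.2 n

/-- Constant in the bound on the sum of the derivatives of all inverse branches. -/
noncomputable def lsvSumConst (θ κ a : ℝ) : ℝ :=
  Real.exp (2 * θ) * (Real.exp 2 + 1 / (lsvGrowth θ a * (κ - 1)))

theorem GoodExponent.sumConst_pos (h : GoodExponent θ κ a α) : 0 < lsvSumConst θ κ a := by
  have h1 := h.growth_pos
  have h2 : 0 < κ - 1 := by linarith [h.one_lt]
  unfold lsvSumConst
  positivity

theorem GoodExponent.summable_invDeriv (h : GoodExponent θ κ a α) (hz : z ∈ lsvDomain θ α) :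
    Summable (fun n => ‖lsvInvDeriv α n z‖) ∧
      ∑' n, ‖lsvInvDeriv α n z‖ ≤ lsvSumConst θ κ a * Real.exp (lsvCoord α z).re := by
  set E := Real.exp (lsvCoord α z).re with hE
  have hE0 : 0 < E := Real.exp_pos _
  have hg := h.growth_pos
  have hκ : 0 < κ - 1 := by linarith [h.one_lt]
  obtain ⟨h1, h2⟩ := summable_one_add_mul_rpow (div_pos hg hE0) h.one_lt
  have h3 := fun n => h.norm_jac_le hz.2.2 n
  have h4 : Summable (fun n => ‖lsvInvDeriv α n z‖) :=
    Summable.of_nonneg_of_le (fun _ => norm_nonneg _) h3 (h1.mul_left _)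
  refine ⟨h4, ?_⟩
  calc ∑' n, ‖lsvInvDeriv α n z‖
      ≤ ∑' n : ℕ, Real.exp (2 * θ) * (1 + lsvGrowth θ a / E * n) ^ (-κ) :=
        h4.tsum_le_tsum h3 (h1.mul_left _)
    _ ≤ Real.exp (2 * θ) * (1 + 1 / (lsvGrowth θ a / E * (κ - 1))) := by
        rw [tsum_mul_left]; gcongr
    _ ≤ lsvSumConst θ κ a * E := by
        have h5 : 1 ≤ Real.exp 2 * E := by
          rw [hE, ← Real.exp_add]
          exact Real.one_le_exp (by linarith [hz.2.2.2])
        have h6 : 1 / (lsvGrowth θ a / E * (κ - 1)) = 1 / (lsvGrowth θ a * (κ - 1)) * E := by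
          field_simp
        rw [lsvSumConst, mul_assoc, add_mul, h6]
        gcongr

theorem GoodExponent.summable_transfer (h : GoodExponent θ κ a α) (hz : z ∈ lsvDomain θ α)
    {u : ℂ → ℂ} (hu : ∀ w ∈ lsvNhd, ‖u w‖ ≤ b) :
    Summable fun n => lsvInvDeriv α n z / 2 * u (lsvBranch α n z) := by
  refine Summable.of_norm_bounded (((h.summable_invDeriv hz).1.div_const 2).mul_right b)
    fun n => ?_
  rw [norm_mul, norm_div, RCLike.norm_ofNat]
  exact mul_le_mul_of_nonneg_left (hu _ (h.branch_mem hz n)) (by positivity)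

theorem GoodExponent.norm_transfer_le (h : GoodExponent θ κ a α) (hz : z ∈ lsvDomain θ α)
    {u : ℂ → ℂ} (hu : ∀ w ∈ lsvNhd, ‖u w‖ ≤ b) :
    ‖lsvTransfer α u z‖ ≤ lsvSumConst θ κ a * Real.exp (lsvCoord α z).re * b := by
  have hb : 0 ≤ b := (norm_nonneg _).trans (hu _ (h.branch_mem hz 0))
  obtain ⟨h1, h2⟩ := h.summable_invDeriv hz
  refine (tsum_of_norm_bounded (h1.mul_right b).hasSum fun n => ?_).trans ?_
  · rw [norm_mul, norm_div, RCLike.norm_ofNat]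
    have := hu _ (h.branch_mem hz n)
    have h3 := norm_nonneg (lsvInvDeriv α n z)
    nlinarith [norm_nonneg (u (lsvBranch α n z))]
  · rw [tsum_mul_right]; gcongr

theorem isOpen_setOf_mem_lsvDomain (hB : IsOpen B) :
    IsOpen {p : ℂ × ℂ | p.1 ∈ B ∧ p.2 ∈ lsvDomain θ p.1} := by
  have h1 : IsOpen (B ×ˢ (Complex.slitPlane ∩ ball 0 (3 / 2))) :=
    hB.prod (Complex.isOpen_slitPlane.inter isOpen_ball)
  have h2 : ContinuousOn (fun p : ℂ × ℂ => lsvCoord p.1 p.2)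
      (B ×ˢ (Complex.slitPlane ∩ ball 0 (3 / 2))) :=
    (continuousOn_fst.neg).mul ((continuousOn_const.mul continuousOn_snd).clog
      fun p hp => two_mul_mem_slitPlane hp.2.1)
  convert h2.isOpen_inter_preimage h1 (isOpen_lsvStrip θ) using 1
  ext p
  simp only [lsvDomain, mem_ofPred_eq, mem_inter_iff, mem_prod, mem_preimage, mem_ball_zero_iff,
    and_assoc]

theorem differentiableOn_lsvCoord :
    DifferentiableOn ℂ (fun p : ℂ × ℂ => lsvCoord p.1 p.2)
      {p : ℂ × ℂ | p.1 ∈ B ∧ p.2 ∈ lsvDomain θ p.1} :=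
  differentiableOn_fst.fun_neg.mul ((differentiableOn_snd.const_mul 2).clog
    fun _ hp => two_mul_mem_slitPlane hp.2.1)

theorem differentiableOn_lsvInv (hB : IsOpen B) (hgood : ∀ α ∈ B, GoodExponent θ κ a α) (n : ℕ) :
    DifferentiableOn ℂ (fun p : ℂ × ℂ => lsvInv p.1 n p.2)
      {p : ℂ × ℂ | p.1 ∈ B ∧ p.2 ∈ lsvDomain θ p.1} := by
  have h1 : DifferentiableOn ℂ (fun p : ℂ × ℂ => lsvIter p.1 n (lsvCoord p.1 p.2))
      {p : ℂ × ℂ | p.1 ∈ B ∧ p.2 ∈ lsvDomain θ p.1} :=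
    (differentiableOn_lsvIter hB hgood n).comp
      (differentiableOn_fst.prodMk differentiableOn_lsvCoord) fun p hp => ⟨hp.1, hp.2.2.2⟩
  simp only [lsvInv, div_eq_mul_inv]
  exact (h1.mul (differentiableOn_fst.inv
    fun p hp => (hgood _ hp.1).ne_zero)).fun_neg.cexp.mul_const _

theorem differentiableOn_lsvInvDeriv (hB : IsOpen B) (hgood : ∀ α ∈ B, GoodExponent θ κ a α)
    (n : ℕ) : DifferentiableOn ℂ (fun p : ℂ × ℂ => lsvInvDeriv p.1 n p.2)
      {p : ℂ × ℂ | p.1 ∈ B ∧ p.2 ∈ lsvDomain θ p.1} := by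
  have h1 : DifferentiableOn ℂ (fun p : ℂ × ℂ => (p.1, lsvCoord p.1 p.2))
      {p : ℂ × ℂ | p.1 ∈ B ∧ p.2 ∈ lsvDomain θ p.1} :=
    differentiableOn_fst.prodMk differentiableOn_lsvCoord
  have h2 : MapsTo (fun p : ℂ × ℂ => (p.1, lsvCoord p.1 p.2))
      {p : ℂ × ℂ | p.1 ∈ B ∧ p.2 ∈ lsvDomain θ p.1} (B ×ˢ lsvStrip θ) :=
    fun p hp => ⟨hp.1, hp.2.2.2⟩
  have h3 := differentiableOn_lsvJac hB hgood n
  have e : (fun p : ℂ × ℂ => lsvInvDeriv p.1 n p.2)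
      = (fun p : ℂ × ℂ => lsvJac p.1 n p.2) ∘ fun p : ℂ × ℂ => (p.1, lsvCoord p.1 p.2) := by
    ext p
    rw [lsvInvDeriv, Function.comp_apply]
  rw [e]
  exact h3.comp h1 h2

theorem differentiableOn_lsvBranch (hB : IsOpen B) (hgood : ∀ α ∈ B, GoodExponent θ κ a α)
    (n : ℕ) : DifferentiableOn ℂ (fun p : ℂ × ℂ => lsvBranch p.1 n p.2)
      {p : ℂ × ℂ | p.1 ∈ B ∧ p.2 ∈ lsvDomain θ p.1} := by
  simp only [lsvBranch, div_eq_mul_inv]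
  exact ((differentiableOn_lsvInv hB hgood n).const_add 1).mul_const _

/-- The bound on the terms degenerates as z → 0, so the M-test is applied locally, on an open set
where e^{Re v} is bounded by M. -/
theorem differentiableOn_lsvTransfer (hB : IsOpen B) (hgood : ∀ α ∈ B, GoodExponent θ κ a α)
    {u : ℂ × ℂ → ℂ} (hu : DifferentiableOn ℂ u (B ×ˢ lsvNhd))
    (hb : ∀ p ∈ B ×ˢ lsvNhd, ‖u p‖ ≤ b) :
    DifferentiableOn ℂ (fun p : ℂ × ℂ => lsvTransfer p.1 (fun z => u (p.1, z)) p.2)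
      {p : ℂ × ℂ | p.1 ∈ B ∧ p.2 ∈ lsvDomain θ p.1} := by
  set Ω := {p : ℂ × ℂ | p.1 ∈ B ∧ p.2 ∈ lsvDomain θ p.1} with hΩ
  have hΩo : IsOpen Ω := isOpen_setOf_mem_lsvDomain hB
  intro p₀ hp₀
  set M := Real.exp (lsvCoord p₀.1 p₀.2).re + 1 with hM
  have hM0 : 0 < M := by positivity
  set Ω' := Ω ∩ (fun p : ℂ × ℂ => Real.exp (lsvCoord p.1 p.2).re) ⁻¹' Iio M with hΩ'
  have hcont : ContinuousOn (fun p : ℂ × ℂ => Real.exp (lsvCoord p.1 p.2).re) Ω :=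
    (Complex.continuous_re.comp_continuousOn differentiableOn_lsvCoord.continuousOn).rexp
  have hΩ'o : IsOpen Ω' := hcont.isOpen_inter_preimage hΩo isOpen_Iio
  have hp₀' : p₀ ∈ Ω' := ⟨hp₀, by simp [hM]⟩
  have hg := (hgood _ hp₀.1).growth_pos
  have hκ := (hgood _ hp₀.1).one_lt
  have hsum := (summable_one_add_mul_rpow (div_pos hg hM0) hκ).1
  refine DifferentiableAt.differentiableWithinAt ?_
  refine DifferentiableOn.differentiableAt (s := Ω') ?_ (hΩ'o.mem_nhds hp₀')
  refine differentiableOn_tsum_of_norm_le ((hsum.mul_left (Real.exp (2 * θ))).mul_right b) hΩ'o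
    (fun n => ?_) fun n p hp => ?_
  · have h1 : DifferentiableOn ℂ (fun p : ℂ × ℂ => (p.1, lsvBranch p.1 n p.2)) Ω :=
      differentiableOn_fst.prodMk (differentiableOn_lsvBranch hB hgood n)
    have h2 := hu.comp h1 fun p hp => ⟨hp.1, (hgood _ hp.1).branch_mem hp.2 n⟩
    have h3 := ((differentiableOn_lsvInvDeriv hB hgood n).mul_const (2 : ℂ)⁻¹).mul h2
    exact h3.mono inter_subset_left
  · have hα := hgood _ hp.1.1
    have h1 := hb (p.1, lsvBranch p.1 n p.2) ⟨hp.1.1, hα.branch_mem hp.1.2 n⟩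
    have h2 := hα.norm_jac_le hp.1.2.2.2 n
    have hE := Real.exp_pos (lsvCoord p.1 p.2).re
    have h3 : (1 + lsvGrowth θ a / Real.exp (lsvCoord p.1 p.2).re * n) ^ (-κ)
        ≤ (1 + lsvGrowth θ a / M * n) ^ (-κ) := by
      refine Real.rpow_le_rpow_of_nonpos (by positivity) ?_ (by linarith)
      have : Real.exp (lsvCoord p.1 p.2).re ≤ M := (mem_Iio.1 hp.2).le
      gcongr
    rw [norm_mul, norm_div, RCLike.norm_ofNat]
    have h4 : ‖lsvInvDeriv p.1 n p.2‖ / 2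
        ≤ Real.exp (2 * θ) * (1 + lsvGrowth θ a / M * n) ^ (-κ) := by
      have h5 := h2.trans (mul_le_mul_of_nonneg_left h3 (Real.exp_pos (2 * θ)).le)
      have h6 := norm_nonneg (lsvInvDeriv p.1 n p.2)
      change ‖lsvInvDeriv p.1 n p.2‖ ≤ _ at h5
      linarith
    exact mul_le_mul h4 h1 (norm_nonneg _) (by positivity)

end Branches


/-! ### Complex exponents near a real one -/

section NearReal

/-- Opening of the invariant sector for exponents near `α₀`. -/
noncomputable def lsvAngle (α₀ : ℝ) : ℝ := α₀ * (Real.pi / 2 - 1 / 12)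

/-- Complex exponents near a real one in `(0, 1)` are good. -/
theorem eventually_goodExponent {α₀ : ℝ} (hα₀ : α₀ ∈ Ioo (0 : ℝ) 1) :
    ∀ᶠ α in 𝓝 (α₀ : ℂ), GoodExponent (lsvAngle α₀) ((1 + α₀⁻¹) / 2) (α₀ / 2) α := by
  obtain ⟨h0, h1⟩ := hα₀
  have hpi := Real.pi_gt_three
  have hθ0 : 0 < lsvAngle α₀ := mul_pos h0 (by linarith)
  have hθ : lsvAngle α₀ < Real.pi / 2 := by
    unfold lsvAngle; nlinarith
  have hinv : 1 < α₀⁻¹ := (one_lt_inv₀ h0).2 h1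
  have hne : (α₀ : ℂ) ≠ 0 := by exact_mod_cast h0.ne'
  have hs := sectorSlope_pos hθ0 hθ
  have cre : ContinuousAt (fun α : ℂ => α.re) α₀ := Complex.continuous_re.continuousAt
  have cim : ContinuousAt (fun α : ℂ => α.im) α₀ := Complex.continuous_im.continuousAt
  have cinv : ContinuousAt (fun α : ℂ => α⁻¹) α₀ := continuousAt_inv₀ hne
  have cire : ContinuousAt (fun α : ℂ => (α⁻¹).re) α₀ :=
    Complex.continuous_re.continuousAt.comp cinv
  have ciim : ContinuousAt (fun α : ℂ => (α⁻¹).im) α₀ :=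
    Complex.continuous_im.continuousAt.comp cinv
  have vire : ((α₀ : ℂ)⁻¹).re = α₀⁻¹ := by rw [← Complex.ofReal_inv, Complex.ofReal_re]
  have viim : ((α₀ : ℂ)⁻¹).im = 0 := by rw [← Complex.ofReal_inv, Complex.ofReal_im]
  have e1 : ∀ᶠ α in 𝓝 (α₀ : ℂ), α₀ / 2 < α.re :=
    cre.eventually_const_lt (by simpa using half_lt_self h0)
  have e2 : ∀ᶠ α in 𝓝 (α₀ : ℂ), ‖α‖ < 1 :=
    continuous_norm.continuousAt.eventually_lt_const (by simpa [abs_of_pos h0] using h1)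
  have e3 : ∀ᶠ α in 𝓝 (α₀ : ℂ), |α.im| < sectorSlope (lsvAngle α₀) * α.re := by
    refine ContinuousAt.eventually_lt cim.abs (cre.const_mul _) ?_
    simpa using mul_pos hs h0
  have e4 : ∀ᶠ α in 𝓝 (α₀ : ℂ), (1 + α₀⁻¹) / 2 < (α⁻¹).re :=
    cire.eventually_const_lt (by change _ < ((α₀ : ℂ)⁻¹).re; rw [vire]; linarith)
  have e5 : ∀ᶠ α in 𝓝 (α₀ : ℂ), |(α⁻¹).im| < 1 :=
    ciim.abs.eventually_lt_const (by change |((α₀ : ℂ)⁻¹).im| < 1; rw [viim]; simp)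
  have e6 : ∀ᶠ α in 𝓝 (α₀ : ℂ),
      lsvAngle α₀ * (α⁻¹).re + 2 * |(α⁻¹).im| < Real.pi / 2 := by
    refine ((cire.const_mul _).add (ciim.abs.const_mul 2)).eventually_lt_const ?_
    change lsvAngle α₀ * ((α₀ : ℂ)⁻¹).re + 2 * |((α₀ : ℂ)⁻¹).im| < _
    rw [vire, viim, lsvAngle, abs_zero]
    -- At α₀ the conditions `angle` and `domain` ask for θ/α₀ strictly between π/2 - 1/6 and π/2.
    -- The value 1/12 is the midpoint.
    have : α₀ * (Real.pi / 2 - 1 / 12) * α₀⁻¹ = Real.pi / 2 - 1 / 12 := by field_simp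
    linarith
  have e7 : ∀ᶠ α in 𝓝 (α₀ : ℂ),
      α.re * (Real.pi / 2 - 1 / 6) + |α.im| * Real.log 3 < lsvAngle α₀ := by
    refine ((cre.mul_const _).add (cim.abs.mul_const _)).eventually_lt_const ?_
    change (α₀ : ℂ).re * (Real.pi / 2 - 1 / 6) + |(α₀ : ℂ).im| * Real.log 3 < _
    simp only [Complex.ofReal_re, Complex.ofReal_im, abs_zero, zero_mul, add_zero, lsvAngle]
    nlinarith
  filter_upwards [e1, e2, e3, e4, e5, e6, e7] with α h1 h2 h3 h4 h5 h6 h7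
  exact ⟨hθ0, hθ, by linarith, by linarith, by linarith, h1.le, h2, h3.le, h4.le, h5.le, h6, h7⟩

theorem goodExponent_self {α₀ : ℝ} (hα₀ : α₀ ∈ Ioo (0 : ℝ) 1) :
    GoodExponent (lsvAngle α₀) ((1 + α₀⁻¹) / 2) (α₀ / 2) α₀ :=
  (eventually_goodExponent hα₀).self_of_nhds

end NearReal

/-! ### Bounded distortion at real exponents -/

section Distortion

variable {α : ℝ} {v z z' : ℂ} {θ κ a : ℝ}

/-- Decay exponent of the derivative of `lsvIter`. -/
noncomputable def lsvDecay (θ : ℝ) : ℝ := Real.cos θ / (1 + Real.exp 2) / 2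

theorem GoodExponent.decay_pos (h : GoodExponent θ κ a (α : ℂ)) : 0 < lsvDecay θ := by
  have := h.cos_pos
  unfold lsvDecay
  positivity

theorem GoodExponent.decay_le_one (h : GoodExponent θ κ a (α : ℂ)) : lsvDecay θ ≤ 1 := by
  have := h.cos_pos
  have h2 := Real.cos_le_one θ
  unfold lsvDecay
  rw [div_div, div_le_one (by positivity)]
  linarith [Real.exp_pos 2]

/-- Sharpens the bound of the factors of `lsvIterDeriv` by 1: each gains a fixed proportion of the
increment of the real part of the coordinate. The product then decays like a power of e^{Re vₙ}. -/
theorem GoodExponent.exp_le_norm_factor (h : GoodExponent θ κ a (α : ℂ)) (hv : v ∈ lsvStrip θ) :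
    Real.exp (lsvDecay θ * (α * logOneAddExpNeg v).re)
      ≤ ‖1 + (α : ℂ) * (1 + Complex.exp v)⁻¹‖ := by
  have hα0 : 0 < α := by simpa using h.re_pos
  have hα1 : α < 1 := by simpa using h.re_lt_one
  have hc := h.cos_pos
  have hc1 := Real.cos_le_one θ
  set E := Real.exp v.re with hE
  have hE0 : 0 < E := Real.exp_pos _
  have hE2 : 1 ≤ Real.exp 2 * E := by
    rw [hE, ← Real.exp_add]; exact Real.one_le_exp (by linarith [hv.2])
  have hX : E * Real.cos θ ≤ (Complex.exp v).re := by
    rw [Complex.exp_re]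
    exact mul_le_mul_of_nonneg_left (cos_le_cos_im h.theta_lt hv.1.le) hE0.le
  have hn : ‖1 + Complex.exp v‖ ≤ 1 + E := by
    refine (norm_add_le _ _).trans ?_
    rw [norm_one, Complex.norm_exp]
  have hn1 : 1 ≤ ‖1 + Complex.exp v‖ := one_le_norm_one_add (exp_re_pos (h.im_lt hv)).le
  have hre : Real.cos θ / (1 + E) ≤ ((1 + Complex.exp v)⁻¹).re := by
    rw [Complex.inv_re, Complex.normSq_eq_norm_sq, div_le_div_iff₀ (by positivity) (by positivity)]
    simp only [Complex.add_re, Complex.one_re]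
    nlinarith [mul_le_mul hn hn (by positivity) (by positivity)]
  set y := α * (Real.cos θ / ((1 + Real.exp 2) * E)) with hy
  have hy0 : 0 < y := by positivity
  have hy1 : y ≤ 1 := by
    rw [hy, ← mul_div_assoc, div_le_one (by positivity)]
    nlinarith
  have h1 : 1 + y ≤ ‖1 + (α : ℂ) * (1 + Complex.exp v)⁻¹‖ := by
    refine le_trans ?_ (Complex.re_le_norm _)
    rw [Complex.add_re, Complex.one_re, Complex.re_ofReal_mul]
    have : Real.cos θ / ((1 + Real.exp 2) * E) ≤ Real.cos θ / (1 + E) := by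
      gcongr; nlinarith
    have := mul_le_mul_of_nonneg_left (this.trans hre) hα0.le
    linarith
  refine le_trans ?_ h1
  rw [← Real.le_log_iff_exp_le (by positivity)]
  have h2 : ((α : ℂ) * logOneAddExpNeg v).re ≤ α * E⁻¹ := by
    rw [Complex.re_ofReal_mul]
    refine mul_le_mul_of_nonneg_left ((Complex.re_le_norm _).trans
      ((norm_logOneAddExpNeg_le (h.im_lt hv)).trans_eq ?_)) hα0.le
    rw [hE, Real.exp_neg]
  calc lsvDecay θ * ((α : ℂ) * logOneAddExpNeg v).re ≤ lsvDecay θ * (α * E⁻¹) :=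
        mul_le_mul_of_nonneg_left h2 h.decay_pos.le
    _ = y / 2 := by rw [hy, lsvDecay]; field_simp
    _ ≤ 1 - (1 + y)⁻¹ := by
        have : 1 - (1 + y)⁻¹ = y / (1 + y) := by field_simp; ring
        rw [this]; gcongr; linarith
    _ ≤ _ := Real.one_sub_inv_le_log_of_pos (by positivity)

theorem GoodExponent.norm_iterDeriv_le (h : GoodExponent θ κ a (α : ℂ)) (hv : v ∈ lsvStrip θ)
    (n : ℕ) : ‖lsvIterDeriv α n v‖
      ≤ Real.exp (-(lsvDecay θ * ((lsvIter α n v).re - v.re))) := by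
  induction n with
  | zero => simp [lsvIterDeriv, lsvIter_zero]
  | succ n ih =>
    have hV := h.iter_mem hv (n + 1)
    have h1 := h.exp_le_norm_factor hV
    have h2 := h.step_eq (h.iter_mem hv n)
    rw [← lsvIter_succ] at h2
    have h3 : ((α : ℂ) * logOneAddExpNeg (lsvIter α (n + 1) v)).re
        = (lsvIter α (n + 1) v).re - (lsvIter α n v).re := by
      rw [← h2]; simp
    rw [h3] at h1
    rw [lsvIterDeriv, Finset.prod_range_succ, ← lsvIterDeriv, norm_mul, norm_inv]
    have h4 := inv_anti₀ (Real.exp_pos _) h1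
    rw [← Real.exp_neg] at h4
    refine (mul_le_mul ih h4 (by positivity) (Real.exp_pos _).le).trans_eq ?_
    rw [← Real.exp_add]; congr 1; ring

/-- Logarithm of the reciprocal of `lsvJac`. -/
noncomputable def lsvLogJac (α : ℂ) (n : ℕ) (v : ℂ) : ℂ :=
  ∑ j ∈ Finset.range n, Complex.log (1 + (1 + α) * Complex.exp (-lsvIter α (j + 1) v))

theorem GoodExponent.re_jac_factor (h : GoodExponent θ κ a (α : ℂ)) (hv : v ∈ lsvStrip θ) :
    1 ≤ (1 + (1 + (α : ℂ)) * Complex.exp (-v)).re := by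
  have h1 := exp_neg_re_pos (h.im_lt hv)
  have hα0 : 0 < α := by simpa using h.re_pos
  have e : (1 + (1 + (α : ℂ)) * Complex.exp (-v)).re = 1 + (1 + α) * (Complex.exp (-v)).re := by
    simp [Complex.mul_re]
  rw [e]
  nlinarith

theorem GoodExponent.exp_neg_logJac (h : GoodExponent θ κ a (α : ℂ)) (hv : v ∈ lsvStrip θ)
    (n : ℕ) : lsvJac α n v = Complex.exp (-lsvLogJac α n v) := by
  rw [lsvLogJac, lsvJac, ← Finset.sum_neg_distrib, Complex.exp_sum]
  refine Finset.prod_congr rfl fun j _ => ?_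
  rw [Complex.exp_neg (Complex.log _), Complex.exp_log (h.jac_factor_ne (h.iter_mem hv _))]

/-- Bound for the logarithmic derivative of `lsvJac`. -/
noncomputable def lsvDistConst (θ a : ℝ) : ℝ :=
  ∑' n : ℕ, 2 * Real.exp 2 * (Real.exp 4 *
    (1 + lsvGrowth θ a * Real.exp 2 * n) ^ (-(1 + lsvDecay θ)))

/-- The terms are O(e^{-Re vⱼ} |dvⱼ/dv|) = O(e^{-(1+s) Re vⱼ}) = O(j^{-(1+s)}) with s = `lsvDecay
θ`. The decay of dvⱼ/dv is essential here, since the bound e^{-Re vⱼ} = O(1/j) alone is not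
summable. -/
theorem GoodExponent.hasDerivAt_logJac (h : GoodExponent θ κ a (α : ℂ)) (hv : v ∈ lsvStrip θ)
    (hv2 : v.re ≤ 2) (n : ℕ) :
    ∃ D : ℂ, HasDerivAt (lsvLogJac α n) D v ∧ ‖D‖ ≤ lsvDistConst θ a := by
  have hα0 : 0 < α := by simpa using h.re_pos
  have hα1 : α < 1 := by simpa using h.re_lt_one
  have hs0 := h.decay_pos
  have hs1 := h.decay_le_one
  have hg := h.growth_pos
  have hsum : Summable fun n : ℕ => 2 * Real.exp 2 * (Real.exp 4 *
      (1 + lsvGrowth θ a * Real.exp 2 * n) ^ (-(1 + lsvDecay θ))) :=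
    ((summable_one_add_mul_rpow (by positivity) (by linarith)).1.mul_left _).mul_left _
  refine ⟨∑ j ∈ Finset.range n, (1 + α) * (Complex.exp (-lsvIter α (j + 1) v)
    * -lsvIterDeriv α (j + 1) v) / (1 + (1 + α) * Complex.exp (-lsvIter α (j + 1) v)), ?_, ?_⟩
  · have h1 := HasDerivAt.fun_sum (u := Finset.range n)
      (A := fun j v => Complex.log (1 + (1 + α) * Complex.exp (-lsvIter α (j + 1) v)))
      fun j _ => (((h.hasDerivAt_iter hv (j + 1)).fun_neg.cexp.const_mul
        (1 + (α : ℂ))).const_add 1).clog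
        (Or.inl (zero_lt_one.trans_le (h.re_jac_factor (h.iter_mem hv (j + 1)))))
    exact h1
  · refine (norm_sum_le _ _).trans (le_trans (Finset.sum_le_sum fun j _ => ?_)
      (hsum.sum_le_tsum (Finset.range n) fun j _ => by positivity))
    have hV := h.iter_mem hv (j + 1)
    have h1 := (h.re_jac_factor hV).trans (Complex.re_le_norm _)
    have h2 := h.norm_iterDeriv_le hv (j + 1)
    have h3 := (h.iter_re_ge hv (j + 1)).2
    set V := lsvIter α (j + 1) v
    have h4 : ‖(1 : ℂ) + α‖ ≤ 2 := by
      refine (norm_add_le _ _).trans ?_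
      rw [norm_one]; linarith [h.norm_lt]
    have h5 : Real.exp (-2) * (1 + lsvGrowth θ a * Real.exp 2 * j) ≤ Real.exp V.re := by
      refine le_trans ?_ h3
      have e1 : Real.exp (-2) * (1 + lsvGrowth θ a * Real.exp 2 * j)
          = Real.exp (-2) + lsvGrowth θ a * j * (Real.exp (-2) * Real.exp 2) := by ring
      rw [e1, ← Real.exp_add]
      have e2 : Real.exp (-2) ≤ Real.exp v.re := Real.exp_le_exp.2 hv.2.le
      push_cast
      norm_num
      nlinarith
    have h6 : Real.exp V.re ^ (-(1 + lsvDecay θ))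
        ≤ Real.exp 4 * (1 + lsvGrowth θ a * Real.exp 2 * j) ^ (-(1 + lsvDecay θ)) := by
      refine (Real.rpow_le_rpow_of_nonpos (by positivity) h5 (by linarith)).trans ?_
      rw [Real.mul_rpow (Real.exp_pos _).le (by positivity), ← Real.exp_mul]
      gcongr
      linarith
    rw [norm_div, norm_mul, norm_mul, norm_neg, norm_exp_neg]
    refine (div_le_self (by positivity) h1).trans ?_
    have h7 : Real.exp (-V.re) * ‖lsvIterDeriv α (j + 1) v‖
        ≤ Real.exp 2 * Real.exp V.re ^ (-(1 + lsvDecay θ)) := by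
      refine (mul_le_mul_of_nonneg_left h2 (Real.exp_pos _).le).trans ?_
      rw [← Real.exp_mul, ← Real.exp_add, ← Real.exp_add]
      refine Real.exp_le_exp.2 ?_
      nlinarith
    calc ‖(1 : ℂ) + α‖ * (Real.exp (-V.re) * ‖lsvIterDeriv α (j + 1) v‖)
        ≤ 2 * (Real.exp 2 * (Real.exp 4 *
            (1 + lsvGrowth θ a * Real.exp 2 * j) ^ (-(1 + lsvDecay θ)))) := by
          refine mul_le_mul h4 (h7.trans ?_) (by positivity) (by norm_num)
          gcongr
      _ = _ := by ring

/-- Mean value inequality on the convex set `lsvNhd`. The factor 4 bounds the derivative of the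
coordinate, of norm |α|/|z|. -/
theorem GoodExponent.norm_invDeriv_le_exp_mul (h : GoodExponent θ κ a (α : ℂ)) (hz : z ∈ lsvNhd)
    (hz' : z' ∈ lsvNhd) (n : ℕ) : ‖lsvInvDeriv α n z‖
      ≤ Real.exp (lsvDistConst θ a * 4 * dist z z') * ‖lsvInvDeriv α n z'‖ := by
  have key : ∀ w ∈ lsvNhd, ∃ D : ℂ, HasDerivAt (fun w => lsvLogJac α n (lsvCoord α w)) D w ∧
      ‖D‖ ≤ lsvDistConst θ a * 4 := by
    intro w hw
    have hwd := h.nhd_subset hw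
    obtain ⟨D, hD, hDn⟩ := h.hasDerivAt_logJac hwd.2.2
      (abs_lt.1 (h.abs_coord_re_lt hw)).2.le n
    have h1 : HasDerivAt (lsvCoord α) (-α * (2 * w)⁻¹ * 2) w := by
      refine ((((hasDerivAt_id w).const_mul 2).clog (two_mul_mem_slitPlane hwd.1)).const_mul
        (-(α : ℂ))).congr_deriv ?_
      simp only [id]; ring
    refine ⟨_, hD.comp w h1, ?_⟩
    rw [norm_mul]
    refine mul_le_mul hDn ?_ (norm_nonneg _) ((norm_nonneg _).trans hDn)
    have h2 : 1 / 4 < ‖w‖ := hw.1.trans_le (Complex.re_le_norm w)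
    have h3 := h.norm_lt
    have e : ‖-(α : ℂ) * (2 * w)⁻¹ * 2‖ = ‖(α : ℂ)‖ / ‖w‖ := by
      rw [norm_mul, norm_mul, norm_neg, norm_inv, norm_mul, RCLike.norm_ofNat]; field_simp
    rw [e, div_le_iff₀ (by linarith)]
    linarith
  choose! D hD using key
  have h1 := convex_lsvNhd.norm_image_sub_le_of_norm_hasDerivWithin_le
    (fun w hw => (hD w hw).1.hasDerivWithinAt) (fun w hw => (hD w hw).2) hz hz'
  rw [lsvInvDeriv, lsvInvDeriv, h.exp_neg_logJac (h.nhd_subset hz).2.2,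
    h.exp_neg_logJac (h.nhd_subset hz').2.2, Complex.norm_exp, Complex.norm_exp, ← Real.exp_add]
  refine Real.exp_le_exp.2 ?_
  have h2 := (Complex.re_le_norm _).trans h1
  rw [← dist_eq_norm, dist_comm] at h2
  simp only [Complex.sub_re, Complex.neg_re] at h2 ⊢
  linarith

end Distortion


/-! ### Identification with the real LSV map and change of variables -/

section RealBranches

variable {α x y : ℝ} {v : ℂ} {θ κ a : ℝ}

/-- The conjugate of the solution solves the same equation, so uniqueness makes the solution real.
-/
theorem GoodExponent.step_im_eq_zero (h : GoodExponent θ κ a (α : ℂ)) (hv : v ∈ lsvStrip θ)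
    (him : v.im = 0) : (lsvStep α v).im = 0 := by
  have h1 := h.im_lt (h.step_mem hv)
  have h2 := h.step_eq hv
  have h3 : lsvStep α v = starRingEnd ℂ (lsvStep α v) := by
    refine eq_of_sub_mul_log_eq h.norm_lt h1 (by simpa using h1) ?_
    have h4 := congrArg (starRingEnd ℂ) h2
    rw [map_sub, map_mul, Complex.conj_ofReal, ← logOneAddExpNeg_conj h1,
      Complex.conj_eq_iff_im.2 him] at h4
    rw [h2, h4]
  exact Complex.conj_eq_iff_im.1 h3.symm

theorem GoodExponent.iter_im_eq_zero (h : GoodExponent θ κ a (α : ℂ)) (hv : v ∈ lsvStrip θ)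
    (him : v.im = 0) (n : ℕ) : (lsvIter α n v).im = 0 := by
  induction n with
  | zero => exact him
  | succ n ih => rw [lsvIter_succ]; exact h.step_im_eq_zero (h.iter_mem hv n) ih

theorem lsvCoord_ofReal (α : ℝ) (hx : 0 < x) :
    lsvCoord α x = ((-α * Real.log (2 * x) : ℝ) : ℂ) := by
  rw [lsvCoord]
  push_cast
  rw [Complex.ofReal_log (by linarith)]
  push_cast
  rfl

theorem ofReal_mem_lsvDomain (hα : α ∈ Ioo (0 : ℝ) 1) (hx : x ∈ Ioo (0 : ℝ) (3 / 2)) :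
    (x : ℂ) ∈ lsvDomain (lsvAngle α) α := by
  have h := goodExponent_self hα
  refine ⟨Complex.ofReal_mem_slitPlane.2 hx.1, ?_, ?_, ?_⟩
  · rw [Complex.norm_real, Real.norm_eq_abs, abs_of_pos hx.1]; exact hx.2
  · rw [lsvCoord_ofReal α hx.1, Complex.ofReal_im, abs_zero]; exact h.theta_pos
  · rw [lsvCoord_ofReal α hx.1, Complex.ofReal_re]
    have h1 : Real.log (2 * x) ≤ Real.log 3 :=
      Real.log_le_log (by linarith [hx.1]) (by linarith [hx.2])
    have h2 := log_three_lt
    nlinarith [hα.1, hα.2]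

theorem ofReal_mem_lsvNhd (hx : x ∈ Icc (1 / 2 : ℝ) 1) : (x : ℂ) ∈ lsvNhd := by
  constructor
  · rw [Complex.ofReal_re]; linarith [hx.1]
  · rw [Complex.norm_real, Real.norm_eq_abs, abs_of_pos (by linarith [hx.1])]; linarith [hx.2]

/-- Iterates of the inverse left branch of the LSV map, as real functions. -/
noncomputable def lsvRealInv (α : ℝ) (n : ℕ) (x : ℝ) : ℝ := (lsvInv α n x).re

/-- The derivative of `lsvRealInv α n`. -/
noncomputable def lsvRealDeriv (α : ℝ) (n : ℕ) (x : ℝ) : ℝ := (lsvInvDeriv α n x).re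

/-- The orbit of `x` under the inverse left branch, in the coordinate `-α log (2 x)`. -/
theorem exists_real_lsvIter (hα : α ∈ Ioo (0 : ℝ) 1) (hx : x ∈ Ioo (0 : ℝ) (3 / 2)) (n : ℕ) :
    ∃ r : ℝ, lsvIter α n (lsvCoord α x) = r ∧ lsvRealInv α n x = Real.exp (-(r / α)) / 2 ∧
      lsvInv α n x = lsvRealInv α n x := by
  have h := goodExponent_self hα
  have hd := ofReal_mem_lsvDomain hα hx
  have him := h.iter_im_eq_zero hd.2.2 (by rw [lsvCoord_ofReal α hx.1, Complex.ofReal_im]) n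
  obtain ⟨r, hr⟩ : ∃ r : ℝ, lsvIter α n (lsvCoord α x) = r :=
    ⟨(lsvIter α n (lsvCoord α x)).re, Complex.ext rfl (by simpa using him)⟩
  have e : lsvInv α n x = ((Real.exp (-(r / α)) / 2 : ℝ) : ℂ) := by
    rw [lsvInv, hr]; push_cast; rfl
  refine ⟨r, hr, by rw [lsvRealInv, e, Complex.ofReal_re], ?_⟩
  rw [lsvRealInv, e, Complex.ofReal_re]

theorem ofReal_lsvRealInv (hα : α ∈ Ioo (0 : ℝ) 1) (hx : x ∈ Ioo (0 : ℝ) (3 / 2)) (n : ℕ) :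
    lsvInv α n x = lsvRealInv α n x :=
  (exists_real_lsvIter hα hx n).choose_spec.2.2

theorem lsvRealInv_pos (hα : α ∈ Ioo (0 : ℝ) 1) (hx : x ∈ Ioo (0 : ℝ) (3 / 2)) (n : ℕ) :
    0 < lsvRealInv α n x := by
  obtain ⟨r, -, h, -⟩ := exists_real_lsvIter hα hx n
  rw [h]; positivity

theorem lsvRealInv_le (hα : α ∈ Ioo (0 : ℝ) 1) (hx : x ∈ Ioo (0 : ℝ) (3 / 2)) (n : ℕ) :
    lsvRealInv α n x ≤ x := by
  refine (Complex.re_le_norm _).trans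
    (((goodExponent_self hα).norm_inv_le (ofReal_mem_lsvDomain hα hx) n).trans_eq ?_)
  rw [Complex.norm_real, Real.norm_eq_abs, abs_of_pos hx.1]

theorem lsvRealDeriv_spec (hα : α ∈ Ioo (0 : ℝ) 1) (hx : x ∈ Ioo (0 : ℝ) (3 / 2)) (n : ℕ) :
    lsvInvDeriv α n x = lsvRealDeriv α n x ∧ 0 < lsvRealDeriv α n x := by
  have hα0 := hα.1
  have : ∃ d : ℝ, 0 < d ∧ lsvInvDeriv α n x = d := by
    choose r hr _ _ using fun n => exists_real_lsvIter hα hx n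
    refine ⟨∏ j ∈ Finset.range n, (1 + (1 + α) * Real.exp (-r (j + 1)))⁻¹,
      Finset.prod_pos fun j _ => by positivity, ?_⟩
    rw [lsvInvDeriv, lsvJac]
    push_cast
    exact Finset.prod_congr rfl fun j _ => by rw [hr]
  obtain ⟨d, hd, e⟩ := this
  rw [lsvRealDeriv, e, Complex.ofReal_re]
  exact ⟨rfl, hd⟩

theorem hasDerivAt_lsvRealInv (hα : α ∈ Ioo (0 : ℝ) 1) (hx : x ∈ Ioo (0 : ℝ) (3 / 2)) (n : ℕ) :
    HasDerivAt (lsvRealInv α n) (lsvRealDeriv α n x) x :=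
  ((goodExponent_self hα).hasDerivAt_inv (ofReal_mem_lsvDomain hα hx) n).real_of_complex

theorem lsvRealInv_zero (hα : α ∈ Ioo (0 : ℝ) 1) (hx : x ∈ Ioo (0 : ℝ) (3 / 2)) :
    lsvRealInv α 0 x = x := by
  rw [lsvRealInv, (goodExponent_self hα).inv_eq (ofReal_mem_lsvDomain hα hx)]
  simp

theorem lsvCoord_lsvRealInv (hα : α ∈ Ioo (0 : ℝ) 1) (hx : x ∈ Ioo (0 : ℝ) (3 / 2)) (n : ℕ) :
    lsvCoord α (lsvRealInv α n x) = lsvIter α n (lsvCoord α x) := by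
  obtain ⟨r, hr, h, -⟩ := exists_real_lsvIter hα hx n
  rw [lsvCoord_ofReal α (lsvRealInv_pos hα hx n), hr, h]
  congr 1
  have : 2 * (Real.exp (-(r / α)) / 2) = Real.exp (-(r / α)) := by ring
  rw [this, Real.log_exp]
  have := hα.1.ne'
  field_simp

theorem lsvRealInv_mem (hα : α ∈ Ioo (0 : ℝ) 1) (hx : x ∈ Ioo (0 : ℝ) (3 / 2)) (n : ℕ) :
    lsvRealInv α n x ∈ Ioo (0 : ℝ) (3 / 2) :=
  ⟨lsvRealInv_pos hα hx n, (lsvRealInv_le hα hx n).trans_lt hx.2⟩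

theorem lsvRealInv_succ (hα : α ∈ Ioo (0 : ℝ) 1) (hx : x ∈ Ioo (0 : ℝ) (3 / 2)) (n : ℕ) :
    lsvRealInv α (n + 1) x = lsvRealInv α n (lsvRealInv α 1 x) := by
  rw [lsvRealInv, lsvRealInv, lsvInv, lsvInv, lsvCoord_lsvRealInv hα hx, lsvIter_succ']
  rfl

theorem lsvRealDeriv_succ (hα : α ∈ Ioo (0 : ℝ) 1) (hx : x ∈ Ioo (0 : ℝ) (3 / 2)) (n : ℕ) :
    lsvRealDeriv α (n + 1) x = lsvRealDeriv α n (lsvRealInv α 1 x) * lsvRealDeriv α 1 x := by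
  have e : lsvInvDeriv α (n + 1) x
      = lsvInvDeriv α n (lsvRealInv α 1 x) * lsvInvDeriv α 1 x := by
    rw [lsvInvDeriv, lsvInvDeriv, lsvInvDeriv, lsvCoord_lsvRealInv hα hx, lsvJac, lsvJac, lsvJac,
      Finset.prod_range_succ']
    simp only [lsvIter_succ' (_ + 1), lsvIter_succ' 0, lsvIter_zero, Finset.range_one,
      Finset.prod_singleton, zero_add]
  rw [(lsvRealDeriv_spec hα hx _).1, (lsvRealDeriv_spec hα (lsvRealInv_mem hα hx 1) _).1,
    (lsvRealDeriv_spec hα hx _).1] at e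
  exact_mod_cast e

theorem lsvRealInv_one_mul (hα : α ∈ Ioo (0 : ℝ) 1) (hx : x ∈ Ioo (0 : ℝ) (3 / 2)) :
    lsvRealInv α 1 x * (1 + (2 : ℝ) ^ α * lsvRealInv α 1 x ^ α) = x := by
  have h := goodExponent_self hα
  have hd := ofReal_mem_lsvDomain hα hx
  obtain ⟨r, hr, hinv, hof⟩ := exists_real_lsvIter hα hx 1
  have hpos := lsvRealInv_pos hα hx 1
  have hα0 := hα.1.ne'
  have h1 := h.inv_eq hd 1
  rw [Finset.range_one, Finset.prod_singleton, zero_add, hr, hof] at h1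
  have h2 : lsvRealInv α 1 x = x * (1 + Real.exp (-r))⁻¹ := by exact_mod_cast h1
  have h3 : (2 : ℝ) ^ α * lsvRealInv α 1 x ^ α = Real.exp (-r) := by
    rw [← Real.mul_rpow (by norm_num) hpos.le, hinv]
    have : 2 * (Real.exp (-(r / α)) / 2) = Real.exp (-(r / α)) := by ring
    rw [this, ← Real.exp_mul]
    congr 1
    field_simp
  rw [h3]
  nth_rw 1 [h2]
  have : 1 + Real.exp (-r) ≠ 0 := by positivity
  field_simp

theorem lsvRealInv_one_le_half (hα : α ∈ Ioo (0 : ℝ) 1) (hx : x ∈ Ioc (0 : ℝ) 1) :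
    lsvRealInv α 1 x ≤ 1 / 2 := by
  have hx' : x ∈ Ioo (0 : ℝ) (3 / 2) := ⟨hx.1, by linarith [hx.2]⟩
  have h1 := lsvRealInv_one_mul hα hx'
  have hpos := lsvRealInv_pos hα hx' 1
  by_contra! hlt
  rw [← Real.mul_rpow (by norm_num) hpos.le] at h1
  have h2 : 1 < (2 * lsvRealInv α 1 x) ^ α := Real.one_lt_rpow (by linarith) hα.1
  nlinarith [hx.2]

theorem lsvMap_lsvRealInv (hα : α ∈ Ioo (0 : ℝ) 1) (hx : x ∈ Ioc (0 : ℝ) 1) :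
    lsvMap α (lsvRealInv α 1 x) = x := by
  rw [lsvMap, if_pos (lsvRealInv_one_le_half hα hx)]
  exact lsvRealInv_one_mul hα ⟨hx.1, by linarith [hx.2]⟩

theorem lsvMap_left_mem (hα : α ∈ Ioo (0 : ℝ) 1) (hy : y ∈ Ioc (0 : ℝ) (1 / 2)) :
    lsvMap α y ∈ Ioc (0 : ℝ) 1 := by
  refine ⟨?_, (lsvMap_mapsTo hα.1 ⟨hy.1.le, by linarith [hy.2]⟩).2⟩
  rw [lsvMap, if_pos hy.2]
  have := hy.1
  positivity

theorem lsvRealInv_lsvMap (hα : α ∈ Ioo (0 : ℝ) 1) (hy : y ∈ Ioc (0 : ℝ) (1 / 2)) :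
    lsvRealInv α 1 (lsvMap α y) = y := by
  have h := goodExponent_self hα
  have hx := lsvMap_left_mem hα hy
  have hα0 := hα.1.ne'
  have hy0 := hy.1
  have hV : lsvIter α 1 (lsvCoord α (lsvMap α y)) = ((-α * Real.log (2 * y) : ℝ) : ℂ) := by
    rw [lsvIter_succ' 0, lsvIter_zero]
    refine lsvStep_eq h.norm_lt (by rw [Complex.ofReal_im, abs_zero]; positivity) ?_
    rw [lsvCoord_ofReal α hx.1]
    have e1 : Real.exp (-(-α * Real.log (2 * y))) = (2 : ℝ) ^ α * y ^ α := by
      rw [← Real.mul_rpow (by norm_num) hy0.le, Real.rpow_def_of_pos (by positivity)]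
      congr 1; ring
    have e2 : logOneAddExpNeg ((-α * Real.log (2 * y) : ℝ) : ℂ)
        = ((Real.log (1 + (2 : ℝ) ^ α * y ^ α) : ℝ) : ℂ) := by
      rw [logOneAddExpNeg, ← Complex.ofReal_neg, ← Complex.ofReal_exp, e1,
        Complex.ofReal_log (by positivity)]
      push_cast; rfl
    rw [e2, lsvMap, if_pos hy.2]
    have e3 : Real.log (2 * (y * (1 + (2 : ℝ) ^ α * y ^ α)))
        = Real.log (2 * y) + Real.log (1 + (2 : ℝ) ^ α * y ^ α) := by
      rw [← mul_assoc, Real.log_mul (by positivity) (by positivity)]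
    rw [e3]
    push_cast
    ring
  obtain ⟨r, hr, hinv, -⟩ := exists_real_lsvIter hα ⟨hx.1, by linarith [hx.2]⟩ 1
  rw [hV] at hr
  have hr' : -α * Real.log (2 * y) = r := by exact_mod_cast hr
  rw [hinv, ← hr']
  have : -(-α * Real.log (2 * y) / α) = Real.log (2 * y) := by field_simp
  rw [this, Real.exp_log (by positivity)]
  ring

theorem tendsto_lsvRealInv (hα : α ∈ Ioo (0 : ℝ) 1) (hx : x ∈ Ioo (0 : ℝ) (3 / 2)) :
    Tendsto (fun n => lsvRealInv α n x) atTop (𝓝 0) := by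
  have h := goodExponent_self hα
  have hd := ofReal_mem_lsvDomain hα hx
  choose r hr hinv _ using fun n => exists_real_lsvIter hα hx n
  have h1 : Tendsto (fun n => Real.exp (r n)) atTop atTop := by
    refine tendsto_atTop_mono (fun n => ?_)
      (tendsto_natCast_atTop_atTop.const_mul_atTop h.growth_pos : Tendsto (fun n : ℕ =>
        lsvGrowth (lsvAngle α) (α / 2) * n) atTop atTop)
    have h2 := (h.iter_re_ge hd.2.2 n).2
    rw [hr, Complex.ofReal_re] at h2
    linarith [Real.exp_pos (lsvCoord α x).re]
  have h2 : Tendsto r atTop atTop := Real.tendsto_exp_comp_atTop.1 h1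
  have h3 : Tendsto (fun n => Real.exp (-(r n / α)) / 2) atTop (𝓝 (0 / 2)) :=
    (Real.tendsto_exp_neg_atTop_nhds_zero.comp (h2.atTop_div_const hα.1)).div_const 2
  simp only [hinv]
  simpa using h3

theorem strictMonoOn_lsvRealInv (hα : α ∈ Ioo (0 : ℝ) 1) (n : ℕ) :
    StrictMonoOn (lsvRealInv α n) (Ioo (0 : ℝ) (3 / 2)) := by
  refine strictMonoOn_of_deriv_pos (convex_Ioo _ _)
    (fun x hx => (hasDerivAt_lsvRealInv hα hx n).continuousAt.continuousWithinAt) fun x hx => ?_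
  rw [interior_Ioo] at hx
  rw [(hasDerivAt_lsvRealInv hα hx n).deriv]
  exact (lsvRealDeriv_spec hα hx n).2

theorem lsvRealInv_one_one (hα : α ∈ Ioo (0 : ℝ) 1) : lsvRealInv α 1 1 = 1 / 2 := by
  have h1 := lsvRealInv_lsvMap hα (y := 1 / 2) (by norm_num)
  have h2 : lsvMap α (1 / 2) = 1 := by
    rw [lsvMap, if_pos le_rfl, ← Real.mul_rpow (by norm_num) (by norm_num)]
    norm_num
  rwa [h2] at h1

theorem image_lsvRealInv (hα : α ∈ Ioo (0 : ℝ) 1) (n : ℕ) :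
    lsvRealInv α n '' Ioc (1 / 2) 1 = Ioc (lsvRealInv α (n + 1) 1) (lsvRealInv α n 1) := by
  have hsub : Icc (1 / 2 : ℝ) 1 ⊆ Ioo (0 : ℝ) (3 / 2) := fun x hx =>
    ⟨by linarith [hx.1], by linarith [hx.2]⟩
  have hmono := strictMonoOn_lsvRealInv hα n
  rw [lsvRealInv_succ hα (by norm_num), lsvRealInv_one_one hα]
  refine Subset.antisymm ?_ (intermediate_value_Ioc (by norm_num) fun x hx =>
    (hasDerivAt_lsvRealInv hα (hsub hx) n).continuousAt.continuousWithinAt)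
  rintro _ ⟨x, hx, rfl⟩
  exact ⟨hmono (by norm_num) (hsub ⟨hx.1.le, hx.2⟩) hx.1,
    hmono.monotoneOn (hsub ⟨hx.1.le, hx.2⟩) (by norm_num) hx.2⟩

theorem antitone_lsvRealInv_one (hα : α ∈ Ioo (0 : ℝ) 1) : Antitone fun n => lsvRealInv α n 1 := by
  refine antitone_nat_of_succ_le fun n => ?_
  rw [lsvRealInv_succ hα (by norm_num), lsvRealInv_one_one hα]
  exact (strictMonoOn_lsvRealInv hα n).monotoneOn (by norm_num) (by norm_num) (by norm_num)

/-- The intervals are the images gⁿ((1/2, 1]). Their affine images under y ↦ (1 + y)/2 tile (1/2,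
1], which makes the duality with Lebesgue measure exact. -/
theorem iUnion_Ioc_lsvRealInv (hα : α ∈ Ioo (0 : ℝ) 1) :
    ⋃ n, Ioc (lsvRealInv α (n + 1) 1) (lsvRealInv α n 1) = Ioc 0 1 := by
  have h1 : (1 : ℝ) ∈ Ioo (0 : ℝ) (3 / 2) := by norm_num
  refine Subset.antisymm (iUnion_subset fun n x hx =>
    ⟨(lsvRealInv_pos hα h1 _).trans hx.1, hx.2.trans (lsvRealInv_le hα h1 n)⟩) fun x hx => ?_
  have hex : ∃ n, lsvRealInv α n 1 < x :=
    ((tendsto_lsvRealInv hα h1).eventually_lt_const hx.1).exists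
  classical
  obtain ⟨m, hm⟩ : ∃ m, Nat.find hex = m + 1 := by
    refine Nat.exists_eq_succ_of_ne_zero fun h0 => ?_
    have := Nat.find_spec hex
    rw [h0, lsvRealInv_zero hα h1] at this
    linarith [hx.2]
  refine mem_iUnion.2 ⟨m, ?_, not_lt.1 (Nat.find_min hex (m := m) (by omega))⟩
  rw [← hm]; exact Nat.find_spec hex

/-- Real inverse branches of the first return map. -/
noncomputable def lsvRealBranch (α : ℝ) (n : ℕ) (x : ℝ) : ℝ := (1 + lsvRealInv α n x) / 2

theorem ofReal_lsvRealBranch (hα : α ∈ Ioo (0 : ℝ) 1) (hx : x ∈ Ioo (0 : ℝ) (3 / 2)) (n : ℕ) :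
    lsvBranch α n x = lsvRealBranch α n x := by
  rw [lsvBranch, ofReal_lsvRealInv hα hx, lsvRealBranch]; push_cast; rfl

theorem lsvRealBranch_mem (hα : α ∈ Ioo (0 : ℝ) 1) (hx : x ∈ Ioc (0 : ℝ) 1) (n : ℕ) :
    lsvRealBranch α n x ∈ Ioc (1 / 2 : ℝ) 1 := by
  have hx' : x ∈ Ioo (0 : ℝ) (3 / 2) := ⟨hx.1, by linarith [hx.2]⟩
  have h1 := lsvRealInv_pos hα hx' n
  have h2 := lsvRealInv_le hα hx' n
  unfold lsvRealBranch
  constructor <;> linarith [hx.2]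

theorem hasDerivAt_lsvRealBranch (hα : α ∈ Ioo (0 : ℝ) 1) (hx : x ∈ Ioo (0 : ℝ) (3 / 2)) (n : ℕ) :
    HasDerivAt (lsvRealBranch α n) (lsvRealDeriv α n x / 2) x :=
  ((hasDerivAt_lsvRealInv hα hx n).const_add 1).div_const 2

theorem image_lsvRealBranch (hα : α ∈ Ioo (0 : ℝ) 1) (n : ℕ) :
    lsvRealBranch α n '' Ioc (1 / 2) 1
      = Ioc ((1 + lsvRealInv α (n + 1) 1) / 2) ((1 + lsvRealInv α n 1) / 2) := by
  have e : lsvRealBranch α n = (fun y => (1 + y) / 2) ∘ lsvRealInv α n := rfl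
  rw [e, image_comp, image_lsvRealInv hα]
  ext y
  simp only [mem_image, mem_Ioc]
  constructor
  · rintro ⟨w, hw, rfl⟩; constructor <;> linarith [hw.1, hw.2]
  · rintro hy; exact ⟨2 * y - 1, ⟨by linarith [hy.1], by linarith [hy.2]⟩, by ring⟩

/-- The first return map preserves integrals against Lebesgue measure in the dual sense. -/
theorem tsum_lintegral_lsvRealBranch (hα : α ∈ Ioo (0 : ℝ) 1) (s : ℝ → ENNReal) :
    ∑' n, ∫⁻ x in Ioc (1 / 2) 1,
        ENNReal.ofReal (lsvRealDeriv α n x / 2) * s (lsvRealBranch α n x)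
      = ∫⁻ x in Ioc (1 / 2) 1, s x := by
  have hsub : ∀ x ∈ Ioc (1 / 2 : ℝ) 1, x ∈ Ioo (0 : ℝ) (3 / 2) := fun x hx =>
    ⟨by linarith [hx.1], by linarith [hx.2]⟩
  have hterm : ∀ n, ∫⁻ x in Ioc (1 / 2) 1,
      ENNReal.ofReal (lsvRealDeriv α n x / 2) * s (lsvRealBranch α n x)
      = ∫⁻ x in Ioc ((1 + lsvRealInv α (n + 1) 1) / 2) ((1 + lsvRealInv α n 1) / 2), s x := by
    intro n
    rw [← image_lsvRealBranch hα n, lintegral_image_eq_lintegral_abs_deriv_mul measurableSet_Ioc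
      (fun x hx => (hasDerivAt_lsvRealBranch hα (hsub x hx) n).hasDerivWithinAt) ?_]
    · refine setLIntegral_congr_fun measurableSet_Ioc fun x hx => ?_
      have := (lsvRealDeriv_spec hα (hsub x hx) n).2
      rw [abs_of_pos (by positivity)]
    · intro x hx y hy hxy
      refine (strictMonoOn_lsvRealInv hα n).injOn (hsub x hx) (hsub y hy) ?_
      unfold lsvRealBranch at hxy
      linarith
  simp only [hterm]
  have hanti : Antitone fun n => (1 + lsvRealInv α n 1) / 2 := fun m n hmn => by
    have := antitone_lsvRealInv_one hα hmn
    simp only at this ⊢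
    linarith
  have hdisj : Pairwise (Function.onFun Disjoint fun n =>
      Ioc ((1 + lsvRealInv α (n + 1) 1) / 2) ((1 + lsvRealInv α n 1) / 2)) :=
    hanti.pairwise_disjoint_on_Ioc_succ
  rw [← lintegral_iUnion (fun n => measurableSet_Ioc) hdisj]
  congr 2
  ext y
  have := Set.ext_iff.1 (iUnion_Ioc_lsvRealInv hα) (2 * y - 1)
  simp only [mem_iUnion, mem_Ioc] at this ⊢
  constructor
  · rintro ⟨n, h1, h2⟩
    have := this.1 ⟨n, by linarith, by linarith⟩
    constructor <;> linarith [this.1, this.2]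
  · rintro ⟨h1, h2⟩
    obtain ⟨n, h3, h4⟩ := this.2 ⟨by linarith, by linarith⟩
    exact ⟨n, by linarith, by linarith⟩

end RealBranches


/-! ### Lebesgue mean on [1/2, 1] as an invariant mean of the transfer operator -/

section MeanValue

variable {α : ℝ} {D d : ℝ}

/-- The interval `[1/2, 1]` as a subset of the complex plane. -/
def lsvBase : Set ℂ := (fun x : ℝ => (x : ℂ)) '' Icc (1 / 2) 1

theorem lsvBase_subset : lsvBase ⊆ lsvNhd := by
  rintro _ ⟨x, hx, rfl⟩
  exact ofReal_mem_lsvNhd hx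

theorem lsvBase_nonempty : lsvBase.Nonempty := ⟨_, 1, by norm_num, rfl⟩

/-- The positive weights dominating `lsvTransfer`. -/
noncomputable def lsvWeight (α : ℝ) (n : ℕ) (z : ℂ) : ℝ := ‖lsvInvDeriv α n z‖ / 2

theorem mapsTo_lsvBranch_base (hα : α ∈ Ioo (0 : ℝ) 1) (n : ℕ) :
    MapsTo (lsvBranch α n) lsvBase lsvBase := by
  rintro _ ⟨x, hx, rfl⟩
  have hx' : x ∈ Ioc (0 : ℝ) 1 := ⟨by linarith [hx.1], hx.2⟩
  refine ⟨lsvRealBranch α n x, Ioc_subset_Icc_self (lsvRealBranch_mem hα hx' n), ?_⟩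
  exact (ofReal_lsvRealBranch hα ⟨hx'.1, by linarith [hx.2]⟩ n).symm

theorem lsvDistConst_nonneg (hα : α ∈ Ioo (0 : ℝ) 1) : 0 ≤ lsvDistConst (lsvAngle α) (α / 2) := by
  have := (goodExponent_self hα).growth_pos
  exact tsum_nonneg fun n => by positivity

/-- The contraction factor 1/2 is that of y ↦ (1 + y)/2, as |(gⁿ)'| ≤ 1 on a convex set. The
diameter 3 is twice the radius 3/2. -/
theorem contractingWeights_lsv (hα : α ∈ Ioo (0 : ℝ) 1) :
    ContractingWeights (lsvWeight α) (lsvBranch α) lsvNhd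
      (lsvDistConst (lsvAngle α) (α / 2) * 4) 3 := by
  have h := goodExponent_self hα
  refine ⟨fun n x _ => by unfold lsvWeight; positivity,
    fun n z hz => h.branch_mem (h.nhd_subset hz) n, fun n z hz z' hz' => ?_,
    fun n z hz z' hz' => ?_, fun z hz => (h.summable_invDeriv (h.nhd_subset hz)).1.div_const 2,
    fun z hz z' hz' => ?_⟩
  · have h1 := convex_lsvNhd.norm_image_sub_le_of_norm_hasDerivWithin_le
      (fun w hw => (h.hasDerivAt_inv (h.nhd_subset hw) n).hasDerivWithinAt)
      (fun w hw => h.norm_invDeriv_le_one (h.nhd_subset hw) n) hz' hz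
    have e : lsvBranch α n z - lsvBranch α n z' = (lsvInv α n z - lsvInv α n z') / 2 := by
      unfold lsvBranch; ring
    rw [dist_eq_norm, dist_eq_norm, e, norm_div, RCLike.norm_ofNat]
    linarith
  · have h1 := h.norm_invDeriv_le_exp_mul hz hz' n
    unfold lsvWeight
    linarith
  · have h1 := hz.2
    have h2 := hz'.2
    rw [dist_eq_norm]
    linarith [norm_sub_le z z']

theorem LogLip.continuousOn {Z : Type*} [PseudoMetricSpace Z] {s : Set Z} {u : Z → ℝ}
    (hu : LogLip D s u) (hD : 0 ≤ D) (hd : ∀ x ∈ s, ∀ y ∈ s, dist x y ≤ d) :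
    ContinuousOn u s := by
  obtain ⟨b, hb⟩ := hu.exists_bound hD hd
  intro x hx
  have hlim : Tendsto (fun y => (Real.exp (D * dist y x) - 1) * b) (𝓝[s] x) (𝓝 0) := by
    have : ContinuousAt (fun y => (Real.exp (D * dist y x) - 1) * b) x := by fun_prop
    have h2 := this.tendsto
    simp only [dist_self, mul_zero, Real.exp_zero, sub_self, zero_mul] at h2
    exact h2.mono_left nhdsWithin_le_nhds
  rw [ContinuousWithinAt, tendsto_iff_dist_tendsto_zero]
  refine squeeze_zero' (Eventually.of_forall fun _ => dist_nonneg) ?_ hlim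
  filter_upwards [self_mem_nhdsWithin] with y hy
  have h1 := hu.le y hy x hx
  have h2 := hu.le x hx y hy
  rw [dist_comm x y] at h2
  have h3 := (abs_le.1 (hb x hx)).2
  have h4 := (abs_le.1 (hb y hy)).2
  have h5 : 1 ≤ Real.exp (D * dist y x) := Real.one_le_exp (mul_nonneg hD dist_nonneg)
  rw [Real.dist_eq, abs_le]
  constructor <;> nlinarith

/-- The mean value over `[1/2, 1]`. -/
noncomputable def lsvRealMean (u : ℂ → ℝ) : ℝ := 2 * ∫ x in (1 / 2 : ℝ)..1, u x

theorem dist_lsvBase_le : ∀ z ∈ lsvBase, ∀ z' ∈ lsvBase, dist z z' ≤ 3 := by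
  intro z hz z' hz'
  have h1 := (lsvBase_subset hz).2
  have h2 := (lsvBase_subset hz').2
  rw [dist_eq_norm]
  linarith [norm_sub_le z z']

theorem ContinuousOn.comp_ofReal {X : Type*} [TopologicalSpace X] {u : ℂ → X}
    (hu : ContinuousOn u lsvBase) : ContinuousOn (fun x : ℝ => u x) (Icc (1 / 2) 1) :=
  hu.comp (by fun_prop) fun x hx => ⟨x, hx, rfl⟩

theorem ContinuousOn.intervalIntegrable_half {X : Type*} [NormedAddCommGroup X] {u : ℂ → X}
    (hu : ContinuousOn u lsvBase) :
    IntervalIntegrable (fun x : ℝ => u x) volume (1 / 2) 1 :=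
  ContinuousOn.intervalIntegrable (by rw [uIcc_of_le (by norm_num)]; exact hu.comp_ofReal)

theorem integral_eq_toReal_lintegral_of_nonneg {f : ℝ → ℝ} (hf : ContinuousOn f (Icc (1 / 2) 1))
    (h0 : ∀ x ∈ Icc (1 / 2 : ℝ) 1, 0 ≤ f x) :
    ∫ x in (1 / 2 : ℝ)..1, f x = (∫⁻ x in Ioc (1 / 2) 1, ENNReal.ofReal (f x)).toReal := by
  rw [intervalIntegral.integral_of_le (by norm_num), integral_eq_lintegral_of_nonneg_ae]
  · filter_upwards [ae_restrict_mem measurableSet_Ioc] with x hx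
    exact h0 x (Ioc_subset_Icc_self hx)
  · exact (hf.mono Ioc_subset_Icc_self).aestronglyMeasurable measurableSet_Ioc

theorem continuousOn_lsvRealDeriv (hα : α ∈ Ioo (0 : ℝ) 1) (n : ℕ) :
    ContinuousOn (lsvRealDeriv α n) (Ioo (0 : ℝ) (3 / 2)) := by
  obtain ⟨r, hr, hgood⟩ := Metric.eventually_nhds_iff_ball.1 (eventually_goodExponent hα)
  have h1 := (differentiableOn_lsvInvDeriv isOpen_ball hgood n).continuousOn
  refine Complex.continuous_re.comp_continuousOn (h1.comp
    (f := fun x : ℝ => ((α : ℂ), (x : ℂ))) (by fun_prop) fun x hx =>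
      ⟨mem_ball_self hr, ofReal_mem_lsvDomain hα hx⟩)

theorem lsvWeight_ofReal (hα : α ∈ Ioo (0 : ℝ) 1) {x : ℝ} (hx : x ∈ Ioo (0 : ℝ) (3 / 2)) (n : ℕ) :
    lsvWeight α n x = lsvRealDeriv α n x / 2 := by
  obtain ⟨h1, h2⟩ := lsvRealDeriv_spec hα hx n
  rw [lsvWeight, h1, Complex.norm_real, Real.norm_eq_abs, abs_of_pos h2]

/-- With χ = 1 this is the invariance of the mean. With χ the indicator of an invariant set it is
the starting point of ergodicity. -/
theorem lintegral_mul_weightedComp (hα : α ∈ Ioo (0 : ℝ) 1) {u : ℂ → ℝ} (hD : 0 ≤ D)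
    (hu : LogLip D lsvBase u) {χ : ℝ → ENNReal} (hχ : Measurable χ)
    (hinv : ∀ n, ∀ x ∈ Ioc (1 / 2 : ℝ) 1, χ (lsvRealBranch α n x) = χ x) :
    ∫⁻ x : ℝ in Ioc (1 / 2) 1,
        χ x * ENNReal.ofReal (weightedComp (lsvWeight α) (lsvBranch α) u x)
      = ∫⁻ x : ℝ in Ioc (1 / 2) 1, χ x * ENNReal.ofReal (u x) := by
  have hW := (contractingWeights_lsv hα).mono lsvBase_subset (mapsTo_lsvBranch_base hα)
  have hcu := (hu.continuousOn hD dist_lsvBase_le).comp_ofReal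
  have hsub : ∀ x ∈ Ioc (1 / 2 : ℝ) 1, x ∈ Ioo (0 : ℝ) (3 / 2) := fun x hx =>
    ⟨by linarith [hx.1], by linarith [hx.2]⟩
  have hsub' : ∀ x ∈ Ioc (1 / 2 : ℝ) 1, x ∈ Ioc (0 : ℝ) 1 := fun x hx => ⟨by linarith [hx.1], hx.2⟩
  rw [← tsum_lintegral_lsvRealBranch hα fun x => χ x * ENNReal.ofReal (u x)]
  have hcongr : ∀ n, ∫⁻ x in Ioc (1 / 2) 1, ENNReal.ofReal (lsvRealDeriv α n x / 2) *
      (χ (lsvRealBranch α n x) * ENNReal.ofReal (u (lsvRealBranch α n x)))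
      = ∫⁻ x in Ioc (1 / 2) 1, χ x * (ENNReal.ofReal (lsvRealDeriv α n x / 2) *
        ENNReal.ofReal (u (lsvRealBranch α n x))) := fun n =>
    setLIntegral_congr_fun measurableSet_Ioc fun x hx => by
      rw [hinv n x hx, mul_left_comm]
  rw [tsum_congr hcongr, ← lintegral_tsum]
  · refine setLIntegral_congr_fun measurableSet_Ioc fun x hx => ?_
    have hxb : (x : ℂ) ∈ lsvBase := ⟨x, Ioc_subset_Icc_self hx, rfl⟩
    obtain ⟨b, hb⟩ := hu.exists_bound hD dist_lsvBase_le
    simp only [weightedComp]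
    rw [ENNReal.tsum_mul_left, ENNReal.ofReal_tsum_of_nonneg
      (fun n => mul_nonneg (hW.nonneg n _ hxb) (hu.nonneg _ (hW.mapsTo n hxb)))
      (hW.summable_mul hb hxb)]
    congr 1
    refine tsum_congr fun n => ?_
    rw [ENNReal.ofReal_mul (hW.nonneg n _ hxb), lsvWeight_ofReal hα (hsub x hx),
      ofReal_lsvRealBranch hα (hsub x hx)]
  · intro n
    refine hχ.aemeasurable.fun_mul (AEMeasurable.fun_mul ?_ ?_)
    · refine AEMeasurable.ennreal_ofReal ?_
      exact (((continuousOn_lsvRealDeriv hα n).mono hsub).div_const 2).aemeasurable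
        measurableSet_Ioc
    · refine AEMeasurable.ennreal_ofReal ?_
      refine ContinuousOn.aemeasurable ?_ measurableSet_Ioc
      exact hcu.comp (fun x hx => (hasDerivAt_lsvRealBranch hα (hsub x hx)
        n).continuousAt.continuousWithinAt)
        fun x hx => Ioc_subset_Icc_self (lsvRealBranch_mem hα (hsub' x hx) n)

theorem lsvRealMean_weightedComp (hα : α ∈ Ioo (0 : ℝ) 1) {u : ℂ → ℝ} (hD : 0 ≤ D)
    (hu : LogLip D lsvBase u) :
    lsvRealMean (weightedComp (lsvWeight α) (lsvBranch α) u) = lsvRealMean u := by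
  have hW := (contractingWeights_lsv hα).mono lsvBase_subset (mapsTo_lsvBranch_base hα)
  have hTu := hu.weightedComp hD hW
  have hK := lsvDistConst_nonneg hα
  have h1 := lintegral_mul_weightedComp hα hD hu (χ := fun _ => 1) measurable_const fun _ _ _ => rfl
  simp only [one_mul] at h1
  unfold lsvRealMean
  congr 1
  rw [integral_eq_toReal_lintegral_of_nonneg
      (hTu.continuousOn (by positivity) dist_lsvBase_le).comp_ofReal
      fun x hx => hTu.nonneg _ ⟨x, hx, rfl⟩,
    integral_eq_toReal_lintegral_of_nonneg (hu.continuousOn hD dist_lsvBase_le).comp_ofReal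
      fun x hx => hu.nonneg _ ⟨x, hx, rfl⟩, h1]

theorem lsvRealMean_const (c : ℝ) : lsvRealMean (fun _ => c) = c := by
  rw [lsvRealMean, intervalIntegral.integral_const, smul_eq_mul]; ring

theorem lsvRealMean_mono {u v : ℂ → ℝ} (hu : ContinuousOn u lsvBase)
    (hv : ContinuousOn v lsvBase) (h : ∀ z ∈ lsvBase, u z ≤ v z) : lsvRealMean u ≤ lsvRealMean v :=
  mul_le_mul_of_nonneg_left (intervalIntegral.integral_mono_on (by norm_num)
    hu.intervalIntegrable_half hv.intervalIntegrable_half fun x hx => h _ ⟨x, hx, rfl⟩)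
    (by norm_num)

theorem invariantMean_lsv (hα : α ∈ Ioo (0 : ℝ) 1) (hD : 0 ≤ D) :
    InvariantMean lsvRealMean (lsvWeight α) (lsvBranch α) lsvBase D 3 where
  map_const := lsvRealMean_const
  map_sub_const u hu c := by
    have h1 := (hu.continuousOn hD dist_lsvBase_le).intervalIntegrable_half
    rw [lsvRealMean, lsvRealMean, intervalIntegral.integral_sub h1 intervalIntegrable_const,
      intervalIntegral.integral_const, smul_eq_mul]
    ring
  map_weightedComp u hu := lsvRealMean_weightedComp hα hD hu
  lower u hu x hx := by
    have h1 := lsvRealMean_mono (hu.continuousOn hD dist_lsvBase_le)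
      (continuousOn_const (c := Real.exp (D * 3) * u x)) fun y hy => (hu.le y hy x hx).trans
        (mul_le_mul_of_nonneg_right (Real.exp_le_exp.2 (mul_le_mul_of_nonneg_left
          (dist_lsvBase_le y hy x hx) hD)) (hu.nonneg x hx))
    rw [lsvRealMean_const] at h1
    have h2 := mul_le_mul_of_nonneg_left h1 (Real.exp_pos (-(D * 3))).le
    rwa [← mul_assoc, ← Real.exp_add, neg_add_cancel, Real.exp_zero, one_mul] at h2
  upper u hu x hx := by
    have h1 := lsvRealMean_mono (continuousOn_const (c := Real.exp (-(D * 3)) * u x))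
      (hu.continuousOn hD dist_lsvBase_le) fun y hy => by
        have h1 := (hu.le x hx y hy).trans
          (mul_le_mul_of_nonneg_right (Real.exp_le_exp.2 (mul_le_mul_of_nonneg_left
            (dist_lsvBase_le x hx y hy) hD)) (hu.nonneg y hy))
        have h2 := mul_le_mul_of_nonneg_left h1 (Real.exp_pos (-(D * 3))).le
        rwa [← mul_assoc, ← Real.exp_add, neg_add_cancel, Real.exp_zero, one_mul] at h2
    rw [lsvRealMean_const] at h1
    have h2 := mul_le_mul_of_nonneg_left h1 (Real.exp_pos (D * 3)).le
    rwa [← mul_assoc, ← Real.exp_add, add_neg_cancel, Real.exp_zero, one_mul] at h2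
  nonneg u hu := by
    have h1 := lsvRealMean_mono (continuousOn_const (c := (0 : ℝ)))
      (hu.continuousOn hD dist_lsvBase_le) hu.nonneg
    rwa [lsvRealMean_const] at h1

end MeanValue


/-! ### The transfer operator minus its mean on bounded holomorphic functions -/

section Remainder

variable {α : ℝ} {β z x : ℂ} {θ κ a b : ℝ} {B : Set ℂ} {u v : ℂ → ℂ}

/-- Holomorphic functions on `lsvNhd` bounded by `b`. -/
structure HolBound (b : ℝ) (v : ℂ → ℂ) : Prop where
  differentiableOn : DifferentiableOn ℂ v lsvNhd
  le : ∀ z ∈ lsvNhd, ‖v z‖ ≤ b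

theorem HolBound.nonneg (hv : HolBound b v) : 0 ≤ b :=
  (norm_nonneg _).trans (hv.le _ (lsvBase_subset lsvBase_nonempty.some_mem))

theorem HolBound.const (c : ℂ) : HolBound ‖c‖ fun _ => c :=
  ⟨differentiableOn_const c, fun _ _ => le_rfl⟩

theorem HolBound.sub {c : ℝ} (hu : HolBound b u) (hv : HolBound c v) :
    HolBound (b + c) fun z => u z - v z :=
  ⟨hu.differentiableOn.sub hv.differentiableOn, fun z hz =>
    (norm_sub_le _ _).trans (add_le_add (hu.le z hz) (hv.le z hz))⟩

theorem HolBound.const_mul (hu : HolBound b u) {c : ℂ} (hc : ‖c‖ ≤ 1) :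
    HolBound b fun z => c * u z :=
  ⟨hu.differentiableOn.const_mul c, fun z hz => by
    rw [norm_mul]
    exact (mul_le_of_le_one_left (norm_nonneg _) hc).trans (hu.le z hz)⟩

/-- The ball of radius 1/4 about x lies in `lsvNhd`, so the Schwarz lemma gives the slope 2b/(1/4).
At distance 1/4 or more the trivial bound 2b suffices. -/
theorem HolBound.norm_sub_le (hv : HolBound b v) (hz : z ∈ lsvNhd) (hx : x ∈ lsvBase) :
    ‖v z - v x‖ ≤ 8 * b * dist z x := by
  have hb := hv.nonneg
  have hx' := lsvBase_subset hx
  obtain ⟨t, ht, rfl⟩ := hx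
  simp only at hx' ⊢
  have hsub : ball (t : ℂ) (1 / 4) ⊆ lsvNhd := by
    intro w hw
    rw [mem_ball, dist_eq_norm] at hw
    have h1 := (abs_le.1 (Complex.abs_re_le_norm (w - t))).1
    have h2 := norm_le_norm_add_norm_sub' w t
    have h3 : ‖(t : ℂ)‖ ≤ 1 := by
      rw [Complex.norm_real, Real.norm_eq_abs, abs_of_pos (by linarith [ht.1])]; exact ht.2
    rw [Complex.sub_re, Complex.ofReal_re] at h1
    exact ⟨by linarith [ht.1], by linarith⟩
  rcases lt_or_ge (dist z t) (1 / 4) with h | h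
  · have h1 := dist_le_of_norm_le_ball (hv.differentiableOn.mono hsub)
      (fun w hw => hv.le w (hsub hw)) (mem_ball.2 h)
    rw [← dist_eq_norm z] at h1
    linarith
  · have h1 := _root_.norm_sub_le (v z) (v t)
    have h2 := hv.le z hz
    have h3 := hv.le t hx'
    nlinarith

/-- The mean value over `[1/2, 1]` of a complex function. -/
noncomputable def lsvMean (u : ℂ → ℂ) : ℂ := 2 * ∫ x in (1 / 2 : ℝ)..1, u x

/-- The transfer operator without its leading eigenvalue at real exponents. -/
noncomputable def lsvRemainder (α : ℂ) (u : ℂ → ℂ) (z : ℂ) : ℂ := lsvTransfer α u z - lsvMean u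

theorem lsvMean_congr (h : ∀ z ∈ lsvBase, u z = v z) : lsvMean u = lsvMean v := by
  unfold lsvMean
  rw [intervalIntegral.integral_congr]
  rw [uIcc_of_le (by norm_num)]
  exact fun x hx => h _ ⟨x, hx, rfl⟩

theorem lsvMean_const (c : ℂ) : lsvMean (fun _ => c) = c := by
  rw [lsvMean, intervalIntegral.integral_const, Complex.real_smul]; push_cast; ring

theorem norm_lsvMean_le (hu : ∀ z ∈ lsvBase, ‖u z‖ ≤ b) : ‖lsvMean u‖ ≤ b := by
  rw [lsvMean, norm_mul, RCLike.norm_ofNat]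
  have h1 := intervalIntegral.norm_integral_le_of_norm_le_const (a := (1 / 2 : ℝ)) (b := 1)
    (f := fun x : ℝ => u x) (C := b) fun x hx => by
      rw [uIoc_of_le (by norm_num)] at hx
      exact hu _ ⟨x, Ioc_subset_Icc_self hx, rfl⟩
  rw [show |(1 : ℝ) - 1 / 2| = 1 / 2 by rw [abs_of_pos] <;> norm_num] at h1
  linarith

theorem HolBound.intervalIntegrable (hv : HolBound b v) :
    IntervalIntegrable (fun x : ℝ => v x) volume (1 / 2) 1 :=
  (hv.differentiableOn.continuousOn.mono lsvBase_subset).intervalIntegrable_half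

theorem lsvMean_sub {c : ℝ} (hu : HolBound b u) (hv : HolBound c v) :
    lsvMean (fun z => u z - v z) = lsvMean u - lsvMean v := by
  rw [lsvMean, intervalIntegral.integral_sub hu.intervalIntegrable hv.intervalIntegrable]
  unfold lsvMean
  ring

theorem lsvMean_const_mul (c : ℂ) : lsvMean (fun z => c * u z) = c * lsvMean u := by
  rw [lsvMean, intervalIntegral.integral_const_mul, lsvMean]; ring

theorem HolBound.re_lsvMean (hu : HolBound b u) :
    (lsvMean u).re = lsvRealMean fun z => (u z).re := by
  have := Complex.reCLM.intervalIntegral_comp_comm hu.intervalIntegrable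
  simp only [Complex.reCLM_apply] at this
  rw [lsvMean, lsvRealMean, this, Complex.mul_re]
  simp

theorem lsvTransfer_congr (h : GoodExponent θ κ a β) (huv : ∀ z ∈ lsvNhd, u z = v z)
    (hz : z ∈ lsvDomain θ β) : lsvTransfer β u z = lsvTransfer β v z :=
  tsum_congr fun n => by rw [huv _ (h.branch_mem hz n)]

theorem lsvRemainder_congr (h : GoodExponent θ κ a β) (huv : ∀ z ∈ lsvNhd, u z = v z)
    (hz : z ∈ lsvNhd) : lsvRemainder β u z = lsvRemainder β v z := by
  rw [lsvRemainder, lsvRemainder, lsvTransfer_congr h huv (h.nhd_subset hz),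
    lsvMean_congr fun z hz => huv z (lsvBase_subset hz)]

/-- Bound for the transfer operator on `lsvNhd`. -/
noncomputable def lsvNormConst (θ κ a : ℝ) : ℝ := lsvSumConst θ κ a * Real.exp 2

theorem GoodExponent.normConst_pos (h : GoodExponent θ κ a β) : 0 < lsvNormConst θ κ a :=
  mul_pos h.sumConst_pos (Real.exp_pos _)

theorem HolBound.lsvTransfer (hu : HolBound b u) (hB : IsOpen B)
    (hgood : ∀ α ∈ B, GoodExponent θ κ a α) (hβ : β ∈ B) :
    HolBound (lsvNormConst θ κ a * b) (lsvTransfer β u) where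
  differentiableOn := by
    have h1 := differentiableOn_lsvTransfer hB hgood (u := fun p => u p.2)
      (hu.differentiableOn.comp differentiableOn_snd fun p hp => hp.2) fun p hp => hu.le _ hp.2
    exact h1.comp (f := fun z => (β, z)) (by fun_prop) fun z hz => ⟨hβ, (hgood β hβ).nhd_subset hz⟩
  le z hz := by
    have h := hgood β hβ
    refine (h.norm_transfer_le (h.nhd_subset hz) hu.le).trans ?_
    have h1 := (abs_lt.1 (h.abs_coord_re_lt hz)).2.le
    have h2 := hu.nonneg
    have h3 := h.sumConst_pos
    unfold lsvNormConst
    gcongr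

theorem HolBound.lsvRemainder (hu : HolBound b u) (hB : IsOpen B)
    (hgood : ∀ α ∈ B, GoodExponent θ κ a α) (hβ : β ∈ B) :
    HolBound ((lsvNormConst θ κ a + 1) * b) (lsvRemainder β u) where
  differentiableOn := (hu.lsvTransfer hB hgood hβ).differentiableOn.sub_const _
  le z hz := by
    refine (_root_.norm_sub_le _ _).trans ?_
    have h1 := (hu.lsvTransfer hB hgood hβ).le z hz
    have h2 := norm_lsvMean_le fun z hz => hu.le z (lsvBase_subset hz)
    linarith

theorem HolBound.iterate_lsvRemainder (hu : HolBound b u) (hB : IsOpen B)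
    (hgood : ∀ α ∈ B, GoodExponent θ κ a α) (hβ : β ∈ B) (k : ℕ) :
    HolBound ((lsvNormConst θ κ a + 1) ^ k * b) ((_root_.lsvRemainder β)^[k] u) := by
  induction k with
  | zero => simpa using hu
  | succ k ih =>
    rw [Function.iterate_succ_apply', pow_succ', mul_assoc]
    exact ih.lsvRemainder hB hgood hβ

theorem exists_ball_goodExponent (hα : α ∈ Ioo (0 : ℝ) 1) : ∃ r > 0, ∀ β ∈ ball (α : ℂ) r,
    GoodExponent (lsvAngle α) ((1 + α⁻¹) / 2) (α / 2) β :=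
  Metric.eventually_nhds_iff_ball.1 (eventually_goodExponent hα)

theorem lsvInvDeriv_div_two_of_mem_base (hα : α ∈ Ioo (0 : ℝ) 1) (hx : x ∈ lsvBase) (n : ℕ) :
    lsvInvDeriv α n x / 2 = (lsvWeight α n x : ℂ) := by
  obtain ⟨t, ht, rfl⟩ := hx
  have ht' : t ∈ Ioo (0 : ℝ) (3 / 2) := ⟨by linarith [ht.1], by linarith [ht.2]⟩
  simp only
  rw [lsvWeight_ofReal hα ht', (lsvRealDeriv_spec hα ht' n).1]
  push_cast
  rfl

theorem HolBound.re_lipschitz (hv : HolBound b v) : (∀ x ∈ lsvBase, |(v x).re| ≤ b) ∧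
    ∀ x ∈ lsvBase, ∀ y ∈ lsvBase, |(v x).re - (v y).re| ≤ 8 * b * dist x y := by
  refine ⟨fun x hx => (Complex.abs_re_le_norm _).trans (hv.le x (lsvBase_subset hx)),
    fun x hx y hy => ?_⟩
  rw [← Complex.sub_re]
  exact (Complex.abs_re_le_norm _).trans (hv.norm_sub_le (lsvBase_subset hx) hy)

theorem contractingWeights_lsv_base (hα : α ∈ Ioo (0 : ℝ) 1) :
    ContractingWeights (lsvWeight α) (lsvBranch α) lsvBase
      (lsvDistConst (lsvAngle α) (α / 2) * 4) 3 :=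
  (contractingWeights_lsv hα).mono lsvBase_subset (mapsTo_lsvBranch_base hα)

theorem lsvRealMean_weightedComp_of_lipschitz (hα : α ∈ Ioo (0 : ℝ) 1) {v : ℂ → ℝ} {ℓ : ℝ}
    (hℓ : 0 ≤ ℓ) (hvb : ∀ x ∈ lsvBase, |v x| ≤ b)
    (hvl : ∀ x ∈ lsvBase, ∀ y ∈ lsvBase, |v x - v y| ≤ ℓ * dist x y) :
    lsvRealMean (weightedComp (lsvWeight α) (lsvBranch α) v) = lsvRealMean v := by
  have hW := contractingWeights_lsv_base hα
  have hb : 0 ≤ b := (abs_nonneg _).trans (hvb _ lsvBase_nonempty.some_mem)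
  have hm := invariantMean_lsv hα zero_le_one
  set M := b + ℓ / 1
  have h1 : LogLip 1 lsvBase fun x => v x + M := LogLip.add_const one_pos hℓ hvb hvl
  have h2 : LogLip 1 lsvBase fun _ : ℂ => M := LogLip.const zero_le_one (by positivity)
  have hK := lsvDistConst_nonneg hα
  have hi := fun {u} (hu : LogLip 1 lsvBase u) => ((hu.weightedComp zero_le_one hW).continuousOn
    (by positivity) dist_lsvBase_le).intervalIntegrable_half
  obtain ⟨b1, hb1⟩ := h1.exists_bound zero_le_one hW.diam
  obtain ⟨b2, hb2⟩ := h2.exists_bound zero_le_one hW.diam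
  have e : ∀ x ∈ lsvBase, weightedComp (lsvWeight α) (lsvBranch α) v x
      = weightedComp (lsvWeight α) (lsvBranch α) (fun x => v x + M) x
        - weightedComp (lsvWeight α) (lsvBranch α) (fun _ => M) x := by
    intro x hx
    unfold weightedComp
    rw [← (hW.summable_mul hb1 hx).tsum_sub (hW.summable_mul hb2 hx)]
    exact tsum_congr fun n => by ring
  have e1 := hm.map_weightedComp _ h1
  have e2 := hm.map_weightedComp _ h2
  have e3 := hm.map_sub_const _ h1 M
  rw [hm.map_const] at e2
  simp only [add_sub_cancel_right] at e3
  rw [e3, ← e1]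
  refine Eq.trans ?_ (congrArg (_ - ·) e2)
  unfold lsvRealMean
  rw [← mul_sub, ← intervalIntegral.integral_sub (hi h1) (hi h2)]
  congr 1
  refine intervalIntegral.integral_congr fun x hx => ?_
  rw [uIcc_of_le (by norm_num)] at hx
  exact e _ ⟨x, hx, rfl⟩

theorem lsvTransfer_const_mul (c : ℂ) (u : ℂ → ℂ) :
    lsvTransfer β (fun z => c * u z) = fun z => c * lsvTransfer β u z :=
  iterate_weightedComp_const_mul _ u c 1

theorem re_iterate_lsvTransfer (hα : α ∈ Ioo (0 : ℝ) 1) (hu : HolBound b u) (k : ℕ)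
    (hx : x ∈ lsvBase) : ((lsvTransfer α)^[k] u x).re
      = (weightedComp (lsvWeight α) (lsvBranch α))^[k] (fun x => (u x).re) x :=
  re_iterate_weightedComp (contractingWeights_lsv_base hα)
    (fun n _ hx => lsvInvDeriv_div_two_of_mem_base hα hx n)
    (fun x hx => hu.le x (lsvBase_subset hx)) (by have := lsvDistConst_nonneg hα; positivity) k x hx

/-- Real parts reduce to the positive operator, and the imaginary part of u is the real part of -i
u. -/
theorem lsvMean_lsvTransfer (hα : α ∈ Ioo (0 : ℝ) 1) (hu : HolBound b u) :
    lsvMean (lsvTransfer α u) = lsvMean u := by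
  obtain ⟨r, hr, hgood⟩ := exists_ball_goodExponent hα
  have key : ∀ {u : ℂ → ℂ}, HolBound b u → (lsvMean (lsvTransfer α u)).re = (lsvMean u).re := by
    intro u hu
    have h8 : 0 ≤ 8 * b := by linarith [hu.nonneg]
    rw [(hu.lsvTransfer isOpen_ball hgood (mem_ball_self hr)).re_lsvMean, hu.re_lsvMean,
      ← lsvRealMean_weightedComp_of_lipschitz hα h8 hu.re_lipschitz.1 hu.re_lipschitz.2]
    unfold lsvRealMean
    congr 1
    refine intervalIntegral.integral_congr fun x hx => ?_
    rw [uIcc_of_le (by norm_num)] at hx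
    exact re_iterate_lsvTransfer hα hu 1 ⟨x, hx, rfl⟩
  refine Complex.ext (key hu) ?_
  have h1 := key (hu.const_mul (c := -Complex.I) (by simp))
  rw [lsvTransfer_const_mul, lsvMean_const_mul, lsvMean_const_mul] at h1
  simpa using h1

end Remainder


/-! ### Spectral gap at real exponents and its persistence at complex ones -/

section SpectralGap

variable {α : ℝ} {β z x : ℂ} {θ κ a b : ℝ} {B : Set ℂ} {u v : ℂ → ℂ}

theorem HolBound.iterate_lsvTransfer (hu : HolBound b u) (hB : IsOpen B)
    (hgood : ∀ α ∈ B, GoodExponent θ κ a α) (hβ : β ∈ B) (k : ℕ) :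
    HolBound (lsvNormConst θ κ a ^ k * b) ((_root_.lsvTransfer β)^[k] u) := by
  induction k with
  | zero => simpa using hu
  | succ k ih =>
    rw [Function.iterate_succ_apply', pow_succ', mul_assoc]
    exact ih.lsvTransfer hB hgood hβ

theorem lsvMean_iterate_lsvTransfer (hα : α ∈ Ioo (0 : ℝ) 1) (hu : HolBound b u) (k : ℕ) :
    lsvMean ((lsvTransfer α)^[k] u) = lsvMean u := by
  obtain ⟨r, hr, hgood⟩ := exists_ball_goodExponent hα
  induction k with
  | zero => rfl
  | succ k ih =>
    rw [Function.iterate_succ_apply', lsvMean_lsvTransfer hα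
      (hu.iterate_lsvTransfer isOpen_ball hgood (mem_ball_self hr) k), ih]

/-- At real exponents the transfer operator preserves means, so every mean that is subtracted along
the way is zero. -/
theorem iterate_lsvRemainder_eq (hα : α ∈ Ioo (0 : ℝ) 1) (hu : HolBound b u)
    (hmu : lsvMean u = 0) (k : ℕ) :
    ∀ z ∈ lsvNhd, (lsvRemainder α)^[k] u z = (lsvTransfer α)^[k] u z := by
  induction k with
  | zero => exact fun _ _ => rfl
  | succ k ih =>
    intro z hz
    rw [Function.iterate_succ_apply', Function.iterate_succ_apply',
      lsvRemainder_congr (goodExponent_self hα) ih hz, lsvRemainder,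
      lsvMean_iterate_lsvTransfer hα hu, hmu, sub_zero]

/-- A cone parameter for which the cone of log-Lipschitz functions is contracted. -/
noncomputable def lsvCone (α : ℝ) : ℝ := 2 * (lsvDistConst (lsvAngle α) (α / 2) * 4) + 1

theorem lsvCone_pos (hα : α ∈ Ioo (0 : ℝ) 1) : 0 < lsvCone α := by
  have := lsvDistConst_nonneg hα
  unfold lsvCone
  positivity

theorem lsvCone_lt (α : ℝ) : lsvCone α / 2 + lsvDistConst (lsvAngle α) (α / 2) * 4 < lsvCone α := by
  unfold lsvCone
  linarith

/-- Bound for all iterates of the transfer operator at a real exponent. -/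
noncomputable def lsvIterConst (α : ℝ) : ℝ := Real.exp (lsvCone α * 3) * Real.exp (lsvCone α * 3)

theorem lsvIterConst_pos (α : ℝ) : 0 < lsvIterConst α := by
  unfold lsvIterConst
  positivity

theorem norm_iterate_lsvTransfer_le_of_base (hα : α ∈ Ioo (0 : ℝ) 1) {c ℓ : ℝ} (hℓ : 0 ≤ ℓ)
    (hc : 0 ≤ c) (hu : ∀ z ∈ lsvNhd, ∀ x ∈ lsvBase, ‖u z‖ ≤ c + ℓ * dist z x) (k : ℕ)
    (hz : z ∈ lsvNhd) :
    ‖(lsvTransfer α)^[k] u z‖ ≤ (c + ℓ * (3 / 2 ^ k)) * lsvIterConst α := by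
  have hW := contractingWeights_lsv hα
  have hK : 0 ≤ lsvDistConst (lsvAngle α) (α / 2) * 4 := by
    have := lsvDistConst_nonneg hα; positivity
  obtain ⟨x, hx⟩ := lsvBase_nonempty
  have h1 := norm_iterate_weightedComp_le (c := fun n z => lsvInvDeriv α n z / 2) hW
    (fun n z _ => by rw [norm_div, RCLike.norm_ofNat]; rfl) (mapsTo_lsvBranch_base hα)
    lsvBase_subset hK hℓ hu k z hz x hx
  have h2 := (invariantMean_lsv hα (lsvCone_pos hα).le).iterate_one_le hW
    (mapsTo_lsvBranch_base hα) lsvBase_subset lsvBase_nonempty (lsvCone_pos hα) (lsvCone_lt α) k hz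
  have h3 := hW.diam z hz x (lsvBase_subset hx)
  refine h1.trans (mul_le_mul ?_ h2 ?_ (by positivity))
  · gcongr
  · exact ((LogLip.const (lsvCone_pos hα).le zero_le_one).iterate (lsvCone_pos hα).le
      (lsvCone_lt α).le hW k).nonneg z hz

theorem HolBound.iterate_lsvTransfer_real (hα : α ∈ Ioo (0 : ℝ) 1) (hu : HolBound b u) (k : ℕ) :
    HolBound (b * lsvIterConst α) ((_root_.lsvTransfer α)^[k] u) := by
  obtain ⟨r, hr, hgood⟩ := exists_ball_goodExponent hα
  refine ⟨(hu.iterate_lsvTransfer isOpen_ball hgood (mem_ball_self hr) k).differentiableOn,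
    fun z hz => ?_⟩
  have := norm_iterate_lsvTransfer_le_of_base hα le_rfl hu.nonneg (u := u)
    (fun z hz x _ => by simpa using hu.le z hz) k hz
  simpa using this

theorem HolBound.norm_iterate_le_of_mean_eq_zero (hα : α ∈ Ioo (0 : ℝ) 1) (hu : HolBound b u)
    (hmu : lsvMean u = 0) (k : ℕ) (hx : x ∈ lsvBase) :
    ‖(_root_.lsvTransfer α)^[k] u x‖ ≤ 2 * (Real.exp (lsvCone α * 3) *
      (coneRate (lsvDistConst (lsvAngle α) (α / 2) * 4) (lsvCone α) 3 ^ k *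
        (b + 8 * b / lsvCone α))) := by
  have hK : 0 ≤ lsvDistConst (lsvAngle α) (α / 2) * 4 := by
    have := lsvDistConst_nonneg hα; positivity
  have key : ∀ {u : ℂ → ℂ}, HolBound b u → lsvMean u = 0 →
      |((_root_.lsvTransfer α)^[k] u x).re| ≤ Real.exp (lsvCone α * 3) *
        (coneRate (lsvDistConst (lsvAngle α) (α / 2) * 4) (lsvCone α) 3 ^ k *
          (b + 8 * b / lsvCone α)) := by
    intro u hu hmu
    rw [re_iterate_lsvTransfer hα hu k hx]
    have hb := hu.nonneg
    refine (invariantMean_lsv hα (lsvCone_pos hα).le).abs_iterate_le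
      (contractingWeights_lsv_base hα) hK (lsvCone_pos hα) (lsvCone_lt α) (by positivity)
      hu.re_lipschitz.1 hb hu.re_lipschitz.2 ?_ k hx
    rw [← hu.re_lsvMean, hmu, Complex.zero_re]
  have h1 := key hu hmu
  have h2 := key (hu.const_mul (c := -Complex.I) (by simp))
    (by rw [lsvMean_const_mul, hmu, mul_zero])
  have h3 : (_root_.lsvTransfer α)^[k] (fun z => -Complex.I * u z) x
      = -Complex.I * (_root_.lsvTransfer α)^[k] u x :=
    congrFun (iterate_weightedComp_const_mul _ u (-Complex.I) k) x
  rw [h3] at h2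
  have h4 : (-Complex.I * (_root_.lsvTransfer α)^[k] u x).re
      = ((_root_.lsvTransfer α)^[k] u x).im := by simp
  rw [h4] at h2
  linarith [Complex.norm_le_abs_re_add_abs_im ((_root_.lsvTransfer α)^[k] u x)]

/-- At real exponents some power of `lsvRemainder` is a contraction. -/
theorem exists_iterate_lsvRemainder_le_half (hα : α ∈ Ioo (0 : ℝ) 1) :
    ∃ N : ℕ, ∀ b v, HolBound b v → ∀ z ∈ lsvNhd, ‖(lsvRemainder α)^[N] v z‖ ≤ b / 2 := by
  obtain ⟨r, hr, hgood⟩ := exists_ball_goodExponent hα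
  have hK : 0 ≤ lsvDistConst (lsvAngle α) (α / 2) * 4 := by
    have := lsvDistConst_nonneg hα; positivity
  set ρ := coneRate (lsvDistConst (lsvAngle α) (α / 2) * 4) (lsvCone α) 3 with hρ
  have hρ01 : ρ ∈ Ico (0 : ℝ) 1 := coneRate_mem hK (lsvCone_pos hα) (lsvCone_lt α) (by norm_num)
  set C := lsvNormConst (lsvAngle α) ((1 + α⁻¹) / 2) (α / 2) + 1 with hC
  have hC0 : 0 < C := by have := (goodExponent_self hα).normConst_pos; positivity
  set M := lsvIterConst α with hM
  have hM0 : 0 < M := lsvIterConst_pos α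
  set E := 2 * (Real.exp (lsvCone α * 3) * (1 + 8 / lsvCone α)) with hE
  have hlim : Tendsto (fun k : ℕ => C * M * (E * ρ ^ k + 24 * M * (1 / 2) ^ k)) atTop (𝓝 0) := by
    have h1 := tendsto_pow_atTop_nhds_zero_of_lt_one hρ01.1 hρ01.2
    have h2 := tendsto_pow_atTop_nhds_zero_of_lt_one (r := (1 / 2 : ℝ)) (by norm_num) (by norm_num)
    simpa using ((h1.const_mul E).add (h2.const_mul (24 * M))).const_mul (C * M)
  obtain ⟨k, hk⟩ := (hlim.eventually_lt_const (show (0 : ℝ) < 1 / 2 by norm_num)).exists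
  -- One application of `lsvRemainder` produces mean zero, the next k make the function small on
  -- [1/2, 1], and the last k carry the smallness over to `lsvNhd`.
  refine ⟨k + k + 1, fun b v hv z hz => ?_⟩
  have hu := hv.lsvRemainder isOpen_ball hgood (mem_ball_self hr)
  rw [← hC] at hu
  have hmu : lsvMean (lsvRemainder α v) = 0 := by
    have h1 := lsvMean_sub (hv.lsvTransfer isOpen_ball hgood (mem_ball_self hr))
      (HolBound.const (lsvMean v))
    rw [lsvMean_const, lsvMean_lsvTransfer hα hv, sub_self] at h1
    exact h1
  set u := lsvRemainder α v
  rw [Function.iterate_succ_apply, iterate_lsvRemainder_eq hα hu hmu _ z hz,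
    Function.iterate_add_apply]
  have hb := hu.nonneg
  have hw := hu.iterate_lsvTransfer_real hα k
  have hcone := lsvCone_pos hα
  have hρk : 0 ≤ ρ ^ k := pow_nonneg hρ01.1 k
  refine (norm_iterate_lsvTransfer_le_of_base hα (c := E * ρ ^ k * (C * b))
    (ℓ := 8 * (C * b * M)) (by positivity) (by positivity) (fun z hz x hx => ?_) k hz).trans ?_
  · have h1 := hw.norm_sub_le hz hx
    have h2 := hu.norm_iterate_le_of_mean_eq_zero hα hmu k hx
    have h3 : 2 * (Real.exp (lsvCone α * 3) * (ρ ^ k * (C * b + 8 * (C * b) / lsvCone α)))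
        = E * ρ ^ k * (C * b) := by rw [hE]; ring
    rw [← hρ, h3] at h2
    linarith [norm_sub_norm_le ((lsvTransfer α)^[k] u z) ((lsvTransfer α)^[k] u x)]
  · have h1 : (E * ρ ^ k * (C * b) + 8 * (C * b * M) * (3 / 2 ^ k)) * M
        = C * M * (E * ρ ^ k + 24 * M * (1 / 2) ^ k) * b := by
      rw [one_div, inv_pow]; ring
    rw [h1]
    nlinarith [hv.nonneg]

theorem prod_lsvNhd_subset (hgood : ∀ α ∈ B, GoodExponent θ κ a α) :
    B ×ˢ lsvNhd ⊆ {p : ℂ × ℂ | p.1 ∈ B ∧ p.2 ∈ lsvDomain θ p.1} :=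
  fun _ hp => ⟨hp.1, (hgood _ hp.1).nhd_subset hp.2⟩

theorem differentiableOn_iterate_lsvRemainder (hB : IsOpen B)
    (hgood : ∀ α ∈ B, GoodExponent θ κ a α) (hv : HolBound b v) (k : ℕ) :
    DifferentiableOn ℂ (fun p : ℂ × ℂ => (lsvRemainder p.1)^[k] v p.2) (B ×ˢ lsvNhd) := by
  induction k with
  | zero => exact hv.differentiableOn.comp differentiableOn_snd fun p hp => hp.2
  | succ k ih =>
    have hbd : ∀ p ∈ B ×ˢ lsvNhd, ‖(lsvRemainder p.1)^[k] v p.2‖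
        ≤ (lsvNormConst θ κ a + 1) ^ k * b := fun p hp =>
      (hv.iterate_lsvRemainder hB hgood hp.1 k).le _ hp.2
    have h1 := (differentiableOn_lsvTransfer hB hgood ih hbd).mono (prod_lsvNhd_subset hgood)
    have h2 := differentiableOn_intervalIntegral_of_bounded (a := 1 / 2) (b := 1) hB isOpen_lsvNhd
      (by norm_num) (fun x hx => ofReal_mem_lsvNhd hx) ih hbd
    simp only [Function.iterate_succ_apply']
    exact h1.sub ((h2.const_mul 2).comp differentiableOn_fst fun p hp => hp.1)

/-- The contraction persists for complex exponents near a real one. -/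
theorem exists_ball_iterate_lsvRemainder_le (hα : α ∈ Ioo (0 : ℝ) 1) :
    ∃ N : ℕ, ∃ r > 0, (∀ β ∈ ball (α : ℂ) r,
        GoodExponent (lsvAngle α) ((1 + α⁻¹) / 2) (α / 2) β) ∧
      ∀ β ∈ ball (α : ℂ) r, ∀ b v, HolBound b v →
        HolBound (3 / 4 * b) ((lsvRemainder β)^[N] v) := by
  obtain ⟨R, hR, hgood⟩ := exists_ball_goodExponent hα
  obtain ⟨N, hN⟩ := exists_iterate_lsvRemainder_le_half hα
  set C := (lsvNormConst (lsvAngle α) ((1 + α⁻¹) / 2) (α / 2) + 1) ^ N with hC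
  have hC0 : 0 < C := by have := (goodExponent_self hα).normConst_pos; positivity
  -- By the Schwarz lemma in β the change is at most (2Cb/R) · R/(8C) = b/4, which turns the factor
  -- 1/2 into 3/4.
  refine ⟨N, min R (R / (8 * C)), by positivity,
    fun β hβ => hgood β (ball_subset_ball (min_le_left _ _) hβ), fun β hβ b v hv => ?_⟩
  have hβR : β ∈ ball (α : ℂ) R := ball_subset_ball (min_le_left _ _) hβ
  refine ⟨(hv.iterate_lsvRemainder isOpen_ball hgood hβR N).differentiableOn, fun z hz => ?_⟩
  have h1 := dist_le_of_norm_le_ball (M := C * b)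
    ((differentiableOn_iterate_lsvRemainder isOpen_ball hgood hv N).comp
      (f := fun β : ℂ => (β, z)) (by fun_prop) fun β hβ => ⟨hβ, hz⟩)
    (fun β hβ => (hv.iterate_lsvRemainder isOpen_ball hgood hβ N).le z hz) hβR
  simp only [Function.comp_apply] at h1
  have h2 := hN b v hv z hz
  have h3 : ‖β - α‖ ≤ R / (8 * C) := by
    rw [← dist_eq_norm]
    exact (mem_ball.1 (ball_subset_ball (min_le_right _ _) hβ)).le
  have hb := hv.nonneg
  have h4 : 2 * (C * b) / R * ‖β - α‖ ≤ 2 * (C * b) / R * (R / (8 * C)) := by gcongr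
  have h5 : 2 * (C * b) / R * (R / (8 * C)) = b / 4 := by field_simp; ring
  linarith [norm_sub_norm_le ((lsvRemainder β)^[N] v z) ((lsvRemainder α)^[N] v z)]

end SpectralGap


/-! ### The fixed function of the transfer operator as a Neumann series -/

section Eigenfunction

variable {α : ℝ} {β z x : ℂ} {θ κ a b c : ℝ} {B : Set ℂ} {u v : ℂ → ℂ} {N : ℕ}

theorem lsvTransfer_sub (h : GoodExponent θ κ a β) (hu : HolBound b u) (hv : HolBound c v)
    (hz : z ∈ lsvDomain θ β) :
    lsvTransfer β (fun z => u z - v z) z = lsvTransfer β u z - lsvTransfer β v z := by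
  refine Eq.trans ?_ ((h.summable_transfer hz hu.le).tsum_sub (h.summable_transfer hz hv.le))
  exact tsum_congr fun n => mul_sub _ _ _

theorem lsvRemainder_sub (h : GoodExponent θ κ a β) (hu : HolBound b u) (hv : HolBound c v)
    (hz : z ∈ lsvNhd) :
    lsvRemainder β (fun z => u z - v z) z = lsvRemainder β u z - lsvRemainder β v z := by
  rw [lsvRemainder, lsvTransfer_sub h hu hv (h.nhd_subset hz), lsvMean_sub hu hv, lsvRemainder,
    lsvRemainder]
  ring

/-- Bounds for the iterates of an operator whose `N`-th power is a `3/4`-contraction. -/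
noncomputable def gapBound (N : ℕ) (C : ℝ) (k : ℕ) : ℝ := (3 / 4) ^ (k / N) * C ^ (k % N)

theorem summable_gapBound {C : ℝ} (hN : N ≠ 0) (hC : 0 ≤ C) : Summable (gapBound N C) := by
  have : NeZero N := ⟨hN⟩
  have h1 : Summable fun p : ℕ × Fin N => (3 / 4 : ℝ) ^ p.1 * C ^ (p.2 : ℕ) :=
    (summable_geometric_of_lt_one (by norm_num) (by norm_num)).mul_of_nonneg
      (.of_finite (f := fun i : Fin N => C ^ (i : ℕ)))
      (fun _ => by positivity) fun _ => by positivity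
  refine ((Nat.divModEquiv N).summable_iff.2 h1).congr fun k => ?_
  simp [gapBound, Nat.divModEquiv]

/-- A family of exponents with a uniform spectral gap. -/
structure UniformGap (B : Set ℂ) (θ κ a : ℝ) (N : ℕ) : Prop where
  isOpen : IsOpen B
  good : ∀ β ∈ B, GoodExponent θ κ a β
  gap : ∀ β ∈ B, ∀ b v, HolBound b v → HolBound (3 / 4 * b) ((lsvRemainder β)^[N] v)

/-- The sum of the bounds on the iterates. -/
noncomputable def gapSum (θ κ a : ℝ) (N : ℕ) : ℝ := ∑' k, gapBound N (lsvNormConst θ κ a + 1) k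

theorem UniformGap.iterate (h : UniformGap B θ κ a N) (hβ : β ∈ B) (hv : HolBound b v) (k : ℕ) :
    HolBound (gapBound N (lsvNormConst θ κ a + 1) k * b) ((lsvRemainder β)^[k] v) := by
  have h1 : ∀ j, ∀ {b v}, HolBound b v →
      HolBound ((3 / 4) ^ j * b) (((lsvRemainder β)^[N])^[j] v) := by
    intro j
    induction j with
    | zero => intro b v hv; simpa using hv
    | succ j ih =>
      intro b v hv
      rw [Function.iterate_succ_apply', pow_succ', mul_assoc]
      exact h.gap β hβ _ _ (ih hv)
  have h2 := h1 (k / N) (hv.iterate_lsvRemainder h.isOpen h.good hβ (k % N))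
  rw [← Function.iterate_mul, ← Function.iterate_add_apply, Nat.div_add_mod, ← mul_assoc] at h2
  exact h2

theorem UniformGap.summable (h : UniformGap B θ κ a N) (hβ : β ∈ B) :
    Summable (gapBound N (lsvNormConst θ κ a + 1)) := by
  refine summable_gapBound ?_ (by linarith [(h.good β hβ).normConst_pos])
  -- For N = 0 the gap would bound the constant 1 by 3/4.
  rintro rfl
  have h1 := (h.gap β hβ 1 _ (by simpa using HolBound.const 1)).le _
    (lsvBase_subset lsvBase_nonempty.some_mem)
  norm_num at h1

/-- The solution of `u = 1 + lsvRemainder α u`. At real exponents it is the invariant density of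
the first return map to `[1/2, 1]`. -/
noncomputable def lsvEigen (β z : ℂ) : ℂ := ∑' k, (lsvRemainder β)^[k] (fun _ => 1) z

theorem UniformGap.norm_iterate_one_le (h : UniformGap B θ κ a N) (hβ : β ∈ B) (hz : z ∈ lsvNhd)
    (k : ℕ) : ‖(lsvRemainder β)^[k] (fun _ => 1) z‖ ≤ gapBound N (lsvNormConst θ κ a + 1) k := by
  have := (h.iterate hβ (HolBound.const 1) k).le z hz
  rwa [norm_one, mul_one] at this

theorem UniformGap.differentiableOn_eigen (h : UniformGap B θ κ a N) :
    DifferentiableOn ℂ (fun p : ℂ × ℂ => lsvEigen p.1 p.2) (B ×ˢ lsvNhd) := by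
  rcases B.eq_empty_or_nonempty with rfl | ⟨β, hβ⟩
  · rw [empty_prod]; exact differentiableOn_empty
  exact differentiableOn_tsum_of_norm_le (h.summable hβ) (h.isOpen.prod isOpen_lsvNhd)
    (fun k => differentiableOn_iterate_lsvRemainder h.isOpen h.good (HolBound.const 1) k)
    fun k p hp => h.norm_iterate_one_le hp.1 hp.2 k

theorem UniformGap.holBound_eigen (h : UniformGap B θ κ a N) (hβ : β ∈ B) :
    HolBound (gapSum θ κ a N) (lsvEigen β) :=
  ⟨h.differentiableOn_eigen.comp (f := fun z => (β, z)) (by fun_prop) fun _ hz => ⟨hβ, hz⟩,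
    fun _ hz => tsum_of_norm_bounded (h.summable hβ).hasSum (h.norm_iterate_one_le hβ hz)⟩

/-- The operator sends the n-th partial sum to the (n+1)-st minus 1; it is bounded on bounded
holomorphic functions, so the limit may be taken on both sides. -/
theorem UniformGap.eigen_eq (h : UniformGap B θ κ a N) (hβ : β ∈ B) (hz : z ∈ lsvNhd) :
    lsvRemainder β (lsvEigen β) z = lsvEigen β z - 1 := by
  set g := gapBound N (lsvNormConst θ κ a + 1) with hg
  have hgs : Summable g := h.summable hβ
  have hgood := h.good β hβ
  set T : ℕ → ℂ → ℂ := fun n z => ∑ k ∈ Finset.range n, (lsvRemainder β)^[k] (fun _ => 1) z with hT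
  have hit : ∀ k, HolBound (g k) ((lsvRemainder β)^[k] fun _ => 1) := fun k => by
    have := h.iterate hβ (HolBound.const 1) k
    rwa [norm_one, mul_one] at this
  have hTb : ∀ n, HolBound (∑ k ∈ Finset.range n, g k) (T n) := fun n =>
    ⟨DifferentiableOn.fun_sum fun k _ => (hit k).differentiableOn, fun z hz =>
      norm_sum_le_of_le _ fun k _ => (hit k).le z hz⟩
  have hKT : ∀ n, ∀ z ∈ lsvNhd, lsvRemainder β (T n) z = T (n + 1) z - 1 := by
    intro n
    induction n with
    | zero =>
      intro z hz
      have : T 0 = fun z => 0 * (1 : ℂ) := by funext; simp [hT]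
      rw [this, lsvRemainder, lsvTransfer_const_mul, lsvMean_const]
      simp [hT]
    | succ n ih =>
      intro z hz
      have h1 := lsvRemainder_sub hgood (hTb (n + 1)) (hTb n) hz
      have h2 : (fun z => T (n + 1) z - T n z) = (lsvRemainder β)^[n] fun _ => 1 := by
        funext z; simp only [hT, Finset.sum_range_succ]; ring
      rw [h2, ← Function.iterate_succ_apply' (lsvRemainder β), ih z hz] at h1
      have h3 : T (n + 1 + 1) z = T (n + 1) z + (lsvRemainder β)^[n + 1] (fun _ => 1) z :=
        Finset.sum_range_succ _ _
      rw [h3, h1]; ring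
  have hdiff : ∀ n, HolBound (∑' k, g (k + n)) fun z => lsvEigen β z - T n z := fun n =>
    ⟨(h.holBound_eigen hβ).differentiableOn.sub (hTb n).differentiableOn, fun z hz => by
      have hs : Summable fun k => (lsvRemainder β)^[k] (fun _ => 1) z :=
        .of_norm_bounded hgs fun k => (hit k).le z hz
      have h1 : lsvEigen β z - T n z = ∑' k, (lsvRemainder β)^[k + n] (fun _ => 1) z := by
        rw [lsvEigen, ← hs.sum_add_tsum_nat_add n]; ring
      rw [h1]
      exact tsum_of_norm_bounded ((summable_nat_add_iff n).2 hgs).hasSum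
        fun k => (hit (k + n)).le z hz⟩
  have htail := tendsto_sum_nat_add g
  have hlim1 : Tendsto (fun n => T n z) atTop (𝓝 (lsvEigen β z)) := by
    rw [tendsto_iff_norm_sub_tendsto_zero]
    refine squeeze_zero (fun _ => norm_nonneg _) (fun n => ?_) htail
    rw [norm_sub_rev]
    exact (hdiff n).le z hz
  have hlim2 : Tendsto (fun n => lsvRemainder β (T n) z) atTop
      (𝓝 (lsvRemainder β (lsvEigen β) z)) := by
    rw [tendsto_iff_norm_sub_tendsto_zero]
    refine squeeze_zero (fun _ => norm_nonneg _) (fun n => ?_)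
      (by simpa using htail.const_mul (lsvNormConst θ κ a + 1))
    rw [norm_sub_rev, ← lsvRemainder_sub hgood (h.holBound_eigen hβ) (hTb n) hz]
    exact ((hdiff n).lsvRemainder h.isOpen h.good hβ).le z hz
  refine tendsto_nhds_unique hlim2 ?_
  simp only [hKT _ z hz]
  exact (hlim1.comp (tendsto_add_atTop_nat 1)).sub_const 1

theorem exists_uniformGap (hα : α ∈ Ioo (0 : ℝ) 1) : ∃ r > 0, ∃ N,
    UniformGap (ball (α : ℂ) r) (lsvAngle α) ((1 + α⁻¹) / 2) (α / 2) N := by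
  obtain ⟨N, r, hr, h1, h2⟩ := exists_ball_iterate_lsvRemainder_le hα
  exact ⟨r, hr, N, isOpen_ball, h1, h2⟩

theorem exists_holBound_lsvEigen (hα : α ∈ Ioo (0 : ℝ) 1) : ∃ b, HolBound b (lsvEigen α) := by
  obtain ⟨r, hr, N, h⟩ := exists_uniformGap hα
  exact ⟨_, h.holBound_eigen (mem_ball_self hr)⟩

/-- Take means in K h = h - 1. The left side has mean zero because L preserves the mean at real
exponents. -/
theorem lsvMean_lsvEigen (hα : α ∈ Ioo (0 : ℝ) 1) : lsvMean (lsvEigen α) = 1 := by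
  obtain ⟨r, hr, N, h⟩ := exists_uniformGap hα
  have hβ := mem_ball_self (x := (α : ℂ)) hr
  have hb := h.holBound_eigen hβ
  have h1 := lsvMean_congr fun z hz => h.eigen_eq hβ (lsvBase_subset hz)
  have h2 := lsvMean_sub hb (HolBound.const 1)
  have h3 := lsvMean_sub (hb.lsvTransfer h.isOpen h.good hβ) (HolBound.const (lsvMean (lsvEigen α)))
  rw [lsvMean_const] at h2 h3
  rw [lsvMean_lsvTransfer hα hb, sub_self] at h3
  change lsvMean (lsvRemainder α (lsvEigen α)) = 0 at h3
  change lsvMean (lsvRemainder α (lsvEigen α)) = _ at h1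
  rw [h3, h2] at h1
  exact (sub_eq_zero.1 h1.symm)

theorem lsvTransfer_lsvEigen (hα : α ∈ Ioo (0 : ℝ) 1) (hz : z ∈ lsvNhd) :
    lsvTransfer α (lsvEigen α) z = lsvEigen α z := by
  obtain ⟨r, hr, N, h⟩ := exists_uniformGap hα
  have h1 := h.eigen_eq (mem_ball_self hr) hz
  rw [lsvRemainder, lsvMean_lsvEigen hα] at h1
  exact sub_left_inj.1 h1

theorem iterate_lsvTransfer_sub (h : UniformGap B θ κ a N) (hβ : β ∈ B)
    (hu : HolBound b u) (hv : HolBound c v) (k : ℕ) : ∀ z ∈ lsvNhd,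
    (lsvTransfer β)^[k] (fun z => u z - v z) z
      = (lsvTransfer β)^[k] u z - (lsvTransfer β)^[k] v z := by
  have hgood := h.good β hβ
  induction k with
  | zero => exact fun _ _ => rfl
  | succ k ih =>
    intro z hz
    simp only [Function.iterate_succ_apply']
    rw [lsvTransfer_congr hgood ih (hgood.nhd_subset hz), lsvTransfer_sub hgood
      (hu.iterate_lsvTransfer h.isOpen h.good hβ k) (hv.iterate_lsvTransfer h.isOpen h.good hβ k)
      (hgood.nhd_subset hz)]

theorem iterate_lsvTransfer_lsvEigen (hα : α ∈ Ioo (0 : ℝ) 1) (k : ℕ) : ∀ z ∈ lsvNhd,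
    (lsvTransfer α)^[k] (lsvEigen α) z = lsvEigen α z := by
  induction k with
  | zero => exact fun _ _ => rfl
  | succ k ih =>
    intro z hz
    have h := goodExponent_self hα
    rw [Function.iterate_succ_apply', lsvTransfer_congr h ih (h.nhd_subset hz),
      lsvTransfer_lsvEigen hα hz]

/-- On the mean zero function v - m(v) h the powers of L are those of K, which tend to 0, while h is
fixed by L. -/
theorem tendsto_iterate_lsvTransfer (hα : α ∈ Ioo (0 : ℝ) 1) (hv : HolBound b v)
    (hz : z ∈ lsvNhd) :
    Tendsto (fun k => (lsvTransfer α)^[k] v z) atTop (𝓝 (lsvMean v * lsvEigen α z)) := by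
  obtain ⟨r, hr, N, h⟩ := exists_uniformGap hα
  have hβ := mem_ball_self (x := (α : ℂ)) hr
  have hh : HolBound (‖lsvMean v‖ * gapSum (lsvAngle α) ((1 + α⁻¹) / 2) (α / 2) N)
      fun z => lsvMean v * lsvEigen α z :=
    ⟨(h.holBound_eigen hβ).differentiableOn.const_mul _, fun z hz => by
      rw [norm_mul]
      exact mul_le_mul_of_nonneg_left ((h.holBound_eigen hβ).le z hz) (norm_nonneg _)⟩
  have hd := hv.sub hh
  have hmean : lsvMean (fun z => v z - lsvMean v * lsvEigen α z) = 0 := by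
    rw [lsvMean_sub hv hh, lsvMean_const_mul, lsvMean_lsvEigen hα, mul_one, sub_self]
  rw [tendsto_iff_norm_sub_tendsto_zero]
  have hlim := (h.summable hβ).tendsto_atTop_zero.mul_const
    (b + ‖lsvMean v‖ * gapSum (lsvAngle α) ((1 + α⁻¹) / 2) (α / 2) N)
  rw [zero_mul] at hlim
  refine squeeze_zero (fun _ => norm_nonneg _) (fun k => ?_) hlim
  have h1 := (h.iterate hβ hd k).le z hz
  rw [iterate_lsvRemainder_eq hα hd hmean k z hz, iterate_lsvTransfer_sub h hβ hv hh k z hz] at h1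
  have h2 : (lsvTransfer α)^[k] (fun z => lsvMean v * lsvEigen α z) z
      = lsvMean v * lsvEigen α z := by
    rw [← iterate_lsvTransfer_lsvEigen hα k z hz]
    exact congrFun (iterate_weightedComp_const_mul _ _ _ k) z
  rwa [h2] at h1

theorem lsvRealMean_iterate_weightedComp (hα : α ∈ Ioo (0 : ℝ) 1) {v : ℂ → ℝ}
    (hv : LogLip (lsvCone α) lsvBase v) (k : ℕ) :
    lsvRealMean ((weightedComp (lsvWeight α) (lsvBranch α))^[k] v) = lsvRealMean v := by
  have hc := (lsvCone_pos hα).le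
  induction k with
  | zero => rfl
  | succ k ih =>
    rw [Function.iterate_succ_apply', lsvRealMean_weightedComp hα hc
      (hv.iterate hc (lsvCone_lt α).le (contractingWeights_lsv_base hα) k), ih]

/-- h is the limit of Lᵏ 1. These functions are real on [1/2, 1], lie in the cone and have mean 1,
which bounds them from below. -/
theorem lsvEigen_base (hα : α ∈ Ioo (0 : ℝ) 1) (hx : x ∈ lsvBase) :
    Real.exp (-(lsvCone α * 3)) ≤ (lsvEigen α x).re ∧ (lsvEigen α x).im = 0 := by
  have hlim := tendsto_iterate_lsvTransfer hα (HolBound.const 1) (lsvBase_subset hx)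
  rw [lsvMean_const, one_mul] at hlim
  have hc := lsvCone_pos hα
  constructor
  · refine ge_of_tendsto' (Complex.continuous_re.continuousAt.tendsto.comp hlim) fun k => ?_
    have hone : LogLip (lsvCone α) lsvBase fun _ => (1 : ℝ) := LogLip.const hc.le zero_le_one
    have h1 := (invariantMean_lsv hα hc.le).lower _ (hone.iterate hc.le (lsvCone_lt α).le
      (contractingWeights_lsv_base hα) k) x hx
    rw [lsvRealMean_iterate_weightedComp hα hone, lsvRealMean_const, mul_one] at h1
    rw [Function.comp_apply, re_iterate_lsvTransfer hα (HolBound.const 1) k hx]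
    exact h1
  · refine tendsto_nhds_unique (Complex.continuous_im.continuousAt.tendsto.comp hlim)
      (tendsto_const_nhds.congr fun k => ?_)
    have h1 := re_iterate_lsvTransfer hα ((HolBound.const 1).const_mul (c := -Complex.I) (by simp))
      k hx
    have h2 : (lsvTransfer α)^[k] (fun _ => -Complex.I * 1) x
        = -Complex.I * (lsvTransfer α)^[k] (fun _ => 1) x :=
      congrFun (iterate_weightedComp_const_mul _ _ _ k) x
    have h3 : ∀ k, (weightedComp (lsvWeight α) (lsvBranch α))^[k]
        (fun _ => (-Complex.I * 1).re) = fun _ => 0 := by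
      intro k
      induction k with
      | zero => simp
      | succ k ih => rw [Function.iterate_succ_apply', ih]; funext; simp [weightedComp]
    rw [h2, h3] at h1
    simpa using h1.symm

end Eigenfunction


/-! ### The unnormalised density on (0, 1] and its bounds -/

section Density

variable {α x : ℝ} {β : ℂ} {θ κ a b : ℝ} {B : Set ℂ} {N : ℕ}

/-- Holomorphic extension of the unnormalised invariant density. -/
noncomputable def lsvDensityExt (β z : ℂ) : ℂ := lsvTransfer β (lsvEigen β) z

/-- An unnormalised invariant density of the LSV map. -/
noncomputable def lsvDensity (α x : ℝ) : ℝ := (lsvDensityExt α x).re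

/-- The partial derivative of `lsvDensity` with respect to the parameter. -/
noncomputable def lsvDensityDeriv (α x : ℝ) : ℝ :=
  (fderiv ℂ (fun p : ℂ × ℂ => lsvDensityExt p.1 p.2) (α, x) (1, 0)).re

theorem UniformGap.differentiableOn_densityExt (h : UniformGap B θ κ a N) :
    DifferentiableOn ℂ (fun p : ℂ × ℂ => lsvDensityExt p.1 p.2)
      {p : ℂ × ℂ | p.1 ∈ B ∧ p.2 ∈ lsvDomain θ p.1} :=
  differentiableOn_lsvTransfer h.isOpen h.good h.differentiableOn_eigen
    fun _ hp => (h.holBound_eigen hp.1).le _ hp.2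

theorem UniformGap.norm_densityExt_le (h : UniformGap B θ κ a N) (hβ : β ∈ B) {z : ℂ}
    (hz : z ∈ lsvDomain θ β) : ‖lsvDensityExt β z‖
      ≤ lsvSumConst θ κ a * Real.exp (lsvCoord β z).re * gapSum θ κ a N :=
  (h.good β hβ).norm_transfer_le hz (h.holBound_eigen hβ).le

theorem abs_log_two_mul_le (hx : x ∈ Ioc (0 : ℝ) 1) : |Real.log (2 * x)| ≤ 1 - Real.log x := by
  have h1 := Real.log_nonpos hx.1.le hx.2
  have h2 := Real.log_two_lt_d9
  have h3 := Real.log_pos one_lt_two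
  rw [Real.log_mul two_ne_zero hx.1.ne', abs_le]
  constructor <;> linarith

/-- Exponents at distance `O(1 / (1 - log x))` from a real exponent are admissible at `x`. -/
theorem GoodExponent.mem_domain_of_near (h : GoodExponent θ κ a β) (hα : α ∈ Ioo (0 : ℝ) 1)
    (hx : x ∈ Ioc (0 : ℝ) 1) (hβ : ‖β - α‖ * (1 - Real.log x) ≤ 1)
    (hβ' : ‖β - α‖ * (1 - Real.log x) < θ) :
    (x : ℂ) ∈ lsvDomain θ β ∧ Real.exp (lsvCoord β x).re ≤ Real.exp 1 * x ^ (-α) := by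
  have e : lsvCoord β x = -β * (Real.log (2 * x) : ℝ) := by
    rw [lsvCoord, Complex.ofReal_log (by linarith [hx.1])]; push_cast; rfl
  have him : (lsvCoord β x).im = -(β - α).im * Real.log (2 * x) := by
    rw [e, Complex.im_mul_ofReal]; simp
  have hre : (lsvCoord β x).re = -β.re * Real.log (2 * x) := by
    rw [e, Complex.re_mul_ofReal]; simp
  have hlog := abs_log_two_mul_le hx
  have h2 := Real.log_two_lt_d9
  have hle : Real.log (2 * x) ≤ Real.log 2 :=
    Real.log_le_log (by linarith [hx.1]) (by linarith [hx.2])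
  have hd : |(β - α).re * Real.log (2 * x)| ≤ 1 := by
    rw [abs_mul]
    exact (mul_le_mul (Complex.abs_re_le_norm _) hlog (abs_nonneg _) (norm_nonneg _)).trans hβ
  refine ⟨⟨Complex.ofReal_mem_slitPlane.2 hx.1, ?_, ?_, ?_⟩, ?_⟩
  · rw [Complex.norm_real, Real.norm_eq_abs, abs_of_pos hx.1]; linarith [hx.2]
  · rw [him, abs_mul, abs_neg]
    exact (mul_le_mul (Complex.abs_im_le_norm _) hlog (abs_nonneg _) (norm_nonneg _)).trans_lt hβ'
  · rw [hre]
    nlinarith [h.re_pos, h.re_lt_one, Real.log_pos one_lt_two]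
  · rw [Real.rpow_def_of_pos hx.1, ← Real.exp_add, Real.exp_le_exp, hre]
    have h3 := (abs_le.1 hd).1
    rw [Complex.sub_re, Complex.ofReal_re] at h3
    have h4 : Real.log (2 * x) = Real.log 2 + Real.log x := Real.log_mul two_ne_zero hx.1.ne'
    rw [h4] at h3 ⊢
    nlinarith [hα.1, Real.log_pos one_lt_two]

theorem GoodExponent.ofReal_mem_domain (h : GoodExponent θ κ a (α : ℂ)) (hα : α ∈ Ioo (0 : ℝ) 1)
    (hx : x ∈ Ioc (0 : ℝ) 1) :
    (x : ℂ) ∈ lsvDomain θ α ∧ Real.exp (lsvCoord α x).re ≤ Real.exp 1 * x ^ (-α) :=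
  h.mem_domain_of_near hα hx (by simp) (by simpa using h.theta_pos)

theorem UniformGap.hasDerivAt_density (h : UniformGap B θ κ a N) (hβ : (α : ℂ) ∈ B)
    (hα : α ∈ Ioo (0 : ℝ) 1) (hx : x ∈ Ioc (0 : ℝ) 1) :
    HasDerivAt (fun a => lsvDensity a x) (lsvDensityDeriv α x) α :=
  (hasDerivAt_fst_of_differentiableOn (p := (α, x)) (isOpen_setOf_mem_lsvDomain h.isOpen)
    h.differentiableOn_densityExt
    ⟨hβ, ((h.good _ hβ).ofReal_mem_domain hα hx).1⟩).real_of_complex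

theorem hasDerivAt_lsvDensity (hα : α ∈ Ioo (0 : ℝ) 1) (hx : x ∈ Ioc (0 : ℝ) 1) :
    HasDerivAt (fun a => lsvDensity a x) (lsvDensityDeriv α x) α := by
  obtain ⟨r, hr, N, h⟩ := exists_uniformGap hα
  exact h.hasDerivAt_density (mem_ball_self hr) hα hx

theorem continuousOn_lsvDensity : ContinuousOn (fun p : ℝ × ℝ => lsvDensity p.1 p.2)
    (Ioo (0 : ℝ) 1 ×ˢ Ioc (0 : ℝ) 1) := by
  rintro ⟨α, x⟩ ⟨hα, hx⟩
  obtain ⟨r, hr, N, h⟩ := exists_uniformGap hα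
  have h1 := (h.differentiableOn_densityExt.differentiableAt
    ((isOpen_setOf_mem_lsvDomain h.isOpen).mem_nhds (x := ((α : ℂ), (x : ℂ)))
      ⟨mem_ball_self hr, ((goodExponent_self hα).ofReal_mem_domain hα hx).1⟩)).continuousAt
  refine ContinuousAt.continuousWithinAt ?_
  exact Complex.continuous_re.continuousAt.comp (ContinuousAt.comp (x := (α, x))
    (f := fun p : ℝ × ℝ => ((p.1 : ℂ), (p.2 : ℂ))) h1 (by fun_prop))

theorem continuousOn_lsvDensityDeriv : ContinuousOn (fun p : ℝ × ℝ => lsvDensityDeriv p.1 p.2)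
    (Ioo (0 : ℝ) 1 ×ˢ Ioc (0 : ℝ) 1) := by
  rintro ⟨α, x⟩ ⟨hα, hx⟩
  obtain ⟨r, hr, N, h⟩ := exists_uniformGap hα
  have hΩ := isOpen_setOf_mem_lsvDomain (θ := lsvAngle α) h.isOpen
  have h1 := (continuousOn_fderiv_of_differentiableOn hΩ
    h.differentiableOn_densityExt).continuousAt (hΩ.mem_nhds (x := ((α : ℂ), (x : ℂ)))
      ⟨mem_ball_self hr, ((goodExponent_self hα).ofReal_mem_domain hα hx).1⟩)
  refine ContinuousAt.continuousWithinAt ?_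
  refine Complex.continuous_re.continuousAt.comp (ContinuousAt.clm_apply ?_ continuousAt_const)
  exact ContinuousAt.comp (x := (α, x))
    (f := fun p : ℝ × ℝ => ((p.1 : ℂ), (p.2 : ℂ))) h1 (by fun_prop)

/-- On the complex disc of radius c/(1 - log x) about α the extended density is at most M x^{-α}.
Cauchy's estimate on this disc produces the factor 1 - log x. -/
theorem exists_local_bound_lsvDensity {α₀ : ℝ} (hα₀ : α₀ ∈ Ioo (0 : ℝ) 1) :
    ∃ K : ℝ, ∀ᶠ α in 𝓝 α₀, ∀ x ∈ Ioc (0 : ℝ) 1, lsvDensity α x ≤ K * x ^ (-α) ∧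
      |lsvDensityDeriv α x| ≤ K * x ^ (-α) * (1 - Real.log x) := by
  obtain ⟨R, hR, N, h⟩ := exists_uniformGap hα₀
  set θ := lsvAngle α₀
  set κ := (1 + α₀⁻¹) / 2
  set a := α₀ / 2
  have hself := goodExponent_self hα₀
  have hS := hself.sumConst_pos
  have hG := (h.holBound_eigen (mem_ball_self hR)).nonneg
  have hθ := hself.theta_pos
  set M := lsvSumConst θ κ a * Real.exp 1 * gapSum θ κ a N
  have hM : 0 ≤ M := by positivity
  -- R/2 keeps the disc about α inside the ball about α₀; 1 and θ are the thresholds of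
  -- `GoodExponent.mem_domain_of_near`.
  set c := min (R / 2) (min 1 θ) with hc
  have hc0 : 0 < c := by positivity
  refine ⟨max M (2 * M / c), ?_⟩
  have hnhds : ∀ᶠ α in 𝓝 α₀, α ∈ ball α₀ (R / 2) ∩ Ioo 0 1 :=
    inter_mem (ball_mem_nhds _ (by positivity)) (isOpen_Ioo.mem_nhds hα₀)
  filter_upwards [hnhds] with α hα x hx
  obtain ⟨hαR, hα⟩ := hα
  have hpow : 0 < x ^ (-α) := Real.rpow_pos_of_pos hx.1 _
  have hlog : 1 ≤ 1 - Real.log x := by linarith [Real.log_nonpos hx.1.le hx.2]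
  have hαB : dist (α : ℂ) α₀ < R / 2 := by
    rw [Complex.dist_of_im_eq (by simp)]; exact hαR
  set δ := c / (1 - Real.log x) with hδ
  have hδ0 : 0 < δ := by positivity
  have hδc : δ ≤ c := div_le_self hc0.le hlog
  have hball : ∀ β ∈ ball (α : ℂ) δ, β ∈ ball (α₀ : ℂ) R ∧ (x : ℂ) ∈ lsvDomain θ β ∧
      ‖lsvDensityExt β x‖ ≤ M * x ^ (-α) := by
    intro β hβ
    have hβR : β ∈ ball (α₀ : ℂ) R := by
      rw [mem_ball] at hβ ⊢
      have := dist_triangle β α α₀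
      have := min_le_left (R / 2) (min 1 θ)
      linarith
    have h1 : ‖β - α‖ * (1 - Real.log x) < c := by
      rw [mem_ball, dist_eq_norm, hδ, lt_div_iff₀ (by linarith)] at hβ
      exact hβ
    obtain ⟨h2, h3⟩ := (h.good β hβR).mem_domain_of_near hα hx
      (h1.le.trans ((min_le_right _ _).trans (min_le_left _ _)))
      (h1.trans_le ((min_le_right _ _).trans (min_le_right _ _)))
    refine ⟨hβR, h2, (h.norm_densityExt_le hβR h2).trans ?_⟩
    calc _ ≤ lsvSumConst θ κ a * (Real.exp 1 * x ^ (-α)) * gapSum θ κ a N := by gcongr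
      _ = M * x ^ (-α) := by ring
  have hmem := hball α (mem_ball_self hδ0)
  constructor
  · refine (Complex.re_le_norm _).trans (hmem.2.2.trans ?_)
    gcongr
    exact le_max_left _ _
  · have hΩ := isOpen_setOf_mem_lsvDomain (θ := θ) h.isOpen
    have h1 := hasDerivAt_fst_of_differentiableOn (p := ((α : ℂ), (x : ℂ))) hΩ
      h.differentiableOn_densityExt ⟨hmem.1, hmem.2.1⟩
    have h2 : DifferentiableOn ℂ (fun β => lsvDensityExt β x) (ball (α : ℂ) δ) :=
      h.differentiableOn_densityExt.comp (f := fun β : ℂ => (β, (x : ℂ))) (by fun_prop)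
        fun β hβ => ⟨(hball β hβ).1, (hball β hβ).2.1⟩
    have h3 := norm_fderiv_le_of_norm_le_ball hδ0 h2 fun β hβ => (hball β hβ).2.2
    rw [← norm_deriv_eq_norm_fderiv, h1.deriv] at h3
    refine (Complex.abs_re_le_norm _).trans (h3.trans ?_)
    have h4 : 2 * (M * x ^ (-α)) / δ = 2 * M / c * x ^ (-α) * (1 - Real.log x) := by
      rw [hδ]; field_simp
    rw [h4]
    gcongr
    exact le_max_right _ _

theorem exists_bound_lsvDensity {αm αp : ℝ} (h0 : 0 < αm) (h1 : αp < 1) :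
    ∃ K : ℝ, 0 ≤ K ∧ ∀ α ∈ Icc αm αp, ∀ x ∈ Ioc (0 : ℝ) 1, lsvDensity α x ≤ K * x ^ (-α) ∧
      |lsvDensityDeriv α x| ≤ K * x ^ (-α) * (1 - Real.log x) := by
  have hmono : ∀ {α x K K' : ℝ}, x ∈ Ioc (0 : ℝ) 1 → K ≤ K' →
      (lsvDensity α x ≤ K * x ^ (-α) ∧
        |lsvDensityDeriv α x| ≤ K * x ^ (-α) * (1 - Real.log x)) →
      lsvDensity α x ≤ K' * x ^ (-α) ∧
        |lsvDensityDeriv α x| ≤ K' * x ^ (-α) * (1 - Real.log x) := by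
    intro α x K K' hx hK h
    have hpow : 0 < x ^ (-α) := Real.rpow_pos_of_pos hx.1 _
    have hlog : 0 ≤ 1 - Real.log x := by linarith [Real.log_nonpos hx.1.le hx.2]
    exact ⟨h.1.trans (by gcongr), h.2.trans (by gcongr)⟩
  refine isCompact_Icc.induction_on (p := fun s => ∃ K : ℝ, 0 ≤ K ∧ ∀ α ∈ s, ∀ x ∈ Ioc (0 : ℝ) 1,
    lsvDensity α x ≤ K * x ^ (-α) ∧
      |lsvDensityDeriv α x| ≤ K * x ^ (-α) * (1 - Real.log x)) ⟨0, le_rfl, by simp⟩ ?_ ?_ ?_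
  · rintro s t hst ⟨K, hK, h⟩
    exact ⟨K, hK, fun α hα => h α (hst hα)⟩
  · rintro s t ⟨K, hK, h⟩ ⟨K', hK', h'⟩
    refine ⟨max K K', hK.trans (le_max_left _ _), fun α hα x hx => ?_⟩
    rcases hα with hα | hα
    · exact hmono hx (le_max_left _ _) (h α hα x hx)
    · exact hmono hx (le_max_right _ _) (h' α hα x hx)
  · intro α hα
    obtain ⟨K, hK⟩ := exists_local_bound_lsvDensity (α₀ := α)
      ⟨h0.trans_le hα.1, hα.2.trans_lt h1⟩
    exact ⟨_, mem_nhdsWithin_of_mem_nhds hK, max K 0, le_max_right _ _,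
      fun α hα x hx => hmono hx (le_max_left _ _) (hα x hx)⟩

theorem lsvDensity_eq_of_half_le (hα : α ∈ Ioo (0 : ℝ) 1) (hx : x ∈ Icc (1 / 2 : ℝ) 1) :
    lsvDensity α x = (lsvEigen α x).re := by
  rw [lsvDensity, lsvDensityExt, lsvTransfer_lsvEigen hα (ofReal_mem_lsvNhd hx)]

theorem hasSum_lsvDensity (hα : α ∈ Ioo (0 : ℝ) 1) (hx : x ∈ Ioc (0 : ℝ) 1) :
    HasSum (fun n => lsvRealDeriv α n x / 2 * lsvDensity α (lsvRealBranch α n x))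
      (lsvDensity α x) := by
  have h := goodExponent_self hα
  have hx' : x ∈ Ioo (0 : ℝ) (3 / 2) := ⟨hx.1, by linarith [hx.2]⟩
  obtain ⟨b, hb⟩ := exists_holBound_lsvEigen hα
  have h1 := (h.summable_transfer (ofReal_mem_lsvDomain hα hx') hb.le).hasSum
  refine (Complex.hasSum_re h1).congr_fun fun n => ?_
  rw [lsvDensity_eq_of_half_le hα (Ioc_subset_Icc_self (lsvRealBranch_mem hα hx n)),
    (lsvRealDeriv_spec hα hx' n).1, ofReal_lsvRealBranch hα hx' n,
    show ((lsvRealDeriv α n x : ℂ) / 2) = ((lsvRealDeriv α n x / 2 : ℝ) : ℂ) by push_cast; rfl,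
    Complex.re_ofReal_mul]

theorem lsvDensity_pos (hα : α ∈ Ioo (0 : ℝ) 1) (hx : x ∈ Ioc (0 : ℝ) 1) : 0 < lsvDensity α x := by
  have hx' : x ∈ Ioo (0 : ℝ) (3 / 2) := ⟨hx.1, by linarith [hx.2]⟩
  have h := hasSum_lsvDensity hα hx
  have hpos : ∀ n, 0 < lsvRealDeriv α n x / 2 * lsvDensity α (lsvRealBranch α n x) := by
    intro n
    have hm := Ioc_subset_Icc_self (lsvRealBranch_mem hα hx n)
    rw [lsvDensity_eq_of_half_le hα hm]
    exact mul_pos (half_pos (lsvRealDeriv_spec hα hx' n).2)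
      ((Real.exp_pos _).trans_le (lsvEigen_base hα ⟨_, hm, rfl⟩).1)
  rw [← h.tsum_eq]
  exact h.summable.tsum_pos (fun n => (hpos n).le) 0 (hpos 0)

theorem lsvRealDeriv_zero (α x : ℝ) : lsvRealDeriv α 0 x = 1 := by
  simp [lsvRealDeriv, lsvInvDeriv, lsvJac]

/-- The unnormalised density is invariant under the transfer operator of the LSV map. -/
theorem lsvDensity_eq (hα : α ∈ Ioo (0 : ℝ) 1) (hx : x ∈ Ioc (0 : ℝ) 1) :
    lsvDensity α x = lsvRealDeriv α 1 x * lsvDensity α (lsvRealInv α 1 x)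
      + 1 / 2 * lsvDensity α ((1 + x) / 2) := by
  have hx' : x ∈ Ioo (0 : ℝ) (3 / 2) := ⟨hx.1, by linarith [hx.2]⟩
  have hy : lsvRealInv α 1 x ∈ Ioc (0 : ℝ) 1 :=
    ⟨lsvRealInv_pos hα hx' 1, (lsvRealInv_le hα hx' 1).trans hx.2⟩
  have h := hasSum_lsvDensity hα hx
  have h1 := (hasSum_lsvDensity hα hy).mul_left (lsvRealDeriv α 1 x)
  set f : ℕ → ℝ := fun n => lsvRealDeriv α n x / 2 * lsvDensity α (lsvRealBranch α n x) with hf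
  -- The terms with positive index form the series at g(x) times g'(x), the left branch; the term of
  -- index 0 is the right branch.
  have hf1 : ∀ n, f (n + 1) = lsvRealDeriv α 1 x * (lsvRealDeriv α n (lsvRealInv α 1 x) / 2
      * lsvDensity α (lsvRealBranch α n (lsvRealInv α 1 x))) := fun n => by
    simp only [hf]
    simp only [lsvRealBranch]
    rw [lsvRealDeriv_succ hα hx' n, lsvRealInv_succ hα hx' n]
    ring
  have h2 : ∑' n, f (n + 1) = lsvRealDeriv α 1 x * lsvDensity α (lsvRealInv α 1 x) :=
    (tsum_congr hf1).trans h1.tsum_eq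
  have h3 : f 0 = 1 / 2 * lsvDensity α ((1 + x) / 2) := by
    simp only [hf]
    rw [lsvRealDeriv_zero, lsvRealBranch, lsvRealInv_zero hα hx']
  rw [← h.tsum_eq, h.summable.tsum_eq_zero_add, h2, h3, add_comm]

end Density


/-! ### The invariant probability measure -/

section InvariantMeasure

variable {α x : ℝ}

theorem continuousOn_lsvDensity_right (hα : α ∈ Ioo (0 : ℝ) 1) :
    ContinuousOn (lsvDensity α) (Ioc 0 1) :=
  continuousOn_lsvDensity.comp (f := fun x => (α, x)) (by fun_prop) fun _ hx => ⟨hα, hx⟩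

theorem integrableOn_lsvDensity (hα : α ∈ Ioo (0 : ℝ) 1) :
    IntegrableOn (lsvDensity α) (Ioc 0 1) := by
  obtain ⟨K, hK0, hK⟩ := exists_bound_lsvDensity hα.1 hα.2
  have h1 : IntegrableOn (fun x : ℝ => K * x ^ (-α)) (Ioc 0 1) := by
    have := (intervalIntegral.intervalIntegrable_rpow' (a := 0) (b := 1)
      (show -1 < -α by linarith [hα.2])).const_mul K
    rwa [intervalIntegrable_iff_integrableOn_Ioc_of_le zero_le_one] at this
  refine h1.mono' ((continuousOn_lsvDensity_right hα).aestronglyMeasurable measurableSet_Ioc) ?_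
  filter_upwards [ae_restrict_mem measurableSet_Ioc] with x hx
  rw [Real.norm_eq_abs, abs_of_pos (lsvDensity_pos hα hx)]
  exact (hK α ⟨le_rfl, le_rfl⟩ x hx).1

/-- The total mass of the unnormalised density. -/
noncomputable def lsvMass (α : ℝ) : ℝ := ∫ x in Icc (0 : ℝ) 1, lsvDensity α x

theorem lsvMass_pos (hα : α ∈ Ioo (0 : ℝ) 1) : 0 < lsvMass α := by
  rw [lsvMass, integral_Icc_eq_integral_Ioc,
    setIntegral_pos_iff_support_of_nonneg_ae _ (integrableOn_lsvDensity hα)]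
  · have : Function.support (lsvDensity α) ∩ Ioc 0 1 = Ioc 0 1 :=
      inter_eq_right.2 fun x hx => (lsvDensity_pos hα hx).ne'
    rw [this]
    simp
  · filter_upwards [ae_restrict_mem measurableSet_Ioc] with x hx
    exact (lsvDensity_pos hα hx).le

/-- The normalised invariant density. -/
noncomputable def lsvProbDensity (α x : ℝ) : ℝ := lsvDensity α x / lsvMass α

theorem lsvProbDensity_pos (hα : α ∈ Ioo (0 : ℝ) 1) (hx : x ∈ Ioc (0 : ℝ) 1) :
    0 < lsvProbDensity α x :=
  div_pos (lsvDensity_pos hα hx) (lsvMass_pos hα)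

theorem continuousOn_lsvProbDensity_right (hα : α ∈ Ioo (0 : ℝ) 1) :
    ContinuousOn (lsvProbDensity α) (Ioc 0 1) :=
  (continuousOn_lsvDensity_right hα).div_const _

/-- The absolutely continuous invariant probability measure. -/
noncomputable def lsvProb (α : ℝ) : Measure ℝ :=
  (volume.restrict (Icc (0 : ℝ) 1)).withDensity fun x => ENNReal.ofReal (lsvProbDensity α x)

theorem restrict_Icc_zero_one :
    (volume : Measure ℝ).restrict (Icc 0 1) = volume.restrict (Ioc 0 1) :=
  Measure.restrict_congr_set Ioc_ae_eq_Icc.symm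

theorem isProbabilityMeasure_lsvProb (hα : α ∈ Ioo (0 : ℝ) 1) :
    IsProbabilityMeasure (lsvProb α) := by
  constructor
  rw [lsvProb, withDensity_apply _ MeasurableSet.univ, Measure.restrict_univ,
    ← ofReal_integral_eq_lintegral_ofReal]
  · have h1 : ∫ x in Icc (0 : ℝ) 1, lsvProbDensity α x = 1 := by
      unfold lsvProbDensity
      rw [integral_div, ← lsvMass, div_self (lsvMass_pos hα).ne']
    rw [h1, ENNReal.ofReal_one]
  · rw [restrict_Icc_zero_one]
    exact (integrableOn_lsvDensity hα).div_const _
  · rw [restrict_Icc_zero_one]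
    filter_upwards [ae_restrict_mem measurableSet_Ioc] with x hx
    exact (lsvProbDensity_pos hα hx).le

theorem aemeasurable_lsvProbDensity (hα : α ∈ Ioo (0 : ℝ) 1) :
    AEMeasurable (fun x => ENNReal.ofReal (lsvProbDensity α x))
      (volume.restrict (Icc (0 : ℝ) 1)) := by
  rw [restrict_Icc_zero_one]
  exact ((continuousOn_lsvProbDensity_right hα).aemeasurable measurableSet_Ioc).ennreal_ofReal

theorem restrict_absolutelyContinuous_lsvProb (hα : α ∈ Ioo (0 : ℝ) 1) :
    volume.restrict (Icc (0 : ℝ) 1) ≪ lsvProb α := by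
  refine withDensity_absolutelyContinuous' (aemeasurable_lsvProbDensity hα) ?_
  rw [restrict_Icc_zero_one]
  filter_upwards [ae_restrict_mem measurableSet_Ioc] with x hx
  exact (ENNReal.ofReal_pos.2 (lsvProbDensity_pos hα hx)).ne'

theorem lsvProbDensity_eq (hα : α ∈ Ioo (0 : ℝ) 1) (hx : x ∈ Ioc (0 : ℝ) 1) :
    lsvProbDensity α x = lsvRealDeriv α 1 x * lsvProbDensity α (lsvRealInv α 1 x)
      + 1 / 2 * lsvProbDensity α ((1 + x) / 2) := by
  unfold lsvProbDensity
  rw [lsvDensity_eq hα hx]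
  ring

theorem preimage_lsvMap_left (hα : α ∈ Ioo (0 : ℝ) 1) (A : Set ℝ) :
    lsvMap α ⁻¹' A ∩ Ioc 0 (1 / 2) = lsvRealInv α 1 '' (A ∩ Ioc 0 1) := by
  ext y
  constructor
  · rintro ⟨hA, hy⟩
    exact ⟨lsvMap α y, ⟨hA, lsvMap_left_mem hα hy⟩, lsvRealInv_lsvMap hα hy⟩
  · rintro ⟨x, ⟨hA, hx⟩, rfl⟩
    refine ⟨?_, lsvRealInv_pos hα ⟨hx.1, by linarith [hx.2]⟩ 1, lsvRealInv_one_le_half hα hx⟩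
    rwa [mem_preimage, lsvMap_lsvRealInv hα hx]

theorem preimage_lsvMap_right (α : ℝ) (A : Set ℝ) :
    lsvMap α ⁻¹' A ∩ Ioc (1 / 2) 1 = (fun x => (1 + x) / 2) '' (A ∩ Ioc 0 1) := by
  have hmap : ∀ y : ℝ, 1 / 2 < y → lsvMap α y = 2 * y - 1 := fun y hy => if_neg (not_le.2 hy)
  ext y
  constructor
  · rintro ⟨hA, hy⟩
    rw [mem_preimage, hmap y hy.1] at hA
    exact ⟨2 * y - 1, ⟨hA, by linarith [hy.1], by linarith [hy.2]⟩, by ring⟩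
  · rintro ⟨x, ⟨hA, hx⟩, rfl⟩
    have h1 : 1 / 2 < (1 + x) / 2 := by linarith [hx.1]
    refine ⟨?_, h1, by linarith [hx.2]⟩
    simp only [mem_preimage]
    rwa [hmap _ h1, show 2 * ((1 + x) / 2) - 1 = x by ring]

theorem measurePreserving_lsvProb (hα : α ∈ Ioo (0 : ℝ) 1) :
    MeasurePreserving (lsvMap α) (lsvProb α) (lsvProb α) := by
  refine ⟨measurable_lsvMap α, Measure.ext fun A hA => ?_⟩
  have hT := measurable_lsvMap α hA
  have hS : MeasurableSet (A ∩ Ioc 0 1) := hA.inter measurableSet_Ioc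
  have hsub : ∀ x ∈ A ∩ Ioc 0 1, x ∈ Ioo (0 : ℝ) (3 / 2) := fun x hx =>
    ⟨hx.2.1, by linarith [hx.2.2]⟩
  rw [Measure.map_apply (measurable_lsvMap α) hA, lsvProb, withDensity_apply _ hT,
    withDensity_apply _ hA, restrict_Icc_zero_one, Measure.restrict_restrict hT,
    Measure.restrict_restrict hA]
  have hsplit : lsvMap α ⁻¹' A ∩ Ioc 0 1
      = (lsvMap α ⁻¹' A ∩ Ioc 0 (1 / 2)) ∪ (lsvMap α ⁻¹' A ∩ Ioc (1 / 2) 1) := by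
    rw [← inter_union_distrib_left, Ioc_union_Ioc_eq_Ioc (by norm_num) (by norm_num)]
  have hdisj : Disjoint (lsvMap α ⁻¹' A ∩ Ioc 0 (1 / 2)) (lsvMap α ⁻¹' A ∩ Ioc (1 / 2) 1) :=
    (Ioc_disjoint_Ioc_of_le le_rfl).mono inter_subset_right inter_subset_right
  rw [hsplit, lintegral_union (hT.inter measurableSet_Ioc) hdisj, preimage_lsvMap_left hα,
    preimage_lsvMap_right, lintegral_image_eq_lintegral_abs_deriv_mul hS
      (fun x hx => (hasDerivAt_lsvRealInv hα (hsub x hx) 1).hasDerivWithinAt)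
      fun x hx y hy h => (strictMonoOn_lsvRealInv hα 1).injOn (hsub x hx) (hsub y hy) h,
    lintegral_image_eq_lintegral_abs_deriv_mul (f := fun x => (1 + x) / 2)
      (f' := fun _ => 1 / 2) hS
      (fun x _ => (((hasDerivAt_id x).const_add 1).div_const 2).hasDerivWithinAt)
      fun x _ y _ h => by simp only at h; linarith, ← lintegral_add_right']
  · refine setLIntegral_congr_fun hS fun x hx => ?_
    have h1 := (lsvRealDeriv_spec hα (hsub x hx) 1).2
    have hx2 : (1 + x) / 2 ∈ Ioc (0 : ℝ) 1 := ⟨by linarith [hx.2.1], by linarith [hx.2.2]⟩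
    have hx1 : lsvRealInv α 1 x ∈ Ioc (0 : ℝ) 1 :=
      ⟨lsvRealInv_pos hα (hsub x hx) 1, (lsvRealInv_le hα (hsub x hx) 1).trans hx.2.2⟩
    have h2 := lsvProbDensity_pos hα hx1
    have h3 := lsvProbDensity_pos hα hx2
    rw [abs_of_pos h1, abs_of_pos one_half_pos, ← ENNReal.ofReal_mul h1.le,
      ← ENNReal.ofReal_mul one_half_pos.le, ← ENNReal.ofReal_add (by positivity) (by positivity),
      ← lsvProbDensity_eq hα hx.2]
  · refine AEMeasurable.const_mul (AEMeasurable.ennreal_ofReal ?_) _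
    refine ContinuousOn.aemeasurable ?_ hS
    exact (continuousOn_lsvProbDensity_right hα).comp (by fun_prop) fun x hx =>
      ⟨by linarith [hx.2.1], by linarith [hx.2.2]⟩

theorem isLSVAcip_lsvProb (hα : α ∈ Ioo (0 : ℝ) 1) : IsLSVAcip α (lsvProb α) :=
  ⟨isProbabilityMeasure_lsvProb hα, withDensity_absolutelyContinuous _ _,
    measurePreserving_lsvProb hα⟩

/-! ### Ergodicity and uniqueness -/

section Ergodic

variable {A : Set ℝ}

theorem lsvRealInv_mem_iff (hα : α ∈ Ioo (0 : ℝ) 1) (hA : lsvMap α ⁻¹' A = A) (n : ℕ) :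
    ∀ x ∈ Ioc (0 : ℝ) 1, lsvRealInv α n x ∈ A ↔ x ∈ A := by
  induction n with
  | zero => intro x hx; rw [lsvRealInv_zero hα ⟨hx.1, by linarith [hx.2]⟩]
  | succ n ih =>
    intro x hx
    have hx' : x ∈ Ioo (0 : ℝ) (3 / 2) := ⟨hx.1, by linarith [hx.2]⟩
    rw [lsvRealInv_succ hα hx', ih _ ⟨lsvRealInv_pos hα hx' 1,
      (lsvRealInv_le hα hx' 1).trans hx.2⟩]
    conv_lhs => rw [← hA]
    rw [mem_preimage, lsvMap_lsvRealInv hα hx]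

theorem lsvRealBranch_mem_iff (hα : α ∈ Ioo (0 : ℝ) 1) (hA : lsvMap α ⁻¹' A = A) (n : ℕ)
    (hx : x ∈ Ioc (0 : ℝ) 1) : lsvRealBranch α n x ∈ A ↔ x ∈ A := by
  conv_lhs => rw [← hA]
  rw [mem_preimage, lsvMap, if_neg (not_le.2 (lsvRealBranch_mem hα hx n).1),
    ← lsvRealInv_mem_iff hα hA n x hx, lsvRealBranch]
  ring_nf

theorem lintegral_mul_iterate_weightedComp (hα : α ∈ Ioo (0 : ℝ) 1) {u : ℂ → ℝ} {D : ℝ}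
    (hD : 0 ≤ D) (hKD : D / 2 + lsvDistConst (lsvAngle α) (α / 2) * 4 ≤ D)
    (hu : LogLip D lsvBase u) {χ : ℝ → ENNReal} (hχ : Measurable χ)
    (hinv : ∀ n, ∀ x ∈ Ioc (1 / 2 : ℝ) 1, χ (lsvRealBranch α n x) = χ x) (k : ℕ) :
    ∫⁻ x : ℝ in Ioc (1 / 2) 1,
        χ x * ENNReal.ofReal ((weightedComp (lsvWeight α) (lsvBranch α))^[k] u x)
      = ∫⁻ x : ℝ in Ioc (1 / 2) 1, χ x * ENNReal.ofReal (u x) := by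
  induction k with
  | zero => rfl
  | succ k ih =>
    rw [Function.iterate_succ_apply', lintegral_mul_weightedComp hα hD
      (hu.iterate hD hKD (contractingWeights_lsv_base hα) k) hχ hinv, ih]

-- Since all exponential moments are finite, the complex moment generating function is determined by
-- its values on the real line, and it determines the measure.
open ProbabilityTheory in
theorem ext_of_forall_lintegral_exp {μ ν : Measure ℝ} [IsFiniteMeasure μ] [IsFiniteMeasure ν]
    (h : ∀ t : ℝ, ∫⁻ x, ENNReal.ofReal (Real.exp (t * x)) ∂μ
      = ∫⁻ x, ENNReal.ofReal (Real.exp (t * x)) ∂ν)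
    (hint : ∀ t : ℝ, ∫⁻ x, ENNReal.ofReal (Real.exp (t * x)) ∂ν ≠ ⊤) : μ = ν := by
  have hmgf : mgf id μ = mgf id ν := by
    funext t
    unfold mgf
    rw [integral_eq_lintegral_of_nonneg_ae (Eventually.of_forall fun x => (Real.exp_pos _).le)
        (by fun_prop), integral_eq_lintegral_of_nonneg_ae
        (Eventually.of_forall fun x => (Real.exp_pos _).le) (by fun_prop)]
    exact congrArg ENNReal.toReal (h t)
  have hzero : μ = 0 ↔ ν = 0 := by
    have h0 := h 0
    simp only [zero_mul, Real.exp_zero, ENNReal.ofReal_one, lintegral_one] at h0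
    rw [← Measure.measure_univ_eq_zero, ← Measure.measure_univ_eq_zero, h0]
  have huniv : integrableExpSet id μ = univ := by
    refine eq_univ_of_forall fun t => ?_
    refine ⟨by fun_prop, ?_⟩
    rw [hasFiniteIntegral_iff_ofReal (Eventually.of_forall fun x => (Real.exp_pos _).le)]
    exact (h t).trans_lt (lt_top_iff_ne_top.2 (hint t))
  refine Measure.ext_of_complexMGF_id_eq (funext fun z => ?_)
  refine eqOn_complexMGF_of_mgf' hmgf hzero ?_
  rw [huniv, interior_univ]
  trivial

/-- The integral of χ · Lᵏ u does not depend on k, and Lᵏ u tends to the mean of u times h.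
Exponentials u serve as test functions because they are entire and have a Lipschitz logarithm. -/
theorem lintegral_mul_exp_of_invariant (hα : α ∈ Ioo (0 : ℝ) 1) {χ : ℝ → ENNReal}
    (hχ : Measurable χ) (hχ1 : ∀ x, χ x ≤ 1)
    (hinv : ∀ n, ∀ x ∈ Ioc (1 / 2 : ℝ) 1, χ (lsvRealBranch α n x) = χ x) (t : ℝ) :
    ∫⁻ x in Ioc (1 / 2) 1, χ x * ENNReal.ofReal (Real.exp (t * x))
      = 2 * (∫⁻ x : ℝ in Ioc (1 / 2) 1, χ x * ENNReal.ofReal (lsvEigen α x).re)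
        * ∫⁻ x in Ioc (1 / 2) 1, ENNReal.ofReal (Real.exp (t * x)) := by
  set v : ℂ → ℂ := fun z => Complex.exp (t * z) with hv
  set u : ℂ → ℝ := fun z => (v z).re with hu
  have hux : ∀ x : ℝ, u x = Real.exp (t * x) := fun x => by
    simp only [hu, hv]
    rw [← Complex.ofReal_mul, ← Complex.ofReal_exp, Complex.ofReal_re]
  have hvb : HolBound (Real.exp (|t| * (3 / 2))) v := by
    refine ⟨by fun_prop, fun z hz => ?_⟩
    rw [Complex.norm_exp, Real.exp_le_exp]
    refine (Complex.re_le_norm _).trans ?_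
    rw [norm_mul, Complex.norm_real, Real.norm_eq_abs]
    exact mul_le_mul_of_nonneg_left hz.2.le (abs_nonneg _)
  have hcone := lsvCone_pos hα
  have hlt := lsvCone_lt α
  -- The logarithm of x ↦ e^{tx} is |t|-Lipschitz, so the cone is enlarged to contain it.
  set D := |t| + lsvCone α with hD
  have hD0 : 0 ≤ D := by positivity
  have hKD : D / 2 + lsvDistConst (lsvAngle α) (α / 2) * 4 ≤ D := by
    linarith [abs_nonneg t]
  have hulip : LogLip D lsvBase u := by
    refine LogLip.mono (D := |t|) ⟨?_, ?_⟩ (by linarith)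
    · rintro _ ⟨x, -, rfl⟩
      simp only [hux]
      exact (Real.exp_pos _).le
    · rintro _ ⟨x, -, rfl⟩ _ ⟨y, -, rfl⟩
      simp only [hux]
      rw [← Real.exp_add, Real.exp_le_exp, Complex.dist_of_im_eq (by simp), Complex.ofReal_re,
        Complex.ofReal_re, Real.dist_eq, ← abs_mul]
      linarith [le_abs_self (t * (x - y))]
  have hW := contractingWeights_lsv_base hα
  have hit := fun k => hulip.iterate hD0 hKD hW k
  have hm0 : 0 ≤ lsvRealMean u := (invariantMean_lsv hα hD0).nonneg u hulip
  have hlim : ∀ x ∈ Ioc (1 / 2 : ℝ) 1, Tendsto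
      (fun k => χ x * ENNReal.ofReal ((weightedComp (lsvWeight α) (lsvBranch α))^[k] u x)) atTop
      (𝓝 (χ x * ENNReal.ofReal (lsvRealMean u * (lsvEigen α x).re))) := by
    intro x hx
    have hxb : (x : ℂ) ∈ lsvBase := ⟨x, Ioc_subset_Icc_self hx, rfl⟩
    refine ENNReal.Tendsto.const_mul (ENNReal.tendsto_ofReal ?_)
      (Or.inr ((hχ1 x).trans_lt ENNReal.one_lt_top).ne)
    have h1 := Complex.continuous_re.continuousAt.tendsto.comp
      (tendsto_iterate_lsvTransfer hα hvb (lsvBase_subset hxb))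
    rw [Complex.mul_re, (lsvEigen_base hα hxb).2, mul_zero, sub_zero, hvb.re_lsvMean] at h1
    exact h1.congr fun k => re_iterate_lsvTransfer hα hvb k hxb
  have hmean : ∀ k, lsvRealMean ((weightedComp (lsvWeight α) (lsvBranch α))^[k] u)
      = lsvRealMean u := by
    intro k
    induction k with
    | zero => rfl
    | succ k ih => rw [Function.iterate_succ_apply', lsvRealMean_weightedComp hα hD0 (hit k), ih]
  have hdom := tendsto_lintegral_of_dominated_convergence' (μ := volume.restrict (Ioc (1 / 2) 1))
    (F := fun k (x : ℝ) =>
      χ x * ENNReal.ofReal ((weightedComp (lsvWeight α) (lsvBranch α))^[k] u x))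
    (bound := fun _ => ENNReal.ofReal (Real.exp (D * 3) * lsvRealMean u))
    (fun k => hχ.aemeasurable.fun_mul (AEMeasurable.ennreal_ofReal
      ((((hit k).continuousOn hD0 dist_lsvBase_le).comp_ofReal.mono
        Ioc_subset_Icc_self).aemeasurable measurableSet_Ioc)))
    (fun k => by
      filter_upwards [ae_restrict_mem measurableSet_Ioc] with x hx
      have h1 := (invariantMean_lsv hα hD0).upper _ (hit k) x ⟨x, Ioc_subset_Icc_self hx, rfl⟩
      rw [hmean k] at h1
      exact (mul_le_of_le_one_left zero_le (hχ1 x)).trans (ENNReal.ofReal_le_ofReal h1))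
    (by simp [ENNReal.mul_eq_top]) (by
      filter_upwards [ae_restrict_mem measurableSet_Ioc] with x hx using hlim x hx)
  simp only [lintegral_mul_iterate_weightedComp hα hD0 hKD hulip hχ hinv] at hdom
  have h1 := tendsto_nhds_unique tendsto_const_nhds hdom
  simp only [hux] at h1
  have hmu : ENNReal.ofReal (lsvRealMean u)
      = 2 * ∫⁻ x in Ioc (1 / 2) 1, ENNReal.ofReal (Real.exp (t * x)) := by
    unfold lsvRealMean
    simp only [hux]
    rw [ENNReal.ofReal_mul zero_le_two, ENNReal.ofReal_ofNat,
      intervalIntegral.integral_of_le (by norm_num), ofReal_integral_eq_lintegral_ofReal]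
    · exact (Continuous.integrableOn_Icc (by fun_prop)).mono_set Ioc_subset_Icc_self
    · exact Eventually.of_forall fun x => (Real.exp_pos _).le
  rw [h1]
  have h2 : ∀ x : ℝ, χ x * ENNReal.ofReal (lsvRealMean u * (lsvEigen α x).re)
      = ENNReal.ofReal (lsvRealMean u) * (χ x * ENNReal.ofReal (lsvEigen α x).re) := fun x => by
    rw [ENNReal.ofReal_mul hm0, mul_left_comm]
  simp only [h2]
  rw [lintegral_const_mul' _ _ ENNReal.ofReal_ne_top, hmu]
  ring

/-- Lebesgue measure on A ∩ (1/2, 1] is c times Lebesgue measure on (1/2, 1], as both have the same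
exponential moments. Evaluation on the complement of A leaves c = 0 or a null complement. -/
theorem volume_inter_half_of_invariant (hα : α ∈ Ioo (0 : ℝ) 1) (hAm : MeasurableSet A)
    (hA : lsvMap α ⁻¹' A = A) :
    volume (A ∩ Ioc (1 / 2) 1) = 0 ∨ volume (Aᶜ ∩ Ioc (1 / 2) 1) = 0 := by
  set χ : ℝ → ENNReal := A.indicator 1 with hχ
  have hχ1 : ∀ x, χ x ≤ 1 := fun x => indicator_le_self' (fun _ _ => zero_le) x
  have hχm : Measurable χ := measurable_one.indicator hAm
  have hχmul : ∀ g : ℝ → ENNReal, ∫⁻ x in Ioc (1 / 2) 1, χ x * g x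
      = ∫⁻ x in A ∩ Ioc (1 / 2) 1, g x := by
    intro g
    have : ∀ x, χ x * g x = A.indicator g x := fun x => by
      by_cases hx : x ∈ A <;> simp [hχ, hx]
    simp only [this]
    rw [lintegral_indicator hAm, Measure.restrict_restrict hAm]
  have hinv : ∀ n, ∀ x ∈ Ioc (1 / 2 : ℝ) 1, χ (lsvRealBranch α n x) = χ x := by
    intro n x hx
    have := lsvRealBranch_mem_iff hα hA n (x := x) ⟨by linarith [hx.1], hx.2⟩
    by_cases hxA : x ∈ A
    · rw [hχ, indicator_of_mem hxA, indicator_of_mem (this.2 hxA)]; rfl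
    · rw [hχ, indicator_of_notMem hxA, indicator_of_notMem (mt this.1 hxA)]
  have hkey := lintegral_mul_exp_of_invariant hα hχm hχ1 hinv
  set c := 2 * (∫⁻ x : ℝ in Ioc (1 / 2) 1, χ x * ENNReal.ofReal (lsvEigen α x).re) with hc
  have hfin : ∀ t : ℝ, ∫⁻ x in Ioc (1 / 2) 1, ENNReal.ofReal (Real.exp (t * x)) ≠ ⊤ := fun t =>
    ((Continuous.integrableOn_Icc (by fun_prop)).mono_set
      Ioc_subset_Icc_self).lintegral_lt_top.ne
  have hc_top : c ≠ ⊤ := by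
    obtain ⟨b, hb⟩ := exists_holBound_lsvEigen hα
    refine ENNReal.mul_ne_top ENNReal.ofNat_ne_top (ne_top_of_le_ne_top
      (b := ∫⁻ _ : ℝ in Ioc (1 / 2) 1, ENNReal.ofReal b) (by simp [ENNReal.mul_eq_top]) ?_)
    refine setLIntegral_mono measurable_const fun x hx => ?_
    refine (mul_le_of_le_one_left zero_le (hχ1 x)).trans (ENNReal.ofReal_le_ofReal ?_)
    exact (Complex.re_le_norm _).trans (hb.le _ (ofReal_mem_lsvNhd (Ioc_subset_Icc_self hx)))
  have hfm : IsFiniteMeasure (c • (volume : Measure ℝ).restrict (Ioc (1 / 2) 1)) :=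
    Measure.smul_finite _ hc_top
  have hfm' : IsFiniteMeasure ((volume : Measure ℝ).restrict (A ∩ Ioc (1 / 2) 1)) :=
    ⟨by
      rw [Measure.restrict_apply_univ]
      exact (measure_mono inter_subset_right).trans_lt measure_Ioc_lt_top⟩
  have heq : (volume : Measure ℝ).restrict (A ∩ Ioc (1 / 2) 1)
      = c • volume.restrict (Ioc (1 / 2) 1) := by
    refine ext_of_forall_lintegral_exp (fun t => ?_) fun t => ?_
    · rw [lintegral_smul_measure, ← hχmul, hkey t, smul_eq_mul]
    · rw [lintegral_smul_measure, smul_eq_mul]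
      exact ENNReal.mul_ne_top hc_top (hfin t)
  have h1 := congrFun (congrArg (fun μ : Measure ℝ => (μ : Set ℝ → ENNReal)) heq) Aᶜ
  simp only [Measure.smul_apply, smul_eq_mul, Measure.restrict_apply hAm.compl] at h1
  rw [← inter_assoc, compl_inter_self, empty_inter, measure_empty] at h1
  rcases mul_eq_zero.1 h1.symm with h | h
  · left
    have h2 := congrFun (congrArg (fun μ : Measure ℝ => (μ : Set ℝ → ENNReal)) heq) univ
    simpa [h] using h2
  · exact Or.inr h

/-- For x in (0, 1], x ∈ A if and only if (1 + x)/2 ∈ A, so A ∩ (0, 1] lies in the image of a null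
set under y ↦ 2y - 1. -/
theorem ae_notMem_of_invariant (hα : α ∈ Ioo (0 : ℝ) 1) (hA : lsvMap α ⁻¹' A = A)
    (h0 : volume (A ∩ Ioc (1 / 2) 1) = 0) : ∀ᵐ x ∂lsvProb α, x ∉ A := by
  refine (withDensity_absolutelyContinuous _ _).ae_le ?_
  change ∀ᵐ x ∂(volume.restrict (Icc (0 : ℝ) 1)), x ∉ A
  rw [restrict_Icc_zero_one, ae_restrict_iff' measurableSet_Ioc, ae_iff]
  refine measure_mono_null (t := (fun y => 2 * y - 1) '' (A ∩ Ioc (1 / 2) 1)) (fun x hx => ?_)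
    (addHaar_image_eq_zero_of_differentiableOn_of_addHaar_eq_zero volume
      (by fun_prop) h0)
  simp only [not_forall, not_not, mem_ofPred_eq] at hx
  obtain ⟨hx, hxA⟩ := hx
  refine ⟨lsvRealBranch α 0 x, ⟨(lsvRealBranch_mem_iff hα hA 0 hx).2 hxA,
    lsvRealBranch_mem hα hx 0⟩, ?_⟩
  simp only
  rw [lsvRealBranch, lsvRealInv_zero hα ⟨hx.1, by linarith [hx.2]⟩]
  ring

theorem ergodic_lsvProb (hα : α ∈ Ioo (0 : ℝ) 1) : Ergodic (lsvMap α) (lsvProb α) where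
  toMeasurePreserving := measurePreserving_lsvProb hα
  aeconst_set A hAm hA := by
    rw [eventuallyConst_set]
    rcases volume_inter_half_of_invariant hα hAm hA with h | h
    · exact Or.inr (ae_notMem_of_invariant hα hA h)
    · left
      have := ae_notMem_of_invariant hα (A := Aᶜ) (by rw [preimage_compl, hA]) h
      filter_upwards [this] with x hx using not_not.1 hx

end Ergodic

/-- Positivity of the density makes ν absolutely continuous with respect to `lsvProb α`, and an
invariant probability measure that is absolutely continuous with respect to an ergodic one equals
it. -/
theorem IsLSVAcip.eq_lsvProb (hα : α ∈ Ioo (0 : ℝ) 1) {ν : Measure ℝ} (hν : IsLSVAcip α ν) :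
    ν = lsvProb α := by
  have := hν.isProbabilityMeasure
  have := isProbabilityMeasure_lsvProb hα
  exact (ergodic_lsvProb hα).eq_of_absolutelyContinuous hν.measurePreserving
    (hν.absolutelyContinuous.trans (restrict_absolutelyContinuous_lsvProb hα))

end InvariantMeasure


/-! ### Differentiation of integrals, normalisation and observables -/

section LinearResponse

variable {α x l u b : ℝ} {φ : ℝ → ℝ}

/-- Hölder's inequality: x^{-b} belongs to the dual Lebesgue space exactly because b < 1 - 1/r makes
the power integrable. -/
theorem integrable_rpow_neg_mul {r : ℝ} (hr : 1 < r) (hbr : b < 1 - r⁻¹)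
    (hφ : MemLp φ (ENNReal.ofReal r) (volume.restrict (Ioc (0 : ℝ) 1))) :
    Integrable (fun x => x ^ (-b) * φ x) (volume.restrict (Ioc (0 : ℝ) 1)) := by
  have hconj := Real.HolderConjugate.conjExponent hr
  have := hconj.symm.ennrealOfReal
  have hs : 0 < r.conjExponent := hconj.symm.pos
  have hinv := hconj.inv_add_inv_eq_one
  have hG : MemLp (fun x : ℝ => x ^ (-b)) (ENNReal.ofReal r.conjExponent)
      (volume.restrict (Ioc (0 : ℝ) 1)) := by
    refine (integrable_norm_rpow_iff ?_ (ENNReal.ofReal_pos.2 hs).ne' ENNReal.ofReal_ne_top).1 ?_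
    · exact (ContinuousOn.rpow_const continuousOn_id fun x hx =>
        Or.inl hx.1.ne').aestronglyMeasurable measurableSet_Ioc
    · have h1 : -1 < -b * r.conjExponent := by
        have h2 : b < r.conjExponent⁻¹ := by linarith
        have h3 := mul_lt_mul_of_pos_right h2 hs
        rw [inv_mul_cancel₀ hs.ne'] at h3
        linarith
      have h4 := intervalIntegral.intervalIntegrable_rpow' (a := 0) (b := 1) h1
      rw [intervalIntegrable_iff_integrableOn_Ioc_of_le zero_le_one] at h4
      refine h4.congr_fun (fun x hx => ?_) measurableSet_Ioc
      simp only
      rw [ENNReal.toReal_ofReal hs.le, Real.norm_eq_abs,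
        abs_of_pos (Real.rpow_pos_of_pos hx.1 _), ← Real.rpow_mul hx.1.le]
  exact hG.integrable_mul hφ

theorem rpow_neg_le_rpow_neg (hx : x ∈ Ioc (0 : ℝ) 1) (hα : α ≤ b) : x ^ (-α) ≤ x ^ (-b) :=
  Real.rpow_le_rpow_of_exponent_ge hx.1 hx.2 (neg_le_neg hα)

/-- The logarithm is absorbed by the spare power: -log x ≤ x^{-(b-u)}/(b - u). -/
theorem rpow_neg_mul_one_sub_log_le (hx : x ∈ Ioc (0 : ℝ) 1) (hα : α ≤ u) (hub : u < b) :
    x ^ (-α) * (1 - Real.log x) ≤ (1 + (b - u)⁻¹) * x ^ (-b) := by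
  have hε : 0 < b - u := by linarith
  have h1 := Real.log_le_rpow_div (inv_pos.2 hx.1).le hε
  rw [Real.log_inv, Real.inv_rpow hx.1.le, ← Real.rpow_neg hx.1.le] at h1
  have h2 : 1 ≤ x ^ (-(b - u)) :=
    Real.one_le_rpow_of_pos_of_le_one_of_nonpos hx.1 hx.2 (by linarith)
  have h3 : 1 - Real.log x ≤ (1 + (b - u)⁻¹) * x ^ (-(b - u)) := by
    rw [div_eq_mul_inv] at h1
    linarith
  have h4 : x ^ (-b) = x ^ (-u) * x ^ (-(b - u)) := by
    rw [← Real.rpow_add hx.1]; congr 1; ring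
  have h5 := rpow_neg_le_rpow_neg hx hα
  have h6 : 0 ≤ 1 - Real.log x := by linarith [Real.log_nonpos hx.1.le hx.2]
  calc x ^ (-α) * (1 - Real.log x) ≤ x ^ (-u) * ((1 + (b - u)⁻¹) * x ^ (-(b - u))) :=
        mul_le_mul h5 h3 h6 (Real.rpow_pos_of_pos hx.1 _).le
    _ = _ := by rw [h4]; ring

theorem exists_dominating_lsvDensity (hl : 0 < l) (hub : u < b) (hb : b < 1) :
    ∃ K : ℝ, ∀ α ∈ Icc l u, ∀ x ∈ Ioc (0 : ℝ) 1,
      |lsvDensity α x| ≤ K * x ^ (-b) ∧ |lsvDensityDeriv α x| ≤ K * x ^ (-b) := by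
  obtain ⟨K, hK0, hK⟩ := exists_bound_lsvDensity hl (hub.trans hb)
  refine ⟨K * (1 + (b - u)⁻¹), fun α hα x hx => ?_⟩
  obtain ⟨h1, h2⟩ := hK α hα x hx
  have hε : 0 < (b - u)⁻¹ := inv_pos.2 (by linarith)
  have hpow : 0 < x ^ (-b) := Real.rpow_pos_of_pos hx.1 _
  constructor
  · rw [abs_of_pos (lsvDensity_pos ⟨hl.trans_le hα.1, hα.2.trans_lt (hub.trans hb)⟩ hx)]
    have h3 := mul_le_mul_of_nonneg_left (rpow_neg_le_rpow_neg hx (hα.2.trans hub.le)) hK0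
    have h4 : 0 ≤ K * (b - u)⁻¹ * x ^ (-b) := by positivity
    linarith
  · have h3 := mul_le_mul_of_nonneg_left (rpow_neg_mul_one_sub_log_le hx hα.2 hub) hK0
    linarith

theorem hasDerivAt_integral_lsvDensity_mul (hl : 0 < l) (hub : u < b) (hb : b < 1)
    (hφm : AEStronglyMeasurable φ (volume.restrict (Ioc (0 : ℝ) 1)))
    (hφ : Integrable (fun x => x ^ (-b) * φ x) (volume.restrict (Ioc (0 : ℝ) 1))) :
    (∀ α ∈ Ioo l u, Integrable (fun x => lsvDensity α x * φ x) (volume.restrict (Ioc (0 : ℝ) 1)) ∧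
      HasDerivAt (fun α => ∫ x in Ioc (0 : ℝ) 1, lsvDensity α x * φ x)
        (∫ x in Ioc (0 : ℝ) 1, lsvDensityDeriv α x * φ x) α) ∧
    ContinuousOn (fun α => ∫ x in Ioc (0 : ℝ) 1, lsvDensityDeriv α x * φ x) (Ioo l u) := by
  obtain ⟨K, hK⟩ := exists_dominating_lsvDensity hl hub hb
  have hsub : ∀ α ∈ Ioo l u, α ∈ Ioo (0 : ℝ) 1 := fun α hα =>
    ⟨hl.trans hα.1, hα.2.trans (hub.trans hb)⟩
  have hbd : Integrable (fun x => K * |x ^ (-b) * φ x|) (volume.restrict (Ioc (0 : ℝ) 1)) :=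
    hφ.abs.const_mul K
  have habs : ∀ x ∈ Ioc (0 : ℝ) 1, ∀ y, |y| ≤ K * x ^ (-b) →
      ‖y * φ x‖ ≤ K * |x ^ (-b) * φ x| := fun x hx y hy => by
    rw [Real.norm_eq_abs, abs_mul, abs_mul, abs_of_pos (Real.rpow_pos_of_pos hx.1 _), ← mul_assoc]
    exact mul_le_mul_of_nonneg_right hy (abs_nonneg _)
  have hm : ∀ α ∈ Ioo l u, AEStronglyMeasurable (fun x => lsvDensity α x * φ x)
      (volume.restrict (Ioc (0 : ℝ) 1)) := fun α hα =>
    ((continuousOn_lsvDensity_right (hsub α hα)).aestronglyMeasurable measurableSet_Ioc).mul hφm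
  have hm' : ∀ α ∈ Ioo l u, AEStronglyMeasurable (fun x => lsvDensityDeriv α x * φ x)
      (volume.restrict (Ioc (0 : ℝ) 1)) := fun α hα =>
    ((continuousOn_lsvDensityDeriv.comp (f := fun x => (α, x)) (by fun_prop)
      fun _ hx => ⟨hsub α hα, hx⟩).aestronglyMeasurable measurableSet_Ioc).mul hφm
  have hint : ∀ α ∈ Ioo l u, Integrable (fun x => lsvDensity α x * φ x)
      (volume.restrict (Ioc (0 : ℝ) 1)) := fun α hα => by
    refine hbd.mono' (hm α hα) ?_
    filter_upwards [ae_restrict_mem measurableSet_Ioc] with x hx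
    exact habs x hx _ (hK α (Ioo_subset_Icc_self hα) x hx).1
  have hbd' : ∀ α ∈ Ioo l u, ∀ x ∈ Ioc (0 : ℝ) 1,
      ‖lsvDensityDeriv α x * φ x‖ ≤ K * |x ^ (-b) * φ x| := fun α hα x hx =>
    habs x hx _ (hK α (Ioo_subset_Icc_self hα) x hx).2
  refine ⟨fun α hα => ⟨hint α hα, ?_⟩, fun α hα => ContinuousAt.continuousWithinAt ?_⟩
  · have hn := isOpen_Ioo.mem_nhds hα
    refine (hasDerivAt_integral_of_dominated_loc_of_deriv_le
      (F := fun α x => lsvDensity α x * φ x) (F' := fun α x => lsvDensityDeriv α x * φ x)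
      (bound := fun x => K * |x ^ (-b) * φ x|) hn ?_ (hint α hα) (hm' α hα) ?_ hbd ?_).2
    · filter_upwards [hn] with a ha using hm a ha
    · filter_upwards [ae_restrict_mem measurableSet_Ioc] with x hx a ha using hbd' a ha x hx
    · filter_upwards [ae_restrict_mem measurableSet_Ioc] with x hx a ha
      exact (hasDerivAt_lsvDensity (hsub a ha) hx).mul_const _
  · have hn := isOpen_Ioo.mem_nhds hα
    refine continuousAt_of_dominated (bound := fun x => K * |x ^ (-b) * φ x|) ?_ ?_ hbd ?_
    · filter_upwards [hn] with a ha using hm' a ha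
    · filter_upwards [hn] with a ha
      filter_upwards [ae_restrict_mem measurableSet_Ioc] with x hx using hbd' a ha x hx
    · filter_upwards [ae_restrict_mem measurableSet_Ioc] with x hx
      refine ContinuousAt.mul_const ?_ _
      have h1 : ContinuousOn (fun a => lsvDensityDeriv a x) (Ioo 0 1) :=
        continuousOn_lsvDensityDeriv.comp (f := fun a => (a, x)) (by fun_prop) fun _ ha => ⟨ha, hx⟩
      exact h1.continuousAt (isOpen_Ioo.mem_nhds (hsub α hα))

/-- The derivative of the total mass. -/
noncomputable def lsvMassDeriv (α : ℝ) : ℝ := ∫ x in Ioc (0 : ℝ) 1, lsvDensityDeriv α x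

/-- The case φ = 1 of the preceding lemma, on a window about α, with (α + 1)/2 < (α + 3)/4 < 1. -/
theorem hasDerivAt_lsvMass_and_continuousAt (hα : α ∈ Ioo (0 : ℝ) 1) :
    HasDerivAt lsvMass (lsvMassDeriv α) α ∧ ContinuousAt lsvMassDeriv α := by
  have h0 := hα.1
  have h1 := hα.2
  have hint : Integrable (fun x : ℝ => x ^ (-((α + 3) / 4)) * 1)
      (volume.restrict (Ioc (0 : ℝ) 1)) := by
    have := intervalIntegral.intervalIntegrable_rpow' (a := 0) (b := 1)
      (show -1 < -((α + 3) / 4) by linarith)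
    rw [intervalIntegrable_iff_integrableOn_Ioc_of_le zero_le_one] at this
    simp only [mul_one]
    exact this
  obtain ⟨h2, h3⟩ := hasDerivAt_integral_lsvDensity_mul (l := α / 2) (u := (α + 1) / 2)
    (by linarith) (by linarith) (by linarith) aestronglyMeasurable_const hint
  have hmem : α ∈ Ioo (α / 2) ((α + 1) / 2) := ⟨by linarith, by linarith⟩
  have h4 := (h2 α hmem).2
  have h5 := h3.continuousAt (isOpen_Ioo.mem_nhds hmem)
  simp only [mul_one] at h4 h5
  refine ⟨?_, h5⟩
  have e : lsvMass = fun α => ∫ x in Ioc (0 : ℝ) 1, lsvDensity α x := by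
    funext α
    rw [lsvMass, integral_Icc_eq_integral_Ioc]
  rwa [e]

/-- The partial derivative of `lsvProbDensity` with respect to the parameter. -/
noncomputable def lsvProbDensityDeriv (α x : ℝ) : ℝ :=
  (lsvDensityDeriv α x * lsvMass α - lsvDensity α x * lsvMassDeriv α) / lsvMass α ^ 2

theorem hasDerivAt_lsvProbDensity (hα : α ∈ Ioo (0 : ℝ) 1) (hx : x ∈ Ioc (0 : ℝ) 1) :
    HasDerivAt (fun a => lsvProbDensity a x) (lsvProbDensityDeriv α x) α :=
  (hasDerivAt_lsvDensity hα hx).fun_div (hasDerivAt_lsvMass_and_continuousAt hα).1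
    (lsvMass_pos hα).ne'

theorem continuousOn_lsvMass : ContinuousOn lsvMass (Ioo 0 1) := fun _ hα =>
  (hasDerivAt_lsvMass_and_continuousAt hα).1.continuousAt.continuousWithinAt

theorem continuousOn_lsvMassDeriv : ContinuousOn lsvMassDeriv (Ioo 0 1) := fun _ hα =>
  (hasDerivAt_lsvMass_and_continuousAt hα).2.continuousWithinAt

theorem continuousOn_lsvProbDensity : ContinuousOn (fun p : ℝ × ℝ => lsvProbDensity p.1 p.2)
    (Ioo (0 : ℝ) 1 ×ˢ Ioc (0 : ℝ) 1) :=
  continuousOn_lsvDensity.div (continuousOn_lsvMass.comp continuousOn_fst fun _ hp => hp.1)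
    fun _ hp => (lsvMass_pos hp.1).ne'

theorem continuousOn_lsvProbDensityDeriv :
    ContinuousOn (fun p : ℝ × ℝ => lsvProbDensityDeriv p.1 p.2)
      (Ioo (0 : ℝ) 1 ×ˢ Ioc (0 : ℝ) 1) := by
  have h1 : ContinuousOn (fun p : ℝ × ℝ => lsvMass p.1) (Ioo (0 : ℝ) 1 ×ˢ Ioc (0 : ℝ) 1) :=
    continuousOn_lsvMass.comp continuousOn_fst fun _ hp => hp.1
  have h2 : ContinuousOn (fun p : ℝ × ℝ => lsvMassDeriv p.1) (Ioo (0 : ℝ) 1 ×ˢ Ioc (0 : ℝ) 1) :=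
    continuousOn_lsvMassDeriv.comp continuousOn_fst fun _ hp => hp.1
  exact ((continuousOn_lsvDensityDeriv.mul h1).sub (continuousOn_lsvDensity.mul h2)).div (h1.pow 2)
    fun _ hp => (pow_pos (lsvMass_pos hp.1) 2).ne'

theorem exists_bound_lsvProbDensity {αm αp : ℝ} (h0 : 0 < αm) (h1 : αp < 1) :
    ∃ K : ℝ, ∀ x ∈ Ioc (0 : ℝ) 1, ∀ α ∈ Icc αm αp, lsvProbDensity α x ≤ K * x ^ (-α) ∧
      |lsvProbDensityDeriv α x| ≤ K * x ^ (-α) * (1 - Real.log x) := by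
  have hsub : Icc αm αp ⊆ Ioo (0 : ℝ) 1 := fun α hα => ⟨h0.trans_le hα.1, hα.2.trans_lt h1⟩
  obtain ⟨K, hK0, hK⟩ := exists_bound_lsvDensity h0 h1
  obtain ⟨C, hC⟩ := isCompact_Icc.exists_bound_of_continuousOn
    ((continuousOn_lsvMass.inv₀ fun α hα => (lsvMass_pos hα).ne').mono hsub)
  obtain ⟨M, hM⟩ := isCompact_Icc.exists_bound_of_continuousOn (continuousOn_lsvMassDeriv.mono hsub)
  -- C bounds the reciprocal of the mass and M its derivative. The second summand pays for the term
  -- of the quotient rule in which the mass is differentiated.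
  refine ⟨K * C + K * C * (M * C), fun x hx α hα => ?_⟩
  obtain ⟨h2, h3⟩ := hK α hα x hx
  have hZ := lsvMass_pos (hsub hα)
  have hρ := lsvDensity_pos (hsub hα) hx
  have hCα := hC α hα
  have hMα := hM α hα
  rw [Pi.inv_apply, Real.norm_eq_abs, abs_of_pos (inv_pos.2 hZ)] at hCα
  rw [Real.norm_eq_abs] at hMα
  have hC0 : 0 ≤ C := (inv_pos.2 hZ).le.trans hCα
  have hM0 : 0 ≤ M := (abs_nonneg _).trans hMα
  have hpow : 0 < x ^ (-α) := Real.rpow_pos_of_pos hx.1 _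
  have hlog : 1 ≤ 1 - Real.log x := by linarith [Real.log_nonpos hx.1.le hx.2]
  have h4 : lsvProbDensity α x ≤ K * x ^ (-α) * C := by
    rw [lsvProbDensity, div_eq_mul_inv]
    exact mul_le_mul h2 hCα (inv_pos.2 hZ).le (by positivity)
  constructor
  · have : 0 ≤ K * C * (M * C) * x ^ (-α) := by positivity
    linarith
  · have e : lsvProbDensityDeriv α x = lsvDensityDeriv α x * (lsvMass α)⁻¹
        - lsvProbDensity α x * (lsvMassDeriv α * (lsvMass α)⁻¹) := by
      rw [lsvProbDensityDeriv, lsvProbDensity]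
      field_simp
    rw [e]
    refine (abs_sub _ _).trans ?_
    rw [abs_mul, abs_mul, abs_mul, abs_of_pos (inv_pos.2 hZ),
      abs_of_pos (lsvProbDensity_pos (hsub hα) hx)]
    have h5 := mul_le_mul h3 hCα (inv_pos.2 hZ).le (by positivity)
    have h6 : |lsvMassDeriv α| * (lsvMass α)⁻¹ ≤ M * C :=
      mul_le_mul hMα hCα (inv_pos.2 hZ).le hM0
    have h7 := mul_le_mul h4 h6 (by positivity) (by positivity)
    have h8 : K * x ^ (-α) * C * (M * C) ≤ K * x ^ (-α) * C * (M * C) * (1 - Real.log x) :=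
      le_mul_of_one_le_right (by positivity) hlog
    linarith

theorem integrable_lsvProb_iff (hα : α ∈ Ioo (0 : ℝ) 1) :
    Integrable φ (lsvProb α)
      ↔ Integrable (fun x => lsvProbDensity α x * φ x) (volume.restrict (Ioc (0 : ℝ) 1)) := by
  rw [← restrict_Icc_zero_one]
  refine (integrable_withDensity_iff_integrable_smul₀
    (f := fun x => (lsvProbDensity α x).toNNReal) ?_).trans (integrable_congr ?_)
  · rw [restrict_Icc_zero_one]
    exact ((continuousOn_lsvProbDensity_right hα).aemeasurable measurableSet_Ioc).real_toNNReal
  · rw [restrict_Icc_zero_one]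
    filter_upwards [ae_restrict_mem measurableSet_Ioc] with x hx
    rw [NNReal.smul_def, Real.coe_toNNReal _ (lsvProbDensity_pos hα hx).le, smul_eq_mul]

theorem integral_lsvProb (hα : α ∈ Ioo (0 : ℝ) 1) :
    ∫ x, φ x ∂lsvProb α = (∫ x in Ioc (0 : ℝ) 1, lsvDensity α x * φ x) / lsvMass α := by
  refine (integral_withDensity_eq_integral_smul₀
    (f := fun x => (lsvProbDensity α x).toNNReal) ?_ φ).trans ?_
  · rw [restrict_Icc_zero_one]
    exact ((continuousOn_lsvProbDensity_right hα).aemeasurable measurableSet_Ioc).real_toNNReal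
  · rw [restrict_Icc_zero_one, ← integral_div]
    refine setIntegral_congr_fun measurableSet_Ioc fun x hx => ?_
    rw [NNReal.smul_def, Real.coe_toNNReal _ (lsvProbDensity_pos hα hx).le, smul_eq_mul,
      lsvProbDensity]
    ring

theorem contDiffOn_integral_lsvProb {αm αp : ℝ} (h0 : 0 < αm) (hmp : αm < αp) (h1 : αp < 1)
    {q : ENNReal} (hq : ENNReal.ofReal (1 - αp)⁻¹ < q)
    (hφ : MemLp φ q (volume.restrict (Icc (0 : ℝ) 1))) :
    (∀ α ∈ Icc αm αp, Integrable φ (lsvProb α)) ∧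
      ContDiffOn ℝ 1 (fun α => ∫ x, φ x ∂lsvProb α) (Icc αm αp) := by
  rw [restrict_Icc_zero_one] at hφ
  -- A finite exponent r below q replaces q, which may be ∞.
  obtain ⟨r, hr1, hr2⟩ := ENNReal.lt_iff_exists_nnreal_btwn.1 hq
  have hpos : 0 < 1 - αp := by linarith
  have hr : (1 - αp)⁻¹ < r := by
    rw [← ENNReal.ofReal_coe_nnreal] at hr1
    exact (ENNReal.ofReal_lt_ofReal_iff_of_nonneg (inv_pos.2 hpos).le).1 hr1
  have hr' : (1 : ℝ) < r := (one_lt_inv_iff₀.2 ⟨hpos, by linarith⟩).trans hr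
  have hr3 : αp < 1 - (r : ℝ)⁻¹ := by
    have := inv_lt_of_inv_lt₀ hpos hr
    linarith
  have hr4 : 0 < (r : ℝ)⁻¹ := inv_pos.2 (by linarith)
  -- The midpoints give αp < u < b < 1 - 1/r. The open interval (αm/2, u) contains [αm, αp], so the
  -- derivatives at the end points are two-sided.
  set b := (αp + (1 - (r : ℝ)⁻¹)) / 2 with hb
  set u := (αp + b) / 2 with hu
  have hφr : MemLp φ (ENNReal.ofReal r) (volume.restrict (Ioc (0 : ℝ) 1)) := by
    rw [ENNReal.ofReal_coe_nnreal]
    exact hφ.mono_exponent hr2.le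
  obtain ⟨h2, h3⟩ := hasDerivAt_integral_lsvDensity_mul (l := αm / 2) (u := u) (b := b)
    (by linarith) (by linarith) (by linarith) hφ.1
    (integrable_rpow_neg_mul hr' (by linarith) hφr)
  have hsub : Icc αm αp ⊆ Ioo (αm / 2) u := fun α hα =>
    ⟨by linarith [hα.1], by linarith [hα.2]⟩
  have hsub' : Ioo (αm / 2) u ⊆ Ioo 0 1 := fun α hα =>
    ⟨by linarith [hα.1], by linarith [hα.2]⟩
  refine ⟨fun α hα => ?_, ?_⟩
  · rw [integrable_lsvProb_iff (hsub' (hsub hα))]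
    refine ((h2 α (hsub hα)).1.div_const (lsvMass α)).congr (Eventually.of_forall fun x => ?_)
    simp only [lsvProbDensity]
    ring
  · refine ContDiffOn.congr (ContDiffOn.mono ?_ hsub)
      fun α hα => integral_lsvProb (hsub' (hsub hα))
    have hderiv : ∀ α ∈ Ioo (αm / 2) u, HasDerivAt
        (fun α => (∫ x in Ioc (0 : ℝ) 1, lsvDensity α x * φ x) / lsvMass α)
        (((∫ x in Ioc (0 : ℝ) 1, lsvDensityDeriv α x * φ x) * lsvMass α
          - (∫ x in Ioc (0 : ℝ) 1, lsvDensity α x * φ x) * lsvMassDeriv α) / lsvMass α ^ 2) α :=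
      fun α hα => (h2 α hα).2.fun_div (hasDerivAt_lsvMass_and_continuousAt (hsub' hα)).1
        (lsvMass_pos (hsub' hα)).ne'
    rw [contDiffOn_one_iff_derivWithin isOpen_Ioo.uniqueDiffOn]
    refine ⟨fun α hα => (hderiv α hα).differentiableAt.differentiableWithinAt, ?_⟩
    have hZ := continuousOn_lsvMass.mono hsub'
    have hΦ : ContinuousOn (fun α => ∫ x in Ioc (0 : ℝ) 1, lsvDensity α x * φ x)
        (Ioo (αm / 2) u) := fun α hα => (h2 α hα).2.continuousAt.continuousWithinAt
    refine (((h3.mul hZ).sub (hΦ.mul (continuousOn_lsvMassDeriv.mono hsub'))).div (hZ.pow 2)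
      fun α hα => (pow_pos (lsvMass_pos (hsub' hα)) 2).ne').congr fun α hα => ?_
    rw [derivWithin_of_isOpen isOpen_Ioo hα, (hderiv α hα).deriv]
    rfl

end LinearResponse


theorem mainTheorem1 :
    -- each `T_α` has exactly one absolutely continuous invariant probability measure
    (∀ α ∈ Ioo (0 : ℝ) 1, ∃! ν : Measure ℝ, IsLSVAcip α ν) ∧
    ∀ ν : ℝ → Measure ℝ, (∀ α ∈ Ioo (0 : ℝ) 1, IsLSVAcip α (ν α)) →
      -- `ρ α x` is the density and `ρ' α x` is its partial derivative with respect to `α`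
      ∃ ρ ρ' : ℝ → ℝ → ℝ,
        (∀ α ∈ Ioo (0 : ℝ) 1,
          (∀ x ∈ Ioc (0 : ℝ) 1, 0 ≤ ρ α x) ∧
          ν α = (volume.restrict (Icc (0 : ℝ) 1)).withDensity
            (fun x => ENNReal.ofReal (ρ α x))) ∧
        (∀ α ∈ Ioo (0 : ℝ) 1, ∀ x ∈ Ioc (0 : ℝ) 1,
          HasDerivAt (fun a => ρ a x) (ρ' α x) α) ∧
        ContinuousOn (fun p : ℝ × ℝ => ρ p.1 p.2) (Ioo (0 : ℝ) 1 ×ˢ Ioc (0 : ℝ) 1) ∧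
        ContinuousOn (fun p : ℝ × ℝ => ρ' p.1 p.2) (Ioo (0 : ℝ) 1 ×ˢ Ioc (0 : ℝ) 1) ∧
        ∀ αm αp : ℝ, 0 < αm → αm < αp → αp < 1 →
          (∃ K : ℝ, ∀ x ∈ Ioc (0 : ℝ) 1, ∀ α ∈ Icc αm αp,
            ρ α x ≤ K * x ^ (-α) ∧
            |ρ' α x| ≤ K * x ^ (-α) * (1 - Real.log x)) ∧
          ∀ (q : ENNReal) (φ : ℝ → ℝ), ENNReal.ofReal (1 - αp)⁻¹ < q →
            MemLp φ q (volume.restrict (Icc (0 : ℝ) 1)) →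
            (∀ α ∈ Icc αm αp, Integrable φ (ν α)) ∧
            ContDiffOn ℝ 1 (fun α => ∫ x, φ x ∂(ν α)) (Icc αm αp) := by
  refine ⟨fun α hα => ⟨lsvProb α, isLSVAcip_lsvProb hα, fun ν hν => hν.eq_lsvProb hα⟩,
    fun ν hν => ?_⟩
  have hν' : ∀ α ∈ Ioo (0 : ℝ) 1, ν α = lsvProb α := fun α hα => (hν α hα).eq_lsvProb hα
  refine ⟨lsvProbDensity, lsvProbDensityDeriv,
    fun α hα => ⟨fun x hx => (lsvProbDensity_pos hα hx).le, hν' α hα⟩,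
    fun α hα x hx => hasDerivAt_lsvProbDensity hα hx, continuousOn_lsvProbDensity,
    continuousOn_lsvProbDensityDeriv, fun αm αp h0 hmp h1 =>
      ⟨exists_bound_lsvProbDensity h0 h1, fun q φ hq hφ => ?_⟩⟩
  have hsub : ∀ α ∈ Icc αm αp, ν α = lsvProb α := fun α hα =>
    hν' α ⟨h0.trans_le hα.1, hα.2.trans_lt h1⟩
  obtain ⟨h2, h3⟩ := contDiffOn_integral_lsvProb h0 hmp h1 hq hφ
  refine ⟨fun α hα => ?_, h3.congr fun α hα => ?_⟩
  · rw [hsub α hα]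
    exact h2 α hα
  · rw [hsub α hα]
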